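/- Fix an integer $k\ge 1$. Then the following promise problem, the context-free membership problem for black-box groups restricted to grammars in $\mathrm{CFG}(k)$, is in $\mathbf{NP}$ for black-box groups: given a finite group $G$ and a context-free grammar $\mathcal G=(N,G,P,S)$ in Chomsky normal form (all productions have the form $A\to BC$ or $A\to g$ with $A,B,C\in N$, $g\in G$) that belongs to $\mathrm{CFG}(k)$, decide whether $\mathcal G$ derives from $S$ a word $g_1\cdots g_n$ over $G$ whose product in $G$ equals $1$. Here $\mathcal G\in\mathrm{CFG}(k)$ means that every acyclic derivation tree of $\mathcal G$ has Horton–Strahler number at most $k$. A derivation tree has its root labelled $S$ and all its leaves labelled with terminals; it is acyclic if no nonterminal appears twice on a path from the root to a leaf. Its Horton–Strahler number is that of the binary tree obtained by removing the terminal-labelled leaves, where $\mathrm{hs}(t)=0$ for a single node, and for a tree $t$ with subtrees $t_1,t_2$ below the root, $\mathrm{hs}(t)=1+\mathrm{hs}(t_1)$ if $\mathrm{hs}(t_1)=\mathrm{hs}(t_2)$ and $\mathrm{hs}(t)=\max\{\mathrm{hs}(t_1),\mathrm{hs}(t_2)\}$ otherwise. A black box for $G$ with parameters $b,c\in\mathbb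 N$ consists of a map $f:\{0,1\}^b\to G\uplus\{\ast\}$ whose image contains $G$ (a bit string $x$ with $f(x)=g\in G$ is called a name of $g$) together with maps $\mathsf{valid}:\{0,1\}^b\to\{\mathsf{yes},\mathsf{no}\}$, $\mathsf{inv}:\{0,1\}^b\to\{0,1\}^b$, $\mathsf{prod}:\{0,1\}^b\times\{0,1\}^b\to\{0,1\}^b$, $\mathsf{id}:\{0,1\}^b\times\{0,1\}^c\to\{\mathsf{yes},\mathsf{no}\}$ such that $\mathsf{valid}(x)=\mathsf{yes}$ iff $f(x)\in G$, and for all names $x,y$: $f(\mathsf{inv}(x))=f(x)^{-1}$, $f(\mathsf{prod}(x,y))=f(x)f(y)$, and $f(x)=1$ iff $\mathsf{id}(x,z)=\mathsf{yes}$ for some $z\in\{0,1\}^c$. Membership in $\mathbf{NP}$ for black-box groups means that there are one nondeterministic oracle Turing machine $T$ (depending only on $k$), with an oracle tape and four query states through which it can evaluate $\mathsf{valid},\mathsf{inv},\mathsf{prod},\mathsf{id}$ in one step each, and one polynomial $p$ such that, for every finite group $G$ and every black box $B$ for $G$ with parameters $b,c$: - every computation of $T$ coupled with $B$, on an input consisting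 of $b$ and $c$ in unary followed by a word $X$, has at most $p(b+c+|X|)$ steps; - for every $\mathcal G\in\mathrm{CFG}(k)$ as above, if $X$ encodes $\mathcal G$ with every terminal written as an arbitrary one of its names (nonterminals being named by bit strings), then $T$ coupled with $B$ accepts the input $b,c,X$ if and only if $\mathcal G$ derives from $S$ a word with product $1$ in $G$. -/

import Mathlib

namespace BlackBoxGroups

/-! ### Black boxes -/

/-- A black box with code length `b` and witness length `c` for the finite group `G`.
The value `f x = none` plays the role of `f x = ∗`; `true` plays the role of "yes". -/
structure BlackBox (G : Type) [Group G] (b c : ℕ) where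
  f : (Fin b → Bool) → Option G
  f_surj : ∀ g : G, ∃ x, f x = some g
  valid : (Fin b → Bool) → Bool
  valid_spec : ∀ x, valid x = true ↔ ∃ g, f x = some g
  inv : (Fin b → Bool) → (Fin b → Bool)
  inv_spec : ∀ x g, f x = some g → f (inv x) = some g⁻¹
  prod : (Fin b → Bool) → (Fin b → Bool) → (Fin b → Bool)
  prod_spec : ∀ x y g h, f x = some g → f y = some h → f (prod x y) = some (g * h)
  id : (Fin b → Bool) → (Fin c → Bool) → Bool
  id_spec : ∀ x g, f x = some g → (g = 1 ↔ ∃ y, id x y = true)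

/-! ### Tapes -/

/-- A two-way infinite tape with a head; `none` is the blank symbol. -/
structure Tape (Γ : Type) where
  cells : ℤ → Option Γ
  head : ℤ

inductive Move where
  | left
  | stay
  | right

def Move.toInt : Move → ℤ
  | .left => -1
  | .stay => 0
  | .right => 1

namespace Tape

variable {Γ : Type}

def read (t : Tape Γ) : Option Γ := t.cells t.head

/-- Overwrite the scanned cell, then move the head. -/
def writeMove (t : Tape Γ) (s : Option Γ) (m : Move) : Tape Γ where
  cells := Function.update t.cells t.head s
  head := t.head + m.toInt

/-- The tape with the word `w` in the cells `0, …, |w| - 1`, all other cells blank,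
and the head on cell `0`. -/
def ofList (w : List Γ) : Tape Γ where
  cells := fun i => if 0 ≤ i then w[i.toNat]? else none
  head := 0

/-- The `n` bits in the cells `s, …, s + n - 1` (blank cells count as the bit `0`). -/
def bits (t : Tape Bool) (s n : ℕ) : Fin n → Bool :=
  fun i => (t.cells ((s : ℤ) + (i.val : ℤ))).getD false

end Tape

/-! ### Nondeterministic black box Turing machines -/

/-- The fixed input alphabet: the two bits, the unary digit, a separator,
and two symbols that announce the two kinds of productions of a grammar. -/
inductive InputSymbol where
  | bit (x : Bool)
  | unary
  | sep
  | binTag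
  | termTag

/-- The four oracle operations. -/
inductive OracleOp where
  | valid
  | inv
  | prod
  | id

/-- What a machine with `m` work tapes does in one step: the new state, the move on the
(read-only) input tape, the symbols written and the moves on the work tapes and on the oracle tape. -/
structure Action (Q Γ : Type) (m : ℕ) where
  state : Q
  inputMove : Move
  workWrite : Fin m → Option Γ
  workMove : Fin m → Move
  oracleWrite : Option Bool
  oracleMove : Move

/-- A nondeterministic black box Turing machine: a read-only two-way input tape, finitely many
work tapes over a finite alphabet, a binary oracle tape, and four special query states.
`trans q x y z a` says that action `a` is allowed in state `q` when `x`, `y`, `z` are the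
symbols scanned on the input tape, the work tapes and the oracle tape. -/
structure BlackBoxTM where
  State : Type
  finite_state : Finite State
  WorkSymbol : Type
  finite_workSymbol : Finite WorkSymbol
  numWork : ℕ
  start : State
  accept : State → Prop
  query : OracleOp → State
  query_injective : Function.Injective query
  trans : State → Option InputSymbol → (Fin numWork → Option WorkSymbol) → Option Bool →
    Action State WorkSymbol numWork → Prop

namespace BlackBoxTM

structure Config (M : BlackBoxTM) where
  state : M.State
  input : Tape InputSymbol
  work : Fin M.numWork → Tape M.WorkSymbol
  oracle : Tape Bool

def init (M : BlackBoxTM) (w : List InputSymbol) : M.Config where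
  state := M.start
  input := Tape.ofList w
  work := fun _ => Tape.ofList []
  oracle := Tape.ofList []

/-- The configuration after performing an action, before a possible oracle call. -/
def applyAction (M : BlackBoxTM) (C : M.Config) (a : Action M.State M.WorkSymbol M.numWork) :
    M.Config where
  state := a.state
  input := C.input.writeMove C.input.read a.inputMove
  work := fun i => (C.work i).writeMove (a.workWrite i) (a.workMove i)
  oracle := C.oracle.writeMove a.oracleWrite a.oracleMove

/-- The word that an oracle call leaves on the oracle tape. -/
def oracleAnswer {G : Type} [Group G] {b c : ℕ} (B : BlackBox G b c) (t : Tape Bool) :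
    OracleOp → List Bool
  | .valid => [B.valid (t.bits 0 b)]
  | .inv => List.ofFn (B.inv (t.bits 0 b))
  | .prod => List.ofFn (B.prod (t.bits 0 b) (t.bits b b))
  | .id => [B.id (t.bits 0 b) (t.bits b c)]

/-- One step of the machine `M` coupled with the black box `B`. Whenever the step enters a
query state, the oracle tape is overwritten by the answer within the same step. -/
inductive Step (M : BlackBoxTM) {G : Type} [Group G] {b c : ℕ} (B : BlackBox G b c) :
    M.Config → M.Config → Prop
  | plain (C : M.Config) (a : Action M.State M.WorkSymbol M.numWork)
      (h : M.trans C.state C.input.read (fun i => (C.work i).read) C.oracle.read a)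
      (hq : ∀ op, a.state ≠ M.query op) :
      Step M B C (M.applyAction C a)
  | oracle (C : M.Config) (a : Action M.State M.WorkSymbol M.numWork)
      (h : M.trans C.state C.input.read (fun i => (C.work i).read) C.oracle.read a)
      (op : OracleOp) (hq : a.state = M.query op) :
      Step M B C
        { M.applyAction C a with
          oracle := Tape.ofList (oracleAnswer B (M.applyAction C a).oracle op) }

/-- `C'` can be reached from `C` in exactly `n` steps. -/
inductive ReachesIn (M : BlackBoxTM) {G : Type} [Group G] {b c : ℕ} (B : BlackBox G b c) :
    ℕ → M.Config → M.Config → Prop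
  | zero (C : M.Config) : ReachesIn M B 0 C C
  | succ {n : ℕ} {C C' C'' : M.Config} (h : ReachesIn M B n C C') (h' : Step M B C' C'') :
      ReachesIn M B (n + 1) C C''

def Accepts (M : BlackBoxTM) {G : Type} [Group G] {b c : ℕ} (B : BlackBox G b c)
    (w : List InputSymbol) : Prop :=
  ∃ n C, M.ReachesIn B n (M.init w) C ∧ M.accept C.state

/-- Every computation on the input `w` has at most `t` steps. -/
def HaltsWithin (M : BlackBoxTM) {G : Type} [Group G] {b c : ℕ} (B : BlackBox G b c)
    (w : List InputSymbol) (t : ℕ) : Prop :=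
  ∀ n C, M.ReachesIn B n (M.init w) C → n ≤ t

end BlackBoxTM

/-! ### Problems for finite groups and the class NP for black box groups -/

/-- A (promise) problem for finite groups. `Inst α` is the type of the additional data `X`,
with entries from `α` in the place of group elements; `encode` writes such data as a word
when the entries are bit strings. -/
structure GroupProblem where
  Inst : Type → Type
  map : {α β : Type} → (α → β) → Inst α → Inst β
  encode : Inst (List Bool) → List InputSymbol
  promise : (G : Type) → [Group G] → Inst G → Prop
  yes : (G : Type) → [Group G] → Inst G → Prop

/-- The input word `b, c, X` with `b` and `c` in unary. -/
def inputWord (b c : ℕ) (u : List InputSymbol) : List InputSymbol :=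
  List.replicate b .unary ++ .sep :: (List.replicate c .unary ++ .sep :: u)

/-- The (promise) problem `P` belongs to NP for black box groups: a single nondeterministic
black box Turing machine, running in time polynomial in `b + c + |X|` with every black box,
decides the instances `(G, X)` that satisfy the promise, whatever black box for `G` it is coupled
with, and whatever names (bit strings) `Y` are chosen for the group elements in `X`. -/
def InNPForBlackBoxGroups (P : GroupProblem) : Prop :=
  ∃ (M : BlackBoxTM) (p : Polynomial ℕ),
    (∀ (G : Type) [Group G] [Finite G] (b c : ℕ) (B : BlackBox G b c) (u : List InputSymbol),
      M.HaltsWithin B (inputWord b c u) (p.eval (b + c + u.length))) ∧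
    (∀ (G : Type) [Group G] [Finite G] (b c : ℕ) (B : BlackBox G b c)
      (X : P.Inst G) (Y : P.Inst (Fin b → Bool)),
      P.map B.f Y = P.map some X → P.promise G X →
        (M.Accepts B (inputWord b c (P.encode (P.map List.ofFn Y))) ↔ P.yes G X))

/-! ### Context-free grammars in Chomsky normal form -/

/-- A production `A → B C` or `A → a`; nonterminals are named by bit strings. -/
inductive Production (T : Type) where
  | bin (A B C : List Bool)
  | term (A : List Bool) (a : T)

/-- A context-free grammar in Chomsky normal form with terminal alphabet `T`, given by its
start nonterminal and the list of its productions. -/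
structure CNFGrammar (T : Type) where
  start : List Bool
  productions : List (Production T)

namespace Production

variable {T U : Type}

def map (φ : T → U) : Production T → Production U
  | .bin A B C => .bin A B C
  | .term A a => .term A (φ a)

def toRule : Production T → ContextFreeRule T (List Bool)
  | .bin A B C => ⟨A, [.nonterminal B, .nonterminal C]⟩
  | .term A a => ⟨A, [.terminal a]⟩

def encode : Production (List Bool) → List InputSymbol
  | .bin A B C => .binTag ::
      (A.map .bit ++ .sep :: (B.map .bit ++ .sep :: (C.map .bit ++ [.sep])))
  | .term A a => .termTag :: (A.map .bit ++ .sep :: (a.map .bit ++ [.sep]))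

end Production

/-- A tree in which every inner node is labelled with a nonterminal, and has either two such
nodes as children (`node`) or a single child that is a leaf labelled with a terminal (`unit`). -/
inductive DTree (T : Type) where
  | unit (A : List Bool) (a : T)
  | node (A : List Bool) (l r : DTree T)

namespace DTree

variable {T : Type}

def root : DTree T → List Bool
  | .unit A _ => A
  | .node A _ _ => A

/-- The nonterminals along the paths from the root to the leaves. -/
def paths : DTree T → List (List (List Bool))
  | .unit A _ => [[A]]
  | .node A l r => (l.paths ++ r.paths).map (A :: ·)

/-- No nonterminal appears twice on a path from the root to a leaf. -/
def Acyclic (t : DTree T) : Prop := ∀ p ∈ t.paths, p.Nodup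

/-- The Horton-Strahler number of the binary tree that remains when all terminal-labelled
leaves are removed. -/
def hs : DTree T → ℕ
  | .unit _ _ => 0
  | .node _ l r => if l.hs = r.hs then 1 + l.hs else max l.hs r.hs

/-- Every inner node is expanded by a production of `g`. -/
def Respects (g : CNFGrammar T) : DTree T → Prop
  | .unit A a => .term A a ∈ g.productions
  | .node A l r => .bin A l.root r.root ∈ g.productions ∧ l.Respects g ∧ r.Respects g

end DTree

namespace CNFGrammar

variable {T U : Type}

def map (φ : T → U) (g : CNFGrammar T) : CNFGrammar U where
  start := g.start
  productions := g.productions.map (Production.map φ)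

open Classical in
noncomputable def toCFG (g : CNFGrammar T) : ContextFreeGrammar T where
  NT := List Bool
  initial := g.start
  rules := (g.productions.map Production.toRule).toFinset

/-- The encoding of a grammar whose terminals are named by bit strings. -/
def encode (g : CNFGrammar (List Bool)) : List InputSymbol :=
  g.start.map .bit ++ .sep :: g.productions.flatMap Production.encode

def IsDerivationTree (g : CNFGrammar T) (t : DTree T) : Prop :=
  t.root = g.start ∧ t.Respects g

/-- The class `CFG(k)`: all acyclic derivation trees have Horton-Strahler number at most `k`. -/
def InCFG (k : ℕ) (g : CNFGrammar T) : Prop :=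
  ∀ t : DTree T, g.IsDerivationTree t → t.Acyclic → t.hs ≤ k

end CNFGrammar

/-- The context-free membership problem restricted to grammars from `CFG(k)`: given a grammar
whose terminals are elements of `G`, does its language contain a word with value `1` in `G`? -/
noncomputable def cfMembership (k : ℕ) : GroupProblem where
  Inst := CNFGrammar
  map := CNFGrammar.map
  encode := CNFGrammar.encode
  promise := fun _ _ X => X.InCFG k
  yes := fun _ _ X => ∃ w ∈ X.toCFG.language, w.prod = 1

end BlackBoxGroups

/-!
# Context-free membership in black-box groups

A nonterminal `A` of the grammar has the *value* `v` if it derives a word with product `v`; the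
question is whether `1` is a value of the start symbol.

**The algorithm.** The machine keeps a list of *facts* `A ⇒ α`, where `α` is a short form over
nonterminals and names of group elements, saying that `A` derives some form that becomes `α` when
adjacent terminals are multiplied. It starts with the productions. In each round it guesses a fact
and makes one pass over its right-hand side, where every symbol is copied, or replaced by the
right-hand side of a fact for it, or multiplied with its neighbour by the oracle; the result is a
new fact (`NewFact`). It accepts when it has derived a name `x` from the start symbol and a guessed
witness shows that `x` names `1`. Every fact remains true (`NewFact.holding`), so acceptance
implies that `1` is a value, `val_of_program`.

**Polynomially many rounds suffice** (`can_goal`). A *context* from `A` to `C` is a pair of products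
`(u, v)` with `A ⇒* u C v`; the contexts from `A` to itself form a submonoid of `G × Gᵐᵒᵖ`, and
hence a subgroup, as `G` is finite. The number of nonterminals and `log |G|` are at most the input
length.
* The known values of `A` span a subgroup by their quotients, the *heap*. If products of known values
  do not enlarge the heaps, then every value of `A` lies in the heap of `A` times a known value.
  As a heap at least doubles when it grows, few values are needed (`can_covered`).
* Given one context for each connected pair of nonterminals (`can_connected`), the short detours
  from `A` to itself, its *pumps*, generate the group of all contexts from `A` to itself
  (`Con.mul_mem_closure_pumps`).
* As in the reachability lemma of Babai and Szemerédi, a logarithmic number of contexts `z₁, …, z_l`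
  can be found among short products such that every context from `A` to itself is a quotient of two
  elements of the cube `{z₁ ^ e₁ ⋯ z_l ^ e_l | e_i ∈ {0, 1}}` (`can_pumpable`). Inverses are computed as powers.
* In a derivation tree, the part between two occurrences of a nonterminal on a path is a context.
  So every value is obtained from an acyclic tree by inserting a context at every node
  (`Val.exists_dec`). An acyclic tree with bounded Horton-Strahler number has polynomial size
  (`DTree.size_le`), so it can be evaluated bottom-up (`Dec.can_hasVal`).

**The machine.** A program is a regular language of instructions; its executions are those of the
words in the language. Routines are regular expressions, and their effect is derived by composing
the lemmas for products and loops. `inNP_of_program` turns a program into a machine: it simulates a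
finite automaton for the language, whose state is stored on a work tape because the query states
cannot store it, and stops when a clock runs out. The clock consists of `d` tapes of length
`|w| + 1`, on which the heads sweep to and fro like the digits of a counter, so that it
limits the executions to fewer than `(|w| + 2) ^ d` instructions.
-/

namespace BlackBoxGroups

open scoped Computability

/-! ### Regular languages -/

theorem _root_.Language.IsRegular.singleton {α : Type} (i : α) :
    ({[i]} : Language α).IsRegular := by
  rw [Language.isRegular_iff_finite_range_leftQuotient]
  refine Set.Finite.subset (s := {({[i]} : Language α), 1, 0}) (by simp) ?_
  rintro _ ⟨x, rfl⟩
  match x with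
  | [] => simp
  | [a] =>
    by_cases h : a = i
    · subst h
      right; left
      ext y
      change [a] ++ y ∈ ({[a]} : Set (List α)) ↔ y ∈ ({[]} : Set (List α))
      simp
    · right; right
      ext y
      change [a] ++ y ∈ ({[i]} : Set (List α)) ↔ y ∈ (∅ : Set (List α))
      simp [h]
  | a :: a' :: x =>
    right; right
    ext y
    change a :: a' :: x ++ y ∈ ({[i]} : Set (List α)) ↔ y ∈ (∅ : Set (List α))
    simp

/-- After reading `x`, a word of `L * M` is either still in its part from `L`, or a prefix of `x` is
that part. There are only finitely many possibilities for either summand if `L` and `M` are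
regular. -/
theorem _root_.Language.leftQuotient_mul {α : Type} (L M : Language α) (x : List α) :
    (L * M).leftQuotient x =
      L.leftQuotient x * M + ⨆ K ∈ {K | ∃ a b, a ++ b = x ∧ a ∈ L ∧ K = M.leftQuotient b}, K := by
  ext y
  simp only [Language.mem_leftQuotient, Language.mem_add, Language.mem_mul, Language.mem_iSup]
  constructor
  · rintro ⟨a, ha, b, hb, h⟩
    rcases List.append_eq_append_iff.1 h with ⟨c, rfl, rfl⟩ | ⟨c, rfl, rfl⟩
    · right
      exact ⟨_, ⟨a, c, rfl, ha, rfl⟩, hb⟩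
    · left
      exact ⟨c, ha, b, hb, rfl⟩
  · rintro (⟨a, ha, b, hb, rfl⟩ | ⟨K, ⟨a, b, rfl, ha, rfl⟩, hy⟩)
    · exact ⟨x ++ a, ha, b, hb, by simp⟩
    · exact ⟨a, ha, b ++ y, hy, by simp⟩

theorem _root_.Language.IsRegular.mul {α : Type} {L M : Language α} (hL : L.IsRegular)
    (hM : M.IsRegular) : (L * M).IsRegular := by
  rw [Language.isRegular_iff_finite_range_leftQuotient] at *
  have h := Set.Finite.image2 (fun (K : Language α) (S : Set (Language α)) => K * M + ⨆ K ∈ S, K)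
    hL hM.finite_subsets
  refine h.subset ?_
  rintro _ ⟨x, rfl⟩
  rw [Language.leftQuotient_mul]
  refine Set.mem_image2_of_mem ⟨x, rfl⟩ ?_
  rintro _ ⟨a, b, -, -, rfl⟩
  exact ⟨b, rfl⟩

/-- After reading `x`, a word of `L∗` is in the middle of some factor from `L`. -/
theorem _root_.Language.leftQuotient_kstar {α : Type} (L : Language α) (x : List α) (hx : x ≠ []) :
    (L∗).leftQuotient x =
      (⨆ K ∈ {K | ∃ a b, a ++ b = x ∧ a ∈ L∗ ∧ K = L.leftQuotient b}, K) * L∗ := by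
  ext y
  simp only [Language.mem_leftQuotient, Language.mem_mul, Language.mem_iSup]
  constructor
  · rintro ⟨S, hS, hSL⟩
    induction S generalizing x with
    | nil => simp at hS; exact absurd hS.1 hx
    | cons w S ih =>
      simp only [List.flatten_cons] at hS
      have hw := hSL w (by simp)
      have hSL' : ∀ y ∈ S, y ∈ L := fun y hy => hSL y (by simp [hy])
      rcases List.append_eq_append_iff.1 hS with ⟨c, rfl, rfl⟩ | ⟨c, rfl, h⟩
      · exact ⟨c, ⟨_, ⟨[], x, by simp, Language.nil_mem_kstar _, rfl⟩, hw⟩, _,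
          Language.join_mem_kstar hSL', rfl⟩
      · by_cases hc : c = []
        · subst hc
          simp at h
          exact ⟨[], ⟨_, ⟨[], w, by simp, Language.nil_mem_kstar _, rfl⟩, by simpa using hw⟩, _,
            Language.join_mem_kstar hSL', by simp [h]⟩
        · obtain ⟨p, ⟨_, ⟨a, b, rfl, ha, rfl⟩, hp⟩, q, hq, rfl⟩ := ih c hc h.symm hSL'
          refine ⟨p, ⟨_, ⟨w ++ a, b, by simp, ?_, rfl⟩, hp⟩, q, hq, rfl⟩
          obtain ⟨S', rfl, hS'⟩ := ha
          exact ⟨w :: S', by simp, by simpa using ⟨hw, hS'⟩⟩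
  · rintro ⟨p, ⟨_, ⟨a, b, rfl, ⟨S, rfl, hS⟩, rfl⟩, hp⟩, q, ⟨S', rfl, hS'⟩, rfl⟩
    refine ⟨S ++ (b ++ p) :: S', by simp, ?_⟩
    intro y hy
    simp only [List.mem_append, List.mem_cons] at hy
    rcases hy with hy | rfl | hy
    · exact hS y hy
    · exact hp
    · exact hS' y hy

theorem _root_.Language.IsRegular.kstar {α : Type} {L : Language α} (hL : L.IsRegular) :
    (L∗).IsRegular := by
  rw [Language.isRegular_iff_finite_range_leftQuotient] at *
  have h := hL.finite_subsets.image (fun (S : Set (Language α)) => (⨆ K ∈ S, K) * L∗)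
  refine (h.insert (L∗)).subset ?_
  rintro _ ⟨x, rfl⟩
  by_cases hx : x = []
  · left; simp [hx]
  · right
    rw [Language.leftQuotient_kstar _ _ hx]
    refine ⟨_, ?_, rfl⟩
    rintro _ ⟨a, b, -, -, rfl⟩
    exact ⟨b, rfl⟩

/-! ### Programs -/

/-- The alphabet of the work tapes of a program: bits, the end markers of the name of a
nonterminal, of the name of a terminal and of a fact, the goal symbol, and the left end of a tape. -/
inductive WorkSym where
  | bit (x : Bool)
  | nonterm
  | term
  | fin
  | goal
  | hash

instance : Finite WorkSym := by
  refine Finite.of_surjective (α := Fin 7)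
    ![.bit false, .bit true, .nonterm, .term, .fin, .goal, .hash] ?_
  rintro (_ | _) <;> simp only [Fin.exists_fin_succ] <;> simp

instance : Finite OracleOp := by
  refine Finite.of_surjective (α := Fin 4) ![.valid, .inv, .prod, .id] ?_
  rintro (_ | _) <;> simp only [Fin.exists_fin_succ] <;> simp

/-- The symbols scanned on the input tape, on three work tapes, and on the oracle tape. -/
structure Reads where
  inp : Option InputSymbol
  a : Option WorkSym
  b : Option WorkSym
  c : Option WorkSym
  orc : Option Bool

/-- What an instruction does to the tapes. A written symbol `none` leaves the cell as it is,
so no cell is ever erased; `call` is a possible oracle call at the end of the step. -/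
structure Effect where
  inp : Move := .stay
  a : Option WorkSym × Move := (none, .stay)
  b : Option WorkSym × Move := (none, .stay)
  c : Option WorkSym × Move := (none, .stay)
  orc : Option Bool × Move := (none, .stay)
  call : Option OracleOp := none

/-- A deterministic instruction, executable when the scanned symbols satisfy `guard`. -/
structure Instr where
  guard : Reads → Prop
  effect : Reads → Effect

/-- The memory of a program: all tapes except those that implement the control and the clock. -/
structure Mem where
  inp : Tape InputSymbol
  a : Tape WorkSym
  b : Tape WorkSym
  c : Tape WorkSym
  orc : Tape Bool

namespace Tape

variable {Γ : Type}

/-- Write the symbol `e.1`, unless it is `none`, and move. -/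
def act (t : Tape Γ) (e : Option Γ × Move) : Tape Γ := t.writeMove (e.1.or t.read) e.2

theorem writeMove_read (t : Tape Γ) (m : Move) :
    t.writeMove t.read m = ⟨t.cells, t.head + m.toInt⟩ := by
  simp [writeMove, read]

@[simp] theorem act_idle (t : Tape Γ) : t.act (none, .stay) = t := by
  simp [act, writeMove_read, Move.toInt]

end Tape

namespace Mem

/-- The scanned symbols. -/
def reads (m : Mem) : Reads := ⟨m.inp.read, m.a.read, m.b.read, m.c.read, m.orc.read⟩

/-- The memory at the start of a computation on the input `w`. -/
def init (w : List InputSymbol) : Mem :=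
  ⟨Tape.ofList w, Tape.ofList [], Tape.ofList [], Tape.ofList [], Tape.ofList []⟩

variable {G : Type} [Group G] {b c : ℕ} (B : BlackBox G b c)

/-- The oracle tape after a possible oracle call. -/
def answer (t : Tape Bool) : Option OracleOp → Tape Bool
  | none => t
  | some op => Tape.ofList (BlackBoxTM.oracleAnswer B t op)

/-- The memory after a step with the effect `e`. -/
def perform (m : Mem) (e : Effect) : Mem where
  inp := m.inp.act (none, e.inp)
  a := m.a.act e.a
  b := m.b.act e.b
  c := m.c.act e.c
  orc := answer B (m.orc.act e.orc) e.call

end Mem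

/-- The instruction word leads from the first memory to the second one. -/
def Exec {G : Type} [Group G] {b c : ℕ} (B : BlackBox G b c) : List Instr → Mem → Mem → Prop
  | [], m, m' => m = m'
  | i :: w, m, m' => i.guard m.reads ∧ Exec B w (m.perform B (i.effect m.reads)) m'

theorem exec_append {G : Type} [Group G] {b c : ℕ} (B : BlackBox G b c) (v w : List Instr)
    (m m' : Mem) : Exec B (v ++ w) m m' ↔ ∃ m₁, Exec B v m m₁ ∧ Exec B w m₁ m' := by
  induction v generalizing m with
  | nil => simp [Exec]
  | cons i v ih => simp [Exec, ih, and_assoc]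

/-! ### A clock -/

/-- The value of a counter with digits at most `N`, least significant digit first. -/
def clockValue (N : ℕ) {d : ℕ} (rem : Fin d → ℕ) : ℕ := ∑ i, rem i * (N + 1) ^ (i : ℕ)

theorem clockValue_max (N d : ℕ) : clockValue N (fun _ : Fin d => N) + 1 = (N + 1) ^ d := by
  unfold clockValue
  induction d with
  | zero => simp
  | succ d ih =>
    rw [Fin.sum_univ_castSucc]
    simp only [Fin.val_castSucc, Fin.val_last]
    rw [pow_succ]
    linarith

theorem clockValue_succ (N : ℕ) {d : ℕ} (rem : Fin (d + 1) → ℕ) :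
    clockValue N rem = rem 0 + (N + 1) * clockValue N (fun i => rem i.succ) := by
  unfold clockValue
  rw [Fin.sum_univ_succ, Finset.mul_sum]
  simp only [Fin.val_zero, pow_zero, mul_one, Fin.val_succ, add_right_inj]
  refine Finset.sum_congr rfl fun i _ => ?_
  rw [pow_succ]; ring

/-- Counting down by one: the digits below the least nonzero digit `j` become maximal. -/
def clockPred (N : ℕ) {d : ℕ} (rem : Fin d → ℕ) (j : Fin d) : Fin d → ℕ :=
  fun i => if i < j then N else if i = j then rem j - 1 else rem i

theorem clockValue_pred (N : ℕ) {d : ℕ} (rem : Fin d → ℕ) (j : Fin d) (hj : rem j ≠ 0)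
    (hlt : ∀ i < j, rem i = 0) : clockValue N (clockPred N rem j) + 1 = clockValue N rem := by
  induction d with
  | zero => exact j.elim0
  | succ d ih =>
    rw [clockValue_succ, clockValue_succ]
    induction j using Fin.cases with
    | zero =>
      have : (fun i : Fin d => clockPred N rem 0 i.succ) = fun i => rem i.succ := by
        funext i; simp [clockPred]
      rw [this]
      simp [clockPred]
      omega
    | succ j =>
      have h0 : rem 0 = 0 := hlt 0 (by simp)
      have : (fun i : Fin d => clockPred N rem j.succ i.succ) =
          clockPred N (fun i => rem i.succ) j := by
        funext i; simp [clockPred]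
      rw [this, ← ih (fun i => rem i.succ) j hj (fun i hi => hlt _ (by simpa using hi)), h0]
      simp [clockPred]
      ring

theorem exists_least_digit {d : ℕ} (N : ℕ) (rem : Fin d → ℕ) (h : clockValue N rem ≠ 0) :
    ∃ j, rem j ≠ 0 ∧ ∀ i < j, rem i = 0 := by
  have hex : ∃ j, rem j ≠ 0 := by
    by_contra! hc
    exact h (by simp [clockValue, hc])
  classical
  have := wellFounded_lt.has_min {j | rem j ≠ 0} hex
  obtain ⟨j, hj, hmin⟩ := this
  exact ⟨j, hj, fun i hi => by by_contra hc; exact hmin i hc hi⟩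

/-- The move in the direction `x`, where `true` means to the right. -/
def dirMove (x : Bool) : Move := if x then .right else .left

/-- A digit of the clock: a tape with `N` marks on which the head sweeps to and fro.
The value of the digit is the number `rem` of moves to the end of the marks in direction `dir`. -/
def clockTape (N : ℕ) (dir : Bool) (rem : ℕ) : Tape Unit where
  cells i := if 0 ≤ i ∧ i < (N : ℤ) then some () else none
  head := if dir then N - rem else rem - 1

/-- The marks of a clock tape while they are being written. -/
def clockFill (h : ℕ) : Tape Unit where
  cells i := if 0 ≤ i ∧ i < (h : ℤ) then some () else none
  head := h

theorem clockTape_read {N rem : ℕ} (dir : Bool) (h : rem ≤ N) :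
    (clockTape N dir rem).read = none ↔ rem = 0 := by
  cases dir <;> simp [clockTape, Tape.read] <;> omega

theorem clockTape_move (N : ℕ) (dir : Bool) {rem : ℕ} (h : rem ≠ 0) :
    (clockTape N dir rem).act (none, dirMove dir) = clockTape N dir (rem - 1) := by
  obtain ⟨r, rfl⟩ := Nat.exists_eq_succ_of_ne_zero h
  cases dir <;> simp [clockTape, Tape.act, Tape.writeMove_read, dirMove, Move.toInt] <;> ring

theorem clockTape_flip (N : ℕ) (dir : Bool) :
    (clockTape N dir 0).act (none, dirMove (!dir)) = clockTape N (!dir) N := by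
  cases dir <;> simp [clockTape, Tape.act, Tape.writeMove_read, dirMove, Move.toInt]; ring

theorem clockFill_write (h : ℕ) : (clockFill h).act (some (), .right) = clockFill (h + 1) := by
  simp only [clockFill, Tape.act, Tape.writeMove, Option.some_or, Move.toInt, Nat.cast_add,
    Nat.cast_one, Tape.mk.injEq, and_true]
  funext i
  by_cases hi : i = (h : ℤ)
  · subst hi; simp
  · rw [Function.update_of_ne hi]
    congr 1
    simp only [eq_iff_iff]; omega

theorem clockFill_left (h : ℕ) : (clockFill h).act (none, .left) = clockTape h false h := by
  simp [clockFill, clockTape, Tape.act, Tape.writeMove_read, Move.toInt]; ring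

theorem clockFill_zero : clockFill 0 = Tape.ofList [] := by
  simp only [clockFill, Tape.ofList, Nat.cast_zero, List.getElem?_nil, ite_self, Tape.mk.injEq,
    and_true]
  funext i
  rw [if_neg]; omega

/-- One tick of the clock, seen from the scanned symbols `y` of the clock tapes: the tapes before
the first one that is not at its end are reversed, and this one and those before it move on. -/
def Tick {d : ℕ} (dirs : Fin d → Bool) (y : Fin d → Option Unit) (dirs' : Fin d → Bool)
    (mv : Fin d → Move) : Prop :=
  ∃ j, y j ≠ none ∧ (∀ i < j, y i = none) ∧ dirs' = (fun i => if i < j then !dirs i else dirs i) ∧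
    mv = fun i => if i ≤ j then dirMove (dirs' i) else .stay

theorem clockTape_tick {N d : ℕ} (dirs : Fin d → Bool) (rem : Fin d → ℕ) (j i : Fin d)
    (hj : rem j ≠ 0) (hlt : ∀ i < j, rem i = 0) :
    (clockTape N (dirs i) (rem i)).act (none, if i ≤ j then
      dirMove (if i < j then !dirs i else dirs i) else .stay) =
    clockTape N (if i < j then !dirs i else dirs i) (clockPred N rem j i) := by
  rcases lt_trichotomy i j with h | rfl | h
  · simp [h, h.le, clockPred, hlt i h, clockTape_flip]
  · simp [clockPred, clockTape_move _ _ hj]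
  · simp [h.not_gt, h.not_ge, clockPred, h.ne']

/-! ### From programs to machines -/

theorem Tape.map_aux {Γ Δ : Type} (φ : Γ → Δ) (f : ℤ → Option Γ) (i : ℤ) (x : Option Γ) :
    (fun k => (Function.update f i x k).map φ) =
      Function.update (fun k => (f k).map φ) i (x.map φ) := by
  funext k
  by_cases h : k = i
  · subst h; simp
  · simp [h]

/-- Rename the symbols of a tape. -/
def Tape.map {Γ Δ : Type} (φ : Γ → Δ) (t : Tape Γ) : Tape Δ := ⟨fun i => (t.cells i).map φ, t.head⟩

theorem Tape.map_writeMove {Γ Δ : Type} (φ : Γ → Δ) (t : Tape Γ) (x : Option Γ) (mv : Move) :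
    (t.map φ).writeMove (x.map φ) mv = (t.writeMove x mv).map φ := by
  simp [Tape.map, Tape.writeMove, Tape.map_aux]

section Machine

variable {σ : Type} {d : ℕ}

/-- The control symbols: `none` while the input head returns to the start, then the state of
an automaton together with the directions of the clock tapes. -/
abbrev Ctl (σ : Type) (d : ℕ) : Type := Option (σ × (Fin d → Bool))

/-- Symbols of a program, control symbols, and the mark of the clock tapes. -/
abbrev MachineSym (σ : Type) (d : ℕ) : Type := WorkSym ⊕ (Ctl σ d ⊕ Unit)

/-- The symbols scanned on all work tapes, from those of the program, of the control tape and of the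
clock tapes. -/
def workVec (a b c : Option WorkSym) (k : Option (Ctl σ d)) (t : Fin d → Option Unit) :
    Fin (d + 4) → Option (MachineSym σ d) :=
  Fin.cons (a.map Sum.inl) (Fin.cons (b.map Sum.inl) (Fin.cons (c.map Sum.inl)
    (Fin.cons (k.map (Sum.inr ∘ Sum.inl)) fun j => (t j).map (Sum.inr ∘ Sum.inr))))

/-- All work tapes: those of the program, the control tape, and the clock tapes. -/
def workTapes (a b c : Tape WorkSym) (k : Tape (Ctl σ d)) (t : Fin d → Tape Unit) :
    Fin (d + 4) → Tape (MachineSym σ d) :=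
  Fin.cons (a.map Sum.inl) (Fin.cons (b.map Sum.inl) (Fin.cons (c.map Sum.inl)
    (Fin.cons (k.map (Sum.inr ∘ Sum.inl)) fun j => (t j).map (Sum.inr ∘ Sum.inr))))

/-- The moves on all work tapes. -/
def moveVec (a b c k : Move) (t : Fin d → Move) : Fin (d + 4) → Move :=
  Fin.cons a (Fin.cons b (Fin.cons c (Fin.cons k t)))

theorem workTapes_read (a b c : Tape WorkSym) (k : Tape (Ctl σ d)) (t : Fin d → Tape Unit) :
    (fun i => (workTapes a b c k t i).read) =
      workVec a.read b.read c.read k.read fun j => (t j).read := by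
  funext i
  refine Fin.cases rfl (fun i => ?_) i
  refine Fin.cases rfl (fun i => ?_) i
  refine Fin.cases rfl (fun i => ?_) i
  exact Fin.cases rfl (fun i => rfl) i

theorem workTapes_writeMove (a b c : Tape WorkSym) (k : Tape (Ctl σ d)) (t : Fin d → Tape Unit)
    (wa wb wc wk wt ma mb mc mk mt) :
    (fun i => (workTapes a b c k t i).writeMove (workVec wa wb wc wk wt i)
      (moveVec ma mb mc mk mt i)) =
    workTapes (a.writeMove wa ma) (b.writeMove wb mb) (c.writeMove wc mc) (k.writeMove wk mk)
      fun j => (t j).writeMove (wt j) (mt j) := by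
  funext i
  refine Fin.cases (Tape.map_writeMove ..) (fun i => ?_) i
  refine Fin.cases (Tape.map_writeMove ..) (fun i => ?_) i
  refine Fin.cases (Tape.map_writeMove ..) (fun i => ?_) i
  exact Fin.cases (Tape.map_writeMove ..) (fun i => Tape.map_writeMove ..) i

theorem workVec_injective {a b c k t a' b' c' k' t'}
    (h : (workVec a b c k t : Fin (d + 4) → Option (MachineSym σ d)) = workVec a' b' c' k' t') :
    a = a' ∧ b = b' ∧ c = c' ∧ k = k' ∧ t = t' := by
  unfold workVec at h
  simp only [Fin.cons_inj] at h
  obtain ⟨h1, h2, h3, h4, h5⟩ := h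
  refine ⟨Option.map_injective Sum.inl_injective h1, Option.map_injective Sum.inl_injective h2,
    Option.map_injective Sum.inl_injective h3,
    Option.map_injective (Sum.inr_injective.comp Sum.inl_injective) h4, ?_⟩
  funext j
  exact Option.map_injective (Sum.inr_injective.comp Sum.inr_injective) (congrFun h5 j)

/-- The result of a step of the control: whether to accept, the effect on the tapes of the
program, the new control symbol, and the effect on the clock tapes. -/
structure Outcome (σ : Type) (d : ℕ) where
  accept : Bool
  effect : Effect
  ctl : Option (Ctl σ d)
  clock : Fin d → Option Unit × Move

/-- The new state of the machine: `none` is the accepting state, `some none` the ordinary one, and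
`some (some op)` the query state for `op`. -/
def Outcome.state (o : Outcome σ d) : Option (Option OracleOp) :=
  if o.accept then none else some o.effect.call

/-- The steps of the machine that executes the words of the language of `D`. It sets up the clock
with one sweep over the input, and then executes one instruction with each tick of the clock. -/
inductive Control (D : DFA Instr σ) : Reads → Option (Ctl σ d) → (Fin d → Option Unit) →
    Outcome σ d → Prop
  | fwd (r y) (h : r.inp ≠ none) :
      Control D r none y ⟨false, { inp := .right }, none, fun _ => (some (), .right)⟩
  | turn (r y) (h : r.inp = none) :
      Control D r none y ⟨false, { inp := .left }, some none, fun _ => (some (), .right)⟩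
  | back (r y) (h : r.inp ≠ none) :
      Control D r (some none) y ⟨false, { inp := .left }, some none, fun _ => (none, .stay)⟩
  | boot (r y) (h : r.inp = none) :
      Control D r (some none) y ⟨false, { inp := .right }, some (some (D.start, fun _ => false)),
        fun _ => (none, .left)⟩
  | exec (r y s dirs) (i : Instr) (hi : i.guard r) (dirs' mv) (ht : Tick dirs y dirs' mv) :
      Control D r (some (some (s, dirs))) y ⟨false, i.effect r, some (some (D.step s i, dirs')),
        fun j => (none, mv j)⟩
  | accept (r y s dirs) (hs : s ∈ D.accept) :
      Control D r (some (some (s, dirs))) y ⟨true, {}, some (some (s, dirs)),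
        fun _ => (none, .stay)⟩

/-- The action of the machine with the given outcome, when `r` and `y` are the scanned symbols. -/
def Outcome.action (o : Outcome σ d) (r : Reads) (y : Fin d → Option Unit) :
    Action (Option (Option OracleOp)) (MachineSym σ d) (d + 4) where
  state := o.state
  inputMove := o.effect.inp
  workWrite := workVec (o.effect.a.1.or r.a) (o.effect.b.1.or r.b) (o.effect.c.1.or r.c) o.ctl
    fun j => (o.clock j).1.or (y j)
  workMove := moveVec o.effect.a.2 o.effect.b.2 o.effect.c.2 .stay fun j => (o.clock j).2
  oracleWrite := o.effect.orc.1.or r.orc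
  oracleMove := o.effect.orc.2

/-- The machine for the language of the automaton `D`, with `d` clock tapes. The state of `D` is
kept on a work tape, because the four query states of the machine cannot remember it.
The machine state `none` is the accepting one. -/
def machine (D : DFA Instr σ) [Finite σ] (d : ℕ) : BlackBoxTM where
  State := Option (Option OracleOp)
  finite_state := inferInstance
  WorkSymbol := MachineSym σ d
  finite_workSymbol := inferInstance
  numWork := d + 4
  start := some none
  accept q := q = none
  query op := some (some op)
  query_injective := by intro a b h; simpa using h
  trans q x y z a := q ≠ none ∧ ∃ r k t o, x = r.inp ∧ y = workVec r.a r.b r.c k t ∧ z = r.orc ∧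
    Control D r k t o ∧ a = o.action r t

/-- The control tape: a single cell is used, and the head never leaves it. -/
def ctlTape (k : Option (Ctl σ d)) : Tape (Ctl σ d) := ⟨Function.update (fun _ => none) 0 k, 0⟩

theorem ctlTape_read (k : Option (Ctl σ d)) : (ctlTape k).read = k := by
  simp [ctlTape, Tape.read]

theorem ctlTape_write (k k' : Option (Ctl σ d)) :
    (ctlTape k).writeMove k' .stay = ctlTape k' := by
  simp [ctlTape, Tape.writeMove, Move.toInt]

variable (D : DFA Instr σ) [Finite σ]

/-- The configuration with state `q`, memory `m`, control symbol `k` and clock tapes `t`. -/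
def conf (q : Option (Option OracleOp)) (m : Mem) (k : Option (Ctl σ d))
    (t : Fin d → Tape Unit) : (machine D d).Config where
  state := q
  input := m.inp
  work := workTapes m.a m.b m.c (ctlTape k) t
  oracle := m.orc

variable {G : Type} [Group G] {b c : ℕ} (B : BlackBox G b c)

theorem applyAction_conf (q) (m : Mem) (k : Option (Ctl σ d)) (t : Fin d → Tape Unit)
    (o : Outcome σ d) :
    (machine D d).applyAction (conf D q m k t) (o.action m.reads fun j => (t j).read) =
      conf D o.state (m.perform B { o.effect with call := none }) o.ctl
        fun j => (t j).act (o.clock j) := by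
  unfold BlackBoxTM.applyAction conf
  congr 1
  · simp only [Outcome.action]
    erw [workTapes_writeMove]
    rw [ctlTape_write]
    rfl

theorem init_eq_conf (w : List InputSymbol) :
    (machine D d).init w = conf D (some none) (Mem.init w) none fun _ => Tape.ofList [] := by
  unfold BlackBoxTM.init conf
  congr 1
  funext i
  have h1 : ∀ (Γ : Type), Tape.ofList ([] : List Γ) = ⟨fun _ => none, 0⟩ := by
    intro Γ; simp [Tape.ofList]
  have h2 : ctlTape (none : Option (Ctl σ d)) = ⟨fun _ => none, 0⟩ := by
    simp [ctlTape]
  have h3 : ∀ (Γ Δ : Type) (φ : Γ → Δ), Tape.map φ ⟨fun _ => none, 0⟩ = ⟨fun _ => none, 0⟩ := by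
    intro Γ Δ φ; simp [Tape.map]
  simp only [workTapes, Mem.init, h1, h2, h3]
  refine Fin.cases rfl (fun i => ?_) i
  refine Fin.cases rfl (fun i => ?_) i
  refine Fin.cases rfl (fun i => ?_) i
  exact Fin.cases rfl (fun i => rfl) i

/-- The steps of the machine are those of `Control`; in particular, the oracle is called exactly
when the effect of the executed instruction says so. -/
theorem step_conf_iff (q) (m : Mem) (k : Option (Ctl σ d)) (t : Fin d → Tape Unit) (C') :
    (machine D d).Step B (conf D q m k t) C' ↔ q ≠ none ∧ ∃ o : Outcome σ d,
      Control D m.reads k (fun j => (t j).read) o ∧ (o.accept → o.effect.call = none) ∧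
      C' = conf D o.state (m.perform B o.effect) o.ctl fun j => (t j).act (o.clock j) := by
  have key : ∀ a, (machine D d).trans (conf D q m k t).state (conf D q m k t).input.read
      (fun i => ((conf D q m k t).work i).read) (conf D q m k t).oracle.read a ↔
      q ≠ none ∧ ∃ o : Outcome σ d, Control D m.reads k (fun j => (t j).read) o ∧
        a = o.action m.reads fun j => (t j).read := by
    intro a
    change q ≠ none ∧ (∃ (r : Reads) (k' : Option (Ctl σ d)) (t' : Fin d → Option Unit)
      (o : Outcome σ d), m.inp.read = r.inp ∧ _ = _ ∧ m.orc.read = r.orc ∧ _) ↔ _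
    refine and_congr_right fun _ => ?_
    constructor
    · rintro ⟨r, k', t', o, h1, h2, h3, h4, rfl⟩
      have h2' := (workTapes_read m.a m.b m.c (ctlTape k) t).symm.trans h2
      obtain ⟨e1, e2, e3, e4, e5⟩ := workVec_injective h2'
      rw [ctlTape_read] at e4
      have hr : m.reads = r := by
        cases r; simp_all [Mem.reads]
      subst hr e4 e5
      exact ⟨o, h4, rfl⟩
    · rintro ⟨o, h4, rfl⟩
      refine ⟨m.reads, k, _, o, rfl, ?_, rfl, h4, rfl⟩
      refine (workTapes_read m.a m.b m.c (ctlTape k) t).trans ?_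
      rw [ctlTape_read]; rfl
  have hcall : ∀ o : Outcome σ d, Control D m.reads k (fun j => (t j).read) o →
      (o.accept → o.effect.call = none) := by
    intro o ho
    cases ho <;> simp
  constructor
  · intro h
    cases h with
    | plain a h hq =>
      obtain ⟨hq0, o, ho, rfl⟩ := (key _).1 h
      refine ⟨hq0, o, ho, hcall o ho, ?_⟩
      rw [applyAction_conf D B]
      have : o.effect.call = none := by
        by_contra hc
        obtain ⟨op, hop⟩ := Option.ne_none_iff_exists'.1 hc
        apply hq op
        have : o.accept = false := by
          by_contra h'
          exact hc (hcall o ho (by simpa using h'))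
        simp [Outcome.action, Outcome.state, machine, this, hop]
      rw [← this]
    | oracle a h op hq =>
      obtain ⟨hq0, o, ho, rfl⟩ := (key _).1 h
      refine ⟨hq0, o, ho, hcall o ho, ?_⟩
      rw [applyAction_conf D B]
      have : o.effect.call = some op := by
        change (if o.accept then none else some o.effect.call) = some (some op) at hq
        split_ifs at hq
        simpa using hq
      simp only [conf, Mem.perform, this, Mem.answer]
  · rintro ⟨hq0, o, ho, -, rfl⟩
    have hkey := (key _).2 ⟨hq0, o, ho, rfl⟩
    cases hop : o.effect.call with
    | none =>
      have h := BlackBoxTM.Step.plain (B := B) _ _ hkey (by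
        intro op h
        change (if o.accept then none else some o.effect.call) = some (some op) at h
        split_ifs at h
        simp [hop] at h)
      rw [applyAction_conf D B, ← hop] at h
      exact h
    | some op =>
      have hacc : o.accept = false := by
        by_contra h'
        have := hcall o ho (by simpa using h')
        simp [hop] at this
      have h := BlackBoxTM.Step.oracle (B := B) _ _ hkey op (by
        change (if o.accept then none else some o.effect.call) = some (some op)
        simp [hacc, hop])
      rw [applyAction_conf D B] at h
      simpa only [conf, Mem.perform, hop, Mem.answer] using h

end Machine

/-! ### The computations of the machine -/

section Machine

variable {σ : Type} {d : ℕ} (D : DFA Instr σ) [Finite σ]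
variable {G : Type} [Group G] {b c : ℕ} (B : BlackBox G b c)

/-- The memory while the input head moves: it is on cell `h` and nothing else has happened. -/
def scanMem (w : List InputSymbol) (h : ℤ) : Mem :=
  { Mem.init w with inp := ⟨(Tape.ofList w).cells, h⟩ }

theorem scanMem_zero (w : List InputSymbol) : scanMem w 0 = Mem.init w := rfl

theorem scanMem_perform (w : List InputSymbol) (h : ℤ) (mv : Move) :
    (scanMem w h).perform B { inp := mv } = scanMem w (h + mv.toInt) := by
  simp [scanMem, Mem.perform, Mem.init, Mem.answer, Tape.act, Tape.writeMove_read]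
  simp [Move.toInt]

theorem scanMem_read (w : List InputSymbol) (h : ℤ) :
    (scanMem w h).reads.inp = none ↔ h < 0 ∨ (w.length : ℤ) ≤ h := by
  simp only [scanMem, Mem.reads, Tape.read, Tape.ofList]
  by_cases h0 : 0 ≤ h
  · simp [h0]
  · simp [h0]; omega

/-- What the configurations look like after `n` steps on the input `w`: the input head moves to the
end of the input and back, a program is executed, or the machine has accepted. -/
inductive Phase (w : List InputSymbol) : ℕ → (machine D d).Config → Prop
  | fwd (h : ℕ) (hh : h ≤ w.length) :
      Phase w h (conf D (some none) (scanMem w h) none fun _ => clockFill h)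
  | back (h : ℕ) (hh : h ≤ w.length) :
      Phase w (2 * w.length + 1 - h)
        (conf D (some none) (scanMem w (h - 1)) (some none) fun _ => clockFill (w.length + 1))
  | run (q) (v : List Instr) (m : Mem) (dirs : Fin d → Bool) (rem : Fin d → ℕ)
      (hrem : ∀ i, rem i ≤ w.length + 1) (hv : Exec B v (Mem.init w) m)
      (hval : v.length + clockValue (w.length + 1) rem + 1 = (w.length + 2) ^ d) :
      Phase w (2 * w.length + 2 + v.length)
        (conf D (some q) m (some (some (D.eval v, dirs)))
          fun j => clockTape (w.length + 1) (dirs j) (rem j))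
  | accepted (v : List Instr) (m : Mem) (k t) (hv : Exec B v (Mem.init w) m)
      (hacc : v ∈ D.accepts) (hval : v.length + 1 ≤ (w.length + 2) ^ d) :
      Phase w (2 * w.length + 2 + v.length + 1) (conf D none m k t)

variable {D B}

theorem Phase.step {w : List InputSymbol} {n : ℕ} {C C' : (machine D d).Config}
    (hC : Phase D B w n C) (h : (machine D d).Step B C C') : Phase D B w (n + 1) C' := by
  cases hC with
  | fwd h hh =>
    rw [step_conf_iff] at h
    obtain ⟨-, o, ho, -, rfl⟩ := h
    cases ho with
    | fwd _ hne =>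
      have hlt : n < w.length := by
        by_contra hc
        exact hne ((scanMem_read _ _).2 (Or.inr (by omega)))
      simp only [Outcome.state, scanMem_perform, clockFill_write, Move.toInt]
      exact_mod_cast Phase.fwd (n + 1) hlt
    | turn _ hne =>
      rcases (scanMem_read _ _).1 hne with hlt | hge
      · omega
      · have : n = w.length := by omega
        subst this
        simp only [Outcome.state, scanMem_perform, clockFill_write, Move.toInt]
        have := Phase.back (d := d) (D := D) (B := B) (w := w) w.length le_rfl
        rw [show 2 * w.length + 1 - w.length = w.length + 1 by omega] at this
        exact this
  | back h hh =>
    rw [step_conf_iff] at h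
    obtain ⟨-, o, ho, -, rfl⟩ := h
    cases ho with
    | back _ hne =>
      have hlt : h ≠ 0 := by
        rintro rfl
        exact hne ((scanMem_read _ _).2 (Or.inl (by simp)))
      simp only [Outcome.state, scanMem_perform, Tape.act_idle, Move.toInt]
      have := Phase.back (d := d) (D := D) (B := B) (w := w) (h - 1) (by omega)
      rw [show 2 * w.length + 1 - (h - 1) = 2 * w.length + 1 - h + 1 by omega,
        Nat.cast_sub (by omega)] at this
      exact this
    | boot _ hne =>
      have : h = 0 := by
        rcases (scanMem_read _ _).1 hne with hlt | hge <;> omega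
      subst this
      simp only [Outcome.state, scanMem_perform, Move.toInt, clockFill_left]
      have := Phase.run (d := d) (D := D) (B := B) (w := w) none [] (Mem.init w)
        (fun _ => false) (fun _ => w.length + 1) (by simp) rfl (by
          have : _ = (w.length + 2) ^ d := clockValue_max (w.length + 1) d
          simp only [List.length_nil]; omega)
      simpa [← scanMem_zero] using this
  | run q v m dirs rem hrem hv hval =>
    rw [step_conf_iff] at h
    obtain ⟨-, o, ho, -, rfl⟩ := h
    cases ho with
    | exec _ _ _ i hi dirs' mv ht =>
      obtain ⟨j, hj, hlt, rfl, rfl⟩ := ht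
      have hj' : rem j ≠ 0 := by
        intro h0; exact hj ((clockTape_read _ (hrem j)).2 h0)
      have hlt' : ∀ i < j, rem i = 0 := fun i hi => (clockTape_read _ (hrem i)).1 (hlt i hi)
      have := Phase.run (d := d) (D := D) (B := B) (w := w) (i.effect m.reads).call (v ++ [i])
        (m.perform B (i.effect m.reads)) (fun i => if i < j then !dirs i else dirs i)
        (clockPred (w.length + 1) rem j) (by
          intro i
          have := hrem i
          have := hrem j
          simp only [clockPred]
          split_ifs <;> omega)
        ((exec_append ..).2 ⟨m, hv, hi, rfl⟩) (by
          have := clockValue_pred (w.length + 1) rem j hj' hlt'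
          simp only [List.length_append, List.length_singleton]; omega)
      rw [DFA.eval_append_singleton, List.length_append, List.length_singleton] at this
      simp only [clockTape_tick dirs rem j _ hj' hlt', Outcome.state]
      exact this
    | accept _ _ _ hs =>
      exact Phase.accepted v _ _ _ (by simpa [Mem.perform, Mem.answer,
        Tape.act_idle] using hv) hs (by omega)
  | accepted v m k t hv hacc hval =>
    rw [step_conf_iff] at h
    exact absurd rfl h.1

theorem reachesIn_phase {w : List InputSymbol} {n : ℕ} {C : (machine D d).Config}
    (h : (machine D d).ReachesIn B n ((machine D d).init w) C) : Phase D B w n C := by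
  generalize hC0 : (machine D d).init w = C0 at h
  induction h with
  | zero =>
    rw [← hC0, init_eq_conf, ← scanMem_zero, ← clockFill_zero]
    exact Phase.fwd 0 (Nat.zero_le _)
  | succ h h' ih => exact (ih hC0).step h'

/-- The clock bounds every computation, whatever the automaton does. -/
theorem machine_haltsWithin (w : List InputSymbol) :
    (machine D d).HaltsWithin B w (2 * w.length + 2 + (w.length + 2) ^ d) := by
  intro n C h
  have hpow : 1 ≤ (w.length + 2) ^ d := Nat.one_le_pow _ _ (by omega)
  cases reachesIn_phase h <;> omega

theorem reaches_scan (w : List InputSymbol) (h : ℕ) (hh : h ≤ w.length) :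
    ∃ n, (machine D d).ReachesIn B n ((machine D d).init w)
      (conf D (some none) (scanMem w h) none fun _ => clockFill h) := by
  induction h with
  | zero =>
    refine ⟨0, ?_⟩
    rw [init_eq_conf, ← scanMem_zero, ← clockFill_zero]
    exact .zero _
  | succ h ih =>
    obtain ⟨n, hn⟩ := ih (by omega)
    refine ⟨n + 1, hn.succ ?_⟩
    rw [step_conf_iff]
    refine ⟨by simp, _, Control.fwd _ _ ?_, by simp, ?_⟩
    · rw [Ne, scanMem_read]; omega
    · simp [Outcome.state, scanMem_perform, clockFill_write, Move.toInt]

theorem reaches_back (w : List InputSymbol) (h : ℕ) (hh : h ≤ w.length) :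
    ∃ n, (machine D d).ReachesIn B n ((machine D d).init w)
      (conf D (some none) (scanMem w (h - 1)) (some none) fun _ => clockFill (w.length + 1)) := by
  induction hh using Nat.decreasingInduction with
  | of_succ h hh ih =>
    obtain ⟨n, hn⟩ := ih
    refine ⟨n + 1, hn.succ ?_⟩
    rw [step_conf_iff]
    refine ⟨by simp, _, Control.back _ _ ?_, by simp, ?_⟩
    · rw [Ne, scanMem_read]; omega
    · simp [Outcome.state, scanMem_perform, Move.toInt, sub_eq_add_neg]
  | self =>
    obtain ⟨n, hn⟩ := reaches_scan (D := D) (B := B) (d := d) w w.length le_rfl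
    refine ⟨n + 1, hn.succ ?_⟩
    rw [step_conf_iff]
    refine ⟨by simp, _, Control.turn _ _ ?_, by simp, ?_⟩
    · rw [scanMem_read]; omega
    · simp [Outcome.state, scanMem_perform, clockFill_write, Move.toInt]; rfl

/-- An execution of a word that is shorter than the capacity of the clock is simulated by the
machine. -/
theorem reaches_run (w : List InputSymbol) (v : List Instr) (m : Mem)
    (hv : Exec B v (Mem.init w) m) (hlen : v.length < (w.length + 2) ^ d) :
    ∃ n q dirs, ∃ rem : Fin d → ℕ, (∀ i, rem i ≤ w.length + 1) ∧
      v.length + clockValue (w.length + 1) rem + 1 = (w.length + 2) ^ d ∧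
      (machine D d).ReachesIn B n ((machine D d).init w)
        (conf D (some q) m (some (some (D.eval v, dirs)))
          fun j => clockTape (w.length + 1) (dirs j) (rem j)) := by
  induction v using List.reverseRecOn generalizing m with
  | nil =>
    obtain ⟨n, hn⟩ := reaches_back (D := D) (B := B) (d := d) w 0 (Nat.zero_le _)
    obtain rfl : Mem.init w = m := hv
    refine ⟨n + 1, none, fun _ => false, fun _ => w.length + 1, by simp, ?_, hn.succ ?_⟩
    · have : _ = (w.length + 2) ^ d := clockValue_max (w.length + 1) d
      simp only [List.length_nil]; omega
    · rw [step_conf_iff]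
      refine ⟨by simp, _, Control.boot _ _ ?_, by simp, ?_⟩
      · rw [scanMem_read]; simp
      · simp [Outcome.state, scanMem_perform, Move.toInt, clockFill_left, scanMem_zero]
  | append_singleton v i ih =>
    obtain ⟨m₁, hv₁, hi, rfl⟩ := (exec_append ..).1 hv
    rw [List.length_append, List.length_singleton] at hlen
    obtain ⟨n, q, dirs, rem, hrem, hval, hn⟩ := ih m₁ hv₁ (by omega)
    obtain ⟨j, hj, hlt⟩ := exists_least_digit (w.length + 1) rem (by omega)
    refine ⟨n + 1, (i.effect m₁.reads).call, fun i => if i < j then !dirs i else dirs i,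
      clockPred (w.length + 1) rem j, ?_, ?_, hn.succ ?_⟩
    · intro i
      have := hrem i
      have := hrem j
      simp only [clockPred]
      split_ifs <;> omega
    · have := clockValue_pred (w.length + 1) rem j hj hlt
      simp only [List.length_append, List.length_singleton]; omega
    · rw [step_conf_iff]
      refine ⟨by simp, _, Control.exec _ _ _ _ i hi _ _ ⟨j, ?_, ?_, rfl, rfl⟩, by simp, ?_⟩
      · rw [Ne, clockTape_read _ (hrem j)]; exact hj
      · exact fun i hi => (clockTape_read _ (hrem i)).2 (hlt i hi)
      · simp only [clockTape_tick dirs rem j _ hj hlt, Outcome.state]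
        rw [DFA.eval_append_singleton]
        rfl

/-- The machine accepts exactly if some word of the language, with a length below the capacity of
the clock, can be executed. -/
theorem machine_accepts_iff (w : List InputSymbol) :
    (machine D d).Accepts B w ↔
      ∃ v ∈ D.accepts, v.length < (w.length + 2) ^ d ∧ ∃ m, Exec B v (Mem.init w) m := by
  constructor
  · rintro ⟨n, C, h, hacc⟩
    cases reachesIn_phase h with
    | fwd | back | run => exact absurd hacc (by simp [machine, conf])
    | accepted v m k t hv hva hval => exact ⟨v, hva, hval, m, hv⟩
  · rintro ⟨v, hva, hlen, m, hv⟩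
    obtain ⟨n, q, dirs, rem, hrem, hval, hn⟩ := reaches_run (D := D) w v m hv hlen
    refine ⟨n + 1, _, hn.succ ((step_conf_iff ..).2 ⟨by simp, _,
      Control.accept _ _ _ _ hva, by simp, rfl⟩), rfl⟩

end Machine

/-- A problem belongs to NP for black box groups if it is decided by the executions of the words
of a regular language of instructions, and executions of polynomial length suffice. -/
theorem inNP_of_program (P : GroupProblem) (L : Language Instr) (hL : L.IsRegular) (d : ℕ)
    (hsound : ∀ (G : Type) [Group G] [Finite G] (b c : ℕ) (B : BlackBox G b c)
      (X : P.Inst G) (Y : P.Inst (Fin b → Bool)), P.map B.f Y = P.map some X → P.promise G X →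
      ∀ v ∈ L, ∀ m, Exec B v (Mem.init (inputWord b c (P.encode (P.map List.ofFn Y)))) m →
      P.yes G X)
    (hcomplete : ∀ (G : Type) [Group G] [Finite G] (b c : ℕ) (B : BlackBox G b c)
      (X : P.Inst G) (Y : P.Inst (Fin b → Bool)), P.map B.f Y = P.map some X → P.promise G X →
      P.yes G X → ∃ v ∈ L,
      v.length < ((inputWord b c (P.encode (P.map List.ofFn Y))).length + 2) ^ d ∧
      ∃ m, Exec B v (Mem.init (inputWord b c (P.encode (P.map List.ofFn Y)))) m) :
    InNPForBlackBoxGroups P := by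
  obtain ⟨σ, _, D, rfl⟩ := hL
  refine ⟨machine D d, 2 * (.X + 2) + 2 + (.X + 4) ^ d, ?_, ?_⟩
  · intro G _ _ b c B u
    have hlen : (inputWord b c u).length = b + c + u.length + 2 := by
      simp [inputWord]; omega
    have := machine_haltsWithin (D := D) (d := d) (B := B) (inputWord b c u)
    rw [hlen] at this
    simpa [add_assoc] using this
  · intro G _ _ b c B X Y hY hX
    rw [machine_accepts_iff]
    constructor
    · rintro ⟨v, hv, -, m, hm⟩
      exact hsound G b c B X Y hY hX v hv m hm
    · exact hcomplete G b c B X Y hY hX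

/-! ### Tapes as split words -/

namespace Tape

variable {Γ : Type}

/-- The tape with the word `p ++ r` from cell `0` on, and the head on the first symbol of `r`. -/
def split (p r : List Γ) : Tape Γ := ⟨(Tape.ofList (p ++ r)).cells, p.length⟩

theorem ofList_eq_split (w : List Γ) : Tape.ofList w = split [] w := rfl

@[simp] theorem read_split (p r : List Γ) : (split p r).read = r.head? := by
  simp only [read, split, ofList, Nat.cast_nonneg, if_true, Int.toNat_natCast]
  cases r <;> simp

@[simp] theorem act_split_right (p : List Γ) (x : Γ) (r : List Γ) :
    (split p (x :: r)).act (none, .right) = split (p ++ [x]) r := by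
  simp [act, Tape.writeMove_read, split, Move.toInt]

@[simp] theorem act_split_left (p : List Γ) (x : Γ) (r : List Γ) :
    (split (p ++ [x]) r).act (none, .left) = split p (x :: r) := by
  simp [act, Tape.writeMove_read, split, Move.toInt]

@[simp] theorem act_split_write (p : List Γ) (x : Γ) (r : List Γ) :
    (split p r).act (some x, .right) = split (p ++ [x]) r.tail := by
  simp only [act, writeMove, split, Option.some_or, Move.toInt, List.length_append,
    List.length_singleton, Nat.cast_add, Nat.cast_one, mk.injEq, and_true]
  funext i
  by_cases hi : i = (p.length : ℤ)
  · subst hi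
    simp [ofList]
  · rw [Function.update_of_ne hi]
    simp only [ofList]
    by_cases h0 : 0 ≤ i
    · lift i to ℕ using h0
      have hne : i ≠ p.length := by exact_mod_cast hi
      simp only [Nat.cast_nonneg, if_true, Int.toNat_natCast]
      rcases lt_or_gt_of_ne hne with h | h
      · rw [List.getElem?_append_left h, List.append_assoc, List.getElem?_append_left h]
      · rw [List.append_assoc, List.getElem?_append_right h.le, List.getElem?_append_right h.le]
        obtain ⟨j, hj⟩ := Nat.exists_eq_add_of_lt h
        rw [show i - p.length = j + 1 by omega]
        cases r <;> simp
    · simp [h0]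

theorem bits_split {n : ℕ} (x : Fin n → Bool) (u v : List Bool) (p r : List Bool)
    (h : p ++ r = u ++ List.ofFn x ++ v) : (split p r).bits u.length n = x := by
  funext i
  simp only [bits, split, h, ofList]
  rw [if_pos (by positivity)]
  have : ((u.length : ℤ) + (i.val : ℤ)).toNat = u.length + i := by omega
  rw [this, List.append_assoc, List.getElem?_append_right (by omega), Nat.add_sub_cancel_left,
    List.getElem?_append_left (by simp)]
  simp

end Tape

/-! ### Executions of regular expressions -/

section Runs

variable {G : Type} [Group G] {b c : ℕ} (B : BlackBox G b c)

/-- Some instruction word of length `n` in `L` leads from `m` to `m'`. -/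
def Runs (L : Language Instr) (n : ℕ) (m m' : Mem) : Prop :=
  ∃ v ∈ L, v.length = n ∧ Exec B v m m'

/-- The language that consists of a single instruction. -/
def single (i : Instr) : Language Instr := {[i]}

variable {B}

theorem runs_single {i : Instr} {n : ℕ} {m m' : Mem} :
    Runs B (single i) n m m' ↔ i.guard m.reads ∧ n = 1 ∧ m' = m.perform B (i.effect m.reads) := by
  constructor
  · rintro ⟨v, hv, rfl, h⟩
    obtain rfl : v = [i] := hv
    exact ⟨h.1, rfl, h.2.symm⟩
  · rintro ⟨h, rfl, rfl⟩
    exact ⟨[i], rfl, rfl, h, rfl⟩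

theorem runs_mul {K L : Language Instr} {n : ℕ} {m m' : Mem} :
    Runs B (K * L) n m m' ↔ ∃ n₁ n₂ m₁, n = n₁ + n₂ ∧ Runs B K n₁ m m₁ ∧ Runs B L n₂ m₁ m' := by
  constructor
  · rintro ⟨_, ⟨v, hv, w, hw, rfl⟩, rfl, h⟩
    obtain ⟨m₁, h1, h2⟩ := (exec_append ..).1 h
    exact ⟨_, _, m₁, List.length_append, ⟨v, hv, rfl, h1⟩, ⟨w, hw, rfl, h2⟩⟩
  · rintro ⟨_, _, m₁, rfl, ⟨v, hv, rfl, h1⟩, ⟨w, hw, rfl, h2⟩⟩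
    exact ⟨v ++ w, ⟨v, hv, w, hw, rfl⟩, List.length_append, (exec_append ..).2 ⟨m₁, h1, h2⟩⟩

theorem runs_add {K L : Language Instr} {n : ℕ} {m m' : Mem} :
    Runs B (K + L) n m m' ↔ Runs B K n m m' ∨ Runs B L n m m' := by
  constructor
  · rintro ⟨v, hv | hv, h⟩
    · exact .inl ⟨v, hv, h⟩
    · exact .inr ⟨v, hv, h⟩
  · rintro (⟨v, hv, h⟩ | ⟨v, hv, h⟩)
    · exact ⟨v, .inl hv, h⟩
    · exact ⟨v, .inr hv, h⟩

theorem runs_one {n : ℕ} {m m' : Mem} : Runs B 1 n m m' ↔ n = 0 ∧ m' = m := by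
  constructor
  · rintro ⟨v, hv, rfl, h⟩
    obtain rfl : v = [] := hv
    exact ⟨rfl, h.symm⟩
  · rintro ⟨rfl, rfl⟩
    exact ⟨[], rfl, rfl, rfl⟩

theorem runs_star {L : Language Instr} {n : ℕ} {m m' : Mem} :
    Runs B (L∗) n m m' ↔ (n = 0 ∧ m' = m) ∨ Runs B (L * L∗) n m m' := by
  rw [← runs_one (B := B), ← runs_add, Language.one_add_self_mul_kstar_eq_kstar]

theorem Runs.star_nil {L : Language Instr} (m : Mem) : Runs B (L∗) 0 m m :=
  runs_star.2 (.inl ⟨rfl, rfl⟩)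

theorem Runs.mul {K L : Language Instr} {n₁ n₂ : ℕ} {m m₁ m' : Mem} (h₁ : Runs B K n₁ m m₁)
    (h₂ : Runs B L n₂ m₁ m') : Runs B (K * L) (n₁ + n₂) m m' :=
  runs_mul.2 ⟨_, _, _, rfl, h₁, h₂⟩

theorem Runs.star_cons {L : Language Instr} {n₁ n₂ : ℕ} {m m₁ m' : Mem} (h₁ : Runs B L n₁ m m₁)
    (h₂ : Runs B (L∗) n₂ m₁ m') : Runs B (L∗) (n₁ + n₂) m m' :=
  runs_star.2 (.inr (h₁.mul h₂))

/-- A property of the memory that is preserved by the executions of `L` is preserved by those of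
`L∗`. -/
theorem Runs.star_invariant {L : Language Instr} {I : Mem → Prop} {n : ℕ} {m m' : Mem}
    (h : Runs B (L∗) n m m') (hI : ∀ n m m', I m → Runs B L n m m' → I m') (hm : I m) : I m' := by
  obtain ⟨_, ⟨S, rfl, hS⟩, -, hv⟩ := h
  induction S generalizing m with
  | nil =>
    obtain rfl : m = m' := hv
    exact hm
  | cons w S ih =>
    obtain ⟨m₁, h1, h2⟩ := (exec_append ..).1 hv
    exact ih (hI _ m m₁ hm ⟨w, hS w List.mem_cons_self, rfl, h1⟩)
      (fun y hy => hS y (List.mem_cons_of_mem _ hy)) h2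

variable (B)

/-- No word of `L` can be executed. -/
def Stuck (L : Language Instr) (m : Mem) : Prop := ∀ n m', ¬ Runs B L n m m'

/-- All executions of words of `L` have length `k` and end in `m'`, and there is one. -/
def Det (L : Language Instr) (k : ℕ) (m m' : Mem) : Prop :=
  ∀ n m'', Runs B L n m m'' ↔ n = k ∧ m'' = m'

variable {B}

theorem Det.runs {L : Language Instr} {k : ℕ} {m m' : Mem} (h : Det B L k m m') :
    Runs B L k m m' := (h _ _).2 ⟨rfl, rfl⟩

theorem Det.mul_iff {K L : Language Instr} {k n : ℕ} {m m' m'' : Mem} (h : Det B K k m m') :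
    Runs B (K * L) n m m'' ↔ ∃ n', n = k + n' ∧ Runs B L n' m' m'' := by
  rw [runs_mul]
  constructor
  · rintro ⟨n₁, n₂, m₁, rfl, h₁, h₂⟩
    obtain ⟨rfl, rfl⟩ := (h _ _).1 h₁
    exact ⟨_, rfl, h₂⟩
  · rintro ⟨n', rfl, h₂⟩
    exact ⟨_, _, _, rfl, h.runs, h₂⟩

theorem Det.mul {K L : Language Instr} {k k' : ℕ} {m m' m'' : Mem} (h : Det B K k m m')
    (h' : Det B L k' m' m'') : Det B (K * L) (k + k') m m'' := by
  intro n m₁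
  rw [h.mul_iff]
  constructor
  · rintro ⟨n', rfl, h₂⟩
    obtain ⟨rfl, rfl⟩ := (h' _ _).1 h₂
    exact ⟨rfl, rfl⟩
  · rintro ⟨rfl, rfl⟩
    exact ⟨_, rfl, h'.runs⟩

theorem det_single {i : Instr} {m : Mem} (h : i.guard m.reads) :
    Det B (single i) 1 m (m.perform B (i.effect m.reads)) := by
  intro n m'
  simp [runs_single, h]

theorem Det.congr {L : Language Instr} {k : ℕ} {m m' m'' : Mem} (h : Det B L k m m')
    (h' : m' = m'') : Det B L k m m'' := h' ▸ h

theorem stuck_single {i : Instr} {m : Mem} (h : ¬ i.guard m.reads) : Stuck B (single i) m := by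
  intro n m' h'
  exact h (runs_single.1 h').1

theorem Stuck.mul {K : Language Instr} {m : Mem} (h : Stuck B K m) (L : Language Instr) :
    Stuck B (K * L) m := by
  intro n m' h'
  obtain ⟨n₁, n₂, m₁, -, h₁, -⟩ := runs_mul.1 h'
  exact h _ _ h₁

theorem Det.stuck_mul {K L : Language Instr} {k : ℕ} {m m' : Mem} (h : Det B K k m m')
    (h' : Stuck B L m') : Stuck B (K * L) m := by
  intro n m'' h''
  obtain ⟨n', -, h₂⟩ := h.mul_iff.1 h''
  exact h' _ _ h₂

theorem runs_loop_exit {i : Instr} {X : Language Instr} {n : ℕ} {m m' : Mem}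
    (h : ¬ i.guard m.reads) : Runs B ((single i)∗ * X) n m m' ↔ Runs B X n m m' := by
  have hs : Stuck B (single i * (single i)∗) m := (stuck_single h).mul _
  constructor
  · intro h'
    obtain ⟨n₁, n₂, m₁, rfl, h₁, h₂⟩ := runs_mul.1 h'
    rcases runs_star.1 h₁ with ⟨rfl, rfl⟩ | h₁
    · simpa using h₂
    · exact absurd h₁ (hs _ _)
  · intro h'
    simpa using (Runs.star_nil m).mul h'

theorem runs_loop_step {i : Instr} {X : Language Instr} {n : ℕ} {m m' : Mem}
    (h : i.guard m.reads) (hX : Stuck B X m) : Runs B ((single i)∗ * X) n m m' ↔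
      ∃ n', n = n' + 1 ∧ Runs B ((single i)∗ * X) n' (m.perform B (i.effect m.reads)) m' := by
  constructor
  · intro h'
    obtain ⟨n₁, n₂, m₁, rfl, h₁, h₂⟩ := runs_mul.1 h'
    rcases runs_star.1 h₁ with ⟨rfl, rfl⟩ | h₁
    · exact absurd h₂ (hX _ _)
    · obtain ⟨n', rfl, h₃⟩ := (det_single h).mul_iff.1 h₁
      exact ⟨n' + n₂, by omega, h₃.mul h₂⟩
  · rintro ⟨n', rfl, h'⟩
    obtain ⟨n₁, n₂, m₁, rfl, h₁, h₂⟩ := runs_mul.1 h'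
    have := ((det_single h).runs.star_cons h₁).mul h₂
    rwa [show 1 + n₁ + n₂ = n₁ + n₂ + 1 by omega] at this

/-- A loop over the word `u`. When the part `p` of `u` has been processed and the part `q` remains,
the memory is `F p q`; the loop can neither be left early nor be continued after `u`. -/
theorem runs_loop {α : Type} {i : Instr} {X : Language Instr} {n : ℕ} {m' : Mem}
    (F : List α → List α → Mem) (u : List α)
    (hstep : ∀ p x q, u = p ++ x :: q → i.guard (F p (x :: q)).reads ∧
      (F p (x :: q)).perform B (i.effect (F p (x :: q)).reads) = F (p ++ [x]) q ∧
      Stuck B X (F p (x :: q)))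
    (hend : ¬ i.guard (F u []).reads) :
    Runs B ((single i)∗ * X) n (F [] u) m' ↔ ∃ n', n = u.length + n' ∧ Runs B X n' (F u []) m' := by
  suffices ∀ q p n, u = p ++ q → (Runs B ((single i)∗ * X) n (F p q) m' ↔
      ∃ n', n = q.length + n' ∧ Runs B X n' (F u []) m') from this u [] n rfl
  intro q
  induction q with
  | nil =>
    intro p n hp
    rw [List.append_nil] at hp
    subst hp
    rw [runs_loop_exit hend]
    simp
  | cons x q ih =>
    intro p n hp
    obtain ⟨h1, h2, h3⟩ := hstep p x q hp
    rw [runs_loop_step h1 h3, h2]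
    simp only [ih (p ++ [x]) _ (by simpa using hp)]
    constructor
    · rintro ⟨_, rfl, n', rfl, h⟩
      exact ⟨n', by simp; omega, h⟩
    · rintro ⟨n', rfl, h⟩
      exact ⟨q.length + n', by simp; omega, n', rfl, h⟩

theorem det_loop {α : Type} {i : Instr} {X : Language Instr} {k : ℕ} {m m' : Mem}
    (F : List α → List α → Mem) (u : List α) (hm : m = F [] u)
    (hstep : ∀ p x q, u = p ++ x :: q → i.guard (F p (x :: q)).reads ∧
      (F p (x :: q)).perform B (i.effect (F p (x :: q)).reads) = F (p ++ [x]) q ∧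
      Stuck B X (F p (x :: q)))
    (hend : ¬ i.guard (F u []).reads) (hX : Det B X k (F u []) m') :
    Det B ((single i)∗ * X) (u.length + k) m m' := by
  subst hm
  intro n m''
  rw [runs_loop F u hstep hend]
  constructor
  · rintro ⟨n', rfl, h⟩
    obtain ⟨rfl, rfl⟩ := (hX _ _).1 h
    exact ⟨rfl, rfl⟩
  · rintro ⟨rfl, rfl⟩
    exact ⟨k, rfl, hX.runs⟩

theorem stuck_loop {α : Type} {i : Instr} {X : Language Instr} {m : Mem}
    (F : List α → List α → Mem) (u : List α) (hm : m = F [] u)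
    (hstep : ∀ p x q, u = p ++ x :: q → i.guard (F p (x :: q)).reads ∧
      (F p (x :: q)).perform B (i.effect (F p (x :: q)).reads) = F (p ++ [x]) q ∧
      Stuck B X (F p (x :: q)))
    (hend : ¬ i.guard (F u []).reads) (hX : Stuck B X (F u [])) :
    Stuck B ((single i)∗ * X) m := by
  subst hm
  intro n m'' h
  obtain ⟨n', -, h⟩ := (runs_loop F u hstep hend).1 h
  exact hX _ _ h

end Runs

/-! ### The instructions -/

/-- The names of the three work tapes. -/
inductive Sel where
  | a
  | b
  | c

/-- The symbol scanned on a work tape. -/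
def Reads.get (r : Reads) : Sel → Option WorkSym
  | .a => r.a
  | .b => r.b
  | .c => r.c

/-- A work tape. -/
def Mem.get (m : Mem) : Sel → Tape WorkSym
  | .a => m.a
  | .b => m.b
  | .c => m.c

/-- Replace a work tape. -/
def Mem.set (m : Mem) (s : Sel) (t : Tape WorkSym) : Mem :=
  match s with
  | .a => { m with a := t }
  | .b => { m with b := t }
  | .c => { m with c := t }

/-- An effect on a single work tape. -/
def Effect.on (s : Sel) (e : Option WorkSym × Move) : Effect :=
  match s with
  | .a => { a := e }
  | .b => { b := e }
  | .c => { c := e }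

@[simp] theorem Mem.reads_get (m : Mem) (s : Sel) : m.reads.get s = (m.get s).read := by
  cases s <;> rfl

@[simp] theorem Mem.get_set (m : Mem) (s : Sel) (t : Tape WorkSym) : (m.set s t).get s = t := by
  cases s <;> rfl

@[simp] theorem Mem.set_set (m : Mem) (s : Sel) (t t' : Tape WorkSym) :
    (m.set s t).set s t' = m.set s t' := by
  cases s <;> rfl

@[simp] theorem Mem.set_get (m : Mem) (s : Sel) : m.set s (m.get s) = m := by
  cases s <;> rfl

namespace Instr

/-- Move the head of a work tape if the scanned cell satisfies `P`. -/
def scan (s : Sel) (P : Option WorkSym → Prop) (mv : Move) : Instr where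
  guard r := P (r.get s)
  effect _ := .on s (none, mv)

/-- Copy a symbol from the first to the third work tape. -/
def copyAC (P : WorkSym → Prop) : Instr where
  guard r := ∃ x ∈ r.a, P x
  effect r := { a := (none, .right), c := (r.a, .right) }

/-- Copy a symbol from the second to the third work tape. -/
def copyBC (P : WorkSym → Prop) : Instr where
  guard r := ∃ x ∈ r.b, P x
  effect r := { b := (none, .right), c := (r.b, .right) }

/-- Copy a symbol from the third to the first two work tapes. -/
def copyCAB (P : WorkSym → Prop) : Instr where
  guard r := ∃ x ∈ r.c, P x
  effect r := { a := (r.c, .right), b := (r.c, .right), c := (none, .right) }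

/-- Check that the first two work tapes show the same symbol. -/
def compare (P : WorkSym → Prop) : Instr where
  guard r := ∃ x ∈ r.a, x ∈ r.b ∧ P x
  effect _ := { a := (none, .right), b := (none, .right) }

/-- Copy a bit from the first work tape to the oracle tape. -/
def ask : Instr where
  guard r := ∃ x, r.a = some (.bit x)
  effect r := { a := (none, .right), orc := (r.a.bind fun | .bit x => some x | _ => none, .right) }

/-- Copy a bit from the oracle tape to the third work tape. -/
def hear : Instr where
  guard r := r.orc ≠ none
  effect r := { c := (r.orc.map .bit, .right), orc := (none, .right) }

/-- At the end of the word on the oracle tape, write an end marker to the third work tape. -/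
def heard : Instr where
  guard r := r.orc = none
  effect _ := { c := (some .term, .right) }

/-- Call the oracle. -/
def call (op : OracleOp) : Instr where
  guard _ := True
  effect _ := { call := some op }

/-- Write a given bit to the oracle tape. -/
def guess (x : Bool) : Instr where
  guard _ := True
  effect _ := { orc := (some x, .right) }

/-- Check that the answer of the oracle is "yes". -/
def answerYes : Instr where
  guard r := r.orc = some true
  effect _ := {}

/-- Move the input head if the scanned symbol satisfies `P`. -/
def skipInput (P : InputSymbol → Prop) : Instr where
  guard r := ∃ x ∈ r.inp, P x
  effect _ := { inp := .right }

/-- Copy a bit from the input to the first two work tapes. -/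
def loadBit : Instr where
  guard r := ∃ x, r.inp = some (.bit x)
  effect r :=
    let y := r.inp.bind fun | .bit x => some (WorkSym.bit x) | _ => none
    { inp := .right, a := (y, .right), b := (y, .right) }

/-- Replace a separator of the input by the end marker `x` on the first two work tapes. -/
def loadSep (x : WorkSym) : Instr where
  guard r := r.inp = some .sep
  effect _ := { inp := .right, a := (some x, .right), b := (some x, .right) }

/-- Write a given symbol to the first two work tapes. -/
def emit (x : WorkSym) : Instr where
  guard _ := True
  effect _ := { a := (some x, .right), b := (some x, .right) }

/-- Write the left end marks of the work tapes. -/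
def emitHash : Instr where
  guard _ := True
  effect _ := { a := (some .hash, .right), b := (some .hash, .right), c := (some .hash, .right) }

end Instr

section

variable {G : Type} [Group G] {b c : ℕ} (B : BlackBox G b c)

@[simp] theorem Mem.perform_on (m : Mem) (s : Sel) (e) :
    m.perform B (.on s e) = m.set s ((m.get s).act e) := by
  cases s <;> simp [Effect.on, Mem.perform, Mem.set, Mem.get, Mem.answer]

end

/-! ### Deterministic routines -/

section Routines

variable {G : Type} [Group G] {b c : ℕ} (B : BlackBox G b c)

def IsBit (x : WorkSym) : Prop := ∃ y, x = .bit y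

@[simp] theorem isBit_bit (y : Bool) : IsBit (.bit y) := ⟨y, rfl⟩

/-- Move a head to the cell after the left end mark. -/
def rewind (s : Sel) : Language Instr :=
  (single (.scan s (· ≠ some .hash) .left))∗ * single (.scan s (· = some .hash) .right)

/-- Move a head behind the next end marker of a fact. -/
def skipFact (s : Sel) : Language Instr :=
  (single (.scan s (fun x => x ≠ none ∧ x ≠ some .fin) .right))∗ *
    single (.scan s (· = some .fin) .right)

/-- Move a head to the first blank cell. -/
def toEnd (s : Sel) : Language Instr :=
  (single (.scan s (· ≠ none) .right))∗ * single (.scan s (· = none) .stay)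

/-- Copy a word of bits and its end marker, which has to satisfy `P`, from the first to the third
work tape. -/
def copyName (P : WorkSym → Prop) : Language Instr :=
  (single (.copyAC IsBit))∗ * single (.copyAC P)

/-- Copy the rest of a fact, up to its end marker, from the second to the third work tape. -/
def copyRest : Language Instr :=
  (single (.copyBC (· ≠ .fin)))∗ * single (.scan .b (· = some .fin) .right)

/-- Copy the name of a terminal from the first work tape to the oracle tape. -/
def askName : Language Instr :=
  (single .ask)∗ * single (.scan .a (· = some .term) .right)

/-- Copy the answer of the oracle to the third work tape. -/
def hearName : Language Instr := (single .hear)∗ * single .heard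

/-- Check that the same name of a nonterminal stands on the first two work tapes. -/
def compareName : Language Instr :=
  (single (.compare IsBit))∗ * single (.compare (· = .nonterm))

/-- Copy a fact from the third work tape to the first two work tapes. -/
def appendFact : Language Instr :=
  (single (.copyCAB (· ≠ .fin)))∗ * single (.copyCAB (· = .fin))

/-- Copy a word of bits from the input to the first two work tapes, with the end marker `x`. -/
def loadName (x : WorkSym) : Language Instr :=
  (single .loadBit)∗ * single (.loadSep x)

/-- Move the input head behind the next separator, over a unary number. -/
def skipUnary : Language Instr :=
  (single (.skipInput (· = .unary)))∗ * single (.skipInput (· = .sep))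

variable {B}

theorem det_rewind {s : Sel} {m : Mem} {p r w : List WorkSym} (hm : m.get s = .split p r)
    (hw : p ++ r = .hash :: w) (hh : .hash ∉ w) :
    Det B (rewind s) (p.length + 1) m (m.set s (.split [.hash] w)) := by
  have := det_loop (B := B) (i := .scan s (· ≠ some .hash) .left)
    (X := single (.scan s (· = some .hash) .right)) (k := 1) (m := m)
    (m' := m.set s (.split [.hash] w))
    (F := fun p' q => m.set s (.split q.reverse (p'.reverse ++ r))) p.reverse
    (by simp [← hm]) ?_ ?_ ?_
  · unfold rewind
    simpa using this
  · intro p' x q hq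
    have hp : p = q.reverse ++ [x] ++ p'.reverse := by
      rw [← List.reverse_reverse p, hq]; simp
    have hne : (p'.reverse ++ r).head? ≠ some .hash := by
      intro h
      rw [hp] at hw
      rw [List.append_assoc, List.append_assoc] at hw
      cases hqr : q.reverse with
      | nil =>
        rw [hqr] at hw
        simp only [List.nil_append, List.singleton_append, List.cons.injEq] at hw
        rw [hw.2] at h
        exact hh (List.mem_of_mem_head? h)
      | cons y q' =>
        rw [hqr] at hw
        simp only [List.cons_append, List.cons.injEq] at hw
        apply hh
        rw [← hw.2]
        exact List.mem_append_right _
          (List.mem_cons_of_mem _ (by simpa using List.mem_of_mem_head? h))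
    refine ⟨by simpa [Instr.scan] using hne, ?_, stuck_single ?_⟩
    · simp [Instr.scan]
    · simpa [Instr.scan] using hne
  · simp [Instr.scan, hw]
  · have h := det_single (B := B) (i := .scan s (· = some .hash) .right)
      (m := m.set s (.split [] (p ++ r))) (by simp [Instr.scan, hw])
    simpa [Instr.scan, hw] using h

theorem det_skipFact {s : Sel} {m : Mem} {p u r : List WorkSym}
    (hm : m.get s = .split p (u ++ .fin :: r)) (hu : .fin ∉ u) :
    Det B (skipFact s) (u.length + 1) m (m.set s (.split (p ++ u ++ [.fin]) r)) := by
  refine det_loop (F := fun p' q => m.set s (.split (p ++ p') (q ++ .fin :: r))) u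
    (by simp [← hm]) ?_ ?_ ?_
  · intro p' x q hq
    have hx : x ≠ .fin := by rintro rfl; exact hu (by simp [hq])
    refine ⟨by simpa [Instr.scan] using hx, ?_, stuck_single (by simpa [Instr.scan] using hx)⟩
    simp [Instr.scan]
  · simp [Instr.scan]
  · have h := det_single (B := B) (i := .scan s (· = some .fin) .right)
      (m := m.set s (.split (p ++ u) (.fin :: r))) (by simp [Instr.scan])
    simpa [Instr.scan] using h

theorem det_toEnd {s : Sel} {m : Mem} {p r : List WorkSym} (hm : m.get s = .split p r) :
    Det B (toEnd s) (r.length + 1) m (m.set s (.split (p ++ r) [])) := by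
  refine det_loop (F := fun p' q => m.set s (.split (p ++ p') q)) r (by simp [← hm]) ?_ ?_ ?_
  · intro p' x q hq
    refine ⟨by simp [Instr.scan], ?_, stuck_single (by simp [Instr.scan])⟩
    simp [Instr.scan]
  · simp [Instr.scan]
  · have h := det_single (B := B) (i := .scan s (· = none) .stay)
      (m := m.set s (.split (p ++ r) [])) (by simp [Instr.scan])
    simpa [Instr.scan] using h

/-- The memory while a name is copied from the first to the third work tape. -/
def copyMem (m : Mem) (p r pc rc : List WorkSym) (x y : List Bool) : Mem :=
  { m with
    a := .split (p ++ x.map .bit) (y.map .bit ++ r)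
    c := .split (pc ++ x.map .bit) (rc.drop x.length) }

theorem copyName_loop {m : Mem} {p r pc rc : List WorkSym} {P : WorkSym → Prop}
    (hP : ∀ x, ¬ P (.bit x)) (u v : List Bool) (x : Bool) :
    (Instr.copyAC IsBit).guard (copyMem m p r pc rc u (x :: v)).reads ∧
    (copyMem m p r pc rc u (x :: v)).perform B
      ((Instr.copyAC IsBit).effect (copyMem m p r pc rc u (x :: v)).reads) =
        copyMem m p r pc rc (u ++ [x]) v ∧
    Stuck B (single (.copyAC P)) (copyMem m p r pc rc u (x :: v)) := by
  refine ⟨by simp [Instr.copyAC, Mem.reads, copyMem], ?_, stuck_single ?_⟩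
  · simp [Instr.copyAC, Mem.reads, copyMem, Mem.perform, Mem.answer]
  · simpa [Instr.copyAC, Mem.reads, copyMem] using hP x

theorem det_copyName {m : Mem} {p r pc rc : List WorkSym} {x : List Bool} {t : WorkSym}
    {P : WorkSym → Prop} (hP : ∀ x, ¬ P (.bit x)) (ht : P t)
    (ha : m.a = .split p (x.map .bit ++ t :: r)) (hc : m.c = .split pc rc) :
    Det B (copyName P) (x.length + 1) m
      { m with
        a := .split (p ++ (x.map .bit ++ [t])) r
        c := .split (pc ++ (x.map .bit ++ [t])) (rc.drop (x.length + 1)) } := by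
  refine det_loop (F := copyMem m p (t :: r) pc rc) x (by simp [copyMem, ← ha, ← hc])
    (fun u y v _ => copyName_loop hP u v y) ?_ ?_
  · simp only [Instr.copyAC, Mem.reads, copyMem, List.map_nil, List.nil_append, Tape.read_split,
      List.head?_cons, Option.mem_def, Option.some.injEq, exists_eq_left']
    rintro ⟨y, rfl⟩; exact hP y ht
  · have h := det_single (B := B) (i := .copyAC P) (m := copyMem m p (t :: r) pc rc x [])
      (by simpa [Instr.copyAC, Mem.reads, copyMem] using ht)
    simpa [Instr.copyAC, Mem.reads, copyMem, Mem.perform, Mem.answer] using h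

theorem stuck_copyName {m : Mem} {p r pc rc : List WorkSym} {x : List Bool} {t : WorkSym}
    {P : WorkSym → Prop} (hP : ∀ x, ¬ P (.bit x)) (htb : ¬ IsBit t) (ht : ¬ P t)
    (ha : m.a = .split p (x.map .bit ++ t :: r)) (hc : m.c = .split pc rc) :
    Stuck B (copyName P) m := by
  refine stuck_loop (F := copyMem m p (t :: r) pc rc) x (by simp [copyMem, ← ha, ← hc])
    (fun u y v _ => copyName_loop hP u v y) ?_ (stuck_single ?_)
  · simpa [Instr.copyAC, Mem.reads, copyMem] using htb
  · simpa [Instr.copyAC, Mem.reads, copyMem] using ht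

theorem det_copyRest {m : Mem} {p r pc rc u : List WorkSym} (hu : .fin ∉ u)
    (hb : m.b = .split p (u ++ .fin :: r)) (hc : m.c = .split pc rc) :
    Det B copyRest (u.length + 1) m
      { m with b := .split (p ++ (u ++ [.fin])) r, c := .split (pc ++ u) (rc.drop u.length) } := by
  refine det_loop (F := fun x y => { m with
    b := .split (p ++ x) (y ++ .fin :: r), c := .split (pc ++ x) (rc.drop x.length) }) u
    (by simp [← hb, ← hc]) ?_ ?_ ?_
  · intro p' x q hq
    have hx : x ≠ .fin := by rintro rfl; exact hu (by simp [hq])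
    refine ⟨by simpa [Instr.copyBC, Mem.reads] using hx, ?_, stuck_single ?_⟩
    · simp [Instr.copyBC, Mem.reads, Mem.perform, Mem.answer]
    · simpa [Instr.scan, Mem.get] using hx
  · simp [Instr.copyBC, Mem.reads]
  · refine (det_single (i := .scan .b (· = some .fin) .right) ?_).congr ?_
    · simp [Instr.scan, Mem.get]
    · simp [Instr.scan, Mem.get, Mem.set]

/-- The memory while a name is copied to the oracle tape. -/
def askMem (m : Mem) (p r : List WorkSym) (po ro : List Bool) (x y : List Bool) : Mem :=
  { m with
    a := .split (p ++ x.map .bit) (y.map .bit ++ r)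
    orc := .split (po ++ x) (ro.drop x.length) }

theorem askName_loop {m : Mem} {p r : List WorkSym} {po ro : List Bool} (u v : List Bool)
    (x : Bool) :
    Instr.ask.guard (askMem m p r po ro u (x :: v)).reads ∧
    (askMem m p r po ro u (x :: v)).perform B
      (Instr.ask.effect (askMem m p r po ro u (x :: v)).reads) =
        askMem m p r po ro (u ++ [x]) v ∧
    Stuck B (single (.scan .a (· = some .term) .right)) (askMem m p r po ro u (x :: v)) := by
  refine ⟨by simp [Instr.ask, Mem.reads, askMem], ?_, stuck_single ?_⟩
  · simp [Instr.ask, Mem.reads, askMem, Mem.perform, Mem.answer]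
  · simp [Instr.scan, askMem, Mem.get]

theorem det_askName {m : Mem} {p r : List WorkSym} {x po ro : List Bool}
    (ha : m.a = .split p (x.map .bit ++ .term :: r)) (ho : m.orc = .split po ro) :
    Det B askName (x.length + 1) m
      { m with
        a := .split (p ++ (x.map .bit ++ [.term])) r
        orc := .split (po ++ x) (ro.drop x.length) } := by
  refine det_loop (F := askMem m p (.term :: r) po ro) x (by simp [askMem, ← ha, ← ho])
    (fun u y v _ => askName_loop u v y) ?_ ?_
  · simp [Instr.ask, Mem.reads, askMem]
  · refine (det_single (i := .scan .a (· = some .term) .right) ?_).congr ?_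
    · simp [Instr.scan, askMem, Mem.get]
    · simp [Instr.scan, askMem, Mem.get, Mem.set]

theorem stuck_askName {m : Mem} {p r : List WorkSym} {x po ro : List Bool} {t : WorkSym}
    (htb : ¬ IsBit t) (ht : t ≠ .term)
    (ha : m.a = .split p (x.map .bit ++ t :: r)) (ho : m.orc = .split po ro) :
    Stuck B askName m := by
  refine stuck_loop (F := askMem m p (t :: r) po ro) x (by simp [askMem, ← ha, ← ho])
    (fun u y v _ => askName_loop u v y) ?_ (stuck_single ?_)
  · simpa [Instr.ask, Mem.reads, askMem, IsBit] using htb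
  · simpa [Instr.scan, askMem, Mem.get] using ht

theorem det_hearName {m : Mem} {pc rc : List WorkSym} {x : List Bool}
    (ho : m.orc = .split [] x) (hc : m.c = .split pc rc) :
    Det B hearName (x.length + 1) m
      { m with
        c := .split (pc ++ (x.map .bit ++ [.term])) (rc.drop (x.length + 1))
        orc := .split x [] } := by
  refine det_loop (F := fun u v => { m with
    c := .split (pc ++ u.map .bit) (rc.drop u.length), orc := .split u v }) x
    (by simp [← ho, ← hc]) ?_ ?_ ?_
  · intro u y v _
    refine ⟨by simp [Instr.hear, Mem.reads], ?_, stuck_single ?_⟩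
    · simp [Instr.hear, Mem.reads, Mem.perform, Mem.answer]
    · simp [Instr.heard, Mem.reads]
  · simp [Instr.hear, Mem.reads]
  · refine (det_single (i := .heard) ?_).congr ?_
    · simp [Instr.heard, Mem.reads]
    · simp [Instr.heard, Mem.perform, Mem.answer]

theorem runs_compareName {m m' : Mem} {n : ℕ} {p r p' r' : List WorkSym} {x x' : List Bool}
    {t t' : WorkSym} (ht : ¬ IsBit t) (ht' : ¬ IsBit t')
    (ha : m.a = .split p (x.map .bit ++ t :: r)) (hb : m.b = .split p' (x'.map .bit ++ t' :: r')) :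
    Runs B compareName n m m' ↔ x = x' ∧ t = .nonterm ∧ t' = .nonterm ∧ n = x.length + 1 ∧
      m' = { m with
        a := .split (p ++ (x.map .bit ++ [t])) r
        b := .split (p' ++ (x'.map .bit ++ [t'])) r' } := by
  induction x generalizing m p p' x' n with
  | nil =>
    unfold compareName
    rw [runs_loop_exit, runs_single]
    · cases x' with
      | nil =>
        simp only [Instr.compare, Mem.reads, ha, hb, List.map_nil, List.nil_append,
          Tape.read_split, List.head?_cons, Option.mem_def, Option.some.injEq, exists_eq_left',
          Mem.perform, Mem.answer, Tape.act_split_right, Tape.act_idle, List.length_nil, zero_add,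
          true_and]
        constructor
        · rintro ⟨⟨rfl, rfl⟩, rfl, rfl⟩; simp
        · rintro ⟨rfl, rfl, rfl, rfl⟩; simp
      | cons y x' =>
        simp only [Instr.compare, Mem.reads, ha, hb, List.map_nil, List.nil_append,
          Tape.read_split, List.head?_cons, Option.mem_def, Option.some.injEq, exists_eq_left',
          List.map_cons, List.cons_append]
        constructor
        · rintro ⟨⟨h, rfl⟩, -⟩; simp at h
        · rintro ⟨h, -⟩; simp at h
    · simpa [Instr.compare, Mem.reads, ha, hb] using fun _ => ht
  | cons y x ih =>
    unfold compareName
    have hstuck : Stuck B (single (.compare (· = .nonterm))) m :=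
      stuck_single (by simp [Instr.compare, Mem.reads, ha, hb])
    by_cases hg : (Instr.compare IsBit).guard m.reads
    · rw [runs_loop_step hg hstuck]
      cases x' with
      | nil =>
        simp only [Instr.compare, Mem.reads, ha, hb, List.map_nil, List.nil_append,
          Tape.read_split, List.head?_cons, Option.mem_def, Option.some.injEq, exists_eq_left',
          List.map_cons, List.cons_append] at hg
        exact absurd ⟨_, hg.1⟩ ht'
      | cons y' x' =>
        have hy : y' = y := by
          simpa [Instr.compare, Mem.reads, ha, hb] using hg
        subst hy
        have key := fun n' => ih (n := n') (p := p ++ [.bit y']) (p' := p' ++ [.bit y']) (x' := x')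
          (m := m.perform B ((Instr.compare IsBit).effect m.reads))
          (by simp [Instr.compare, Mem.perform, ha]) (by simp [Instr.compare, Mem.perform, hb])
        unfold compareName at key
        simp only [key]
        simp only [List.append_assoc, List.cons_append, List.nil_append, List.cons.injEq, true_and,
          List.length_cons, List.map_cons, Instr.compare, Mem.perform, Mem.answer, Tape.act_idle]
        constructor
        · rintro ⟨n', rfl, rfl, rfl, rfl, rfl, rfl⟩; simp
        · rintro ⟨rfl, rfl, rfl, rfl, rfl⟩; simp
    · rw [runs_loop_exit hg]
      refine iff_of_false (hstuck _ _) ?_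
      rintro ⟨rfl, -⟩
      exact hg (by simp [Instr.compare, Mem.reads, ha, hb])

theorem det_appendFact {m : Mem} {p pa pb u r : List WorkSym} (hu : .fin ∉ u)
    (hc : m.c = .split p (u ++ .fin :: r)) (ha : m.a = .split pa []) (hb : m.b = .split pb []) :
    Det B appendFact (u.length + 1) m
      { m with
        a := .split (pa ++ (u ++ [.fin])) []
        b := .split (pb ++ (u ++ [.fin])) []
        c := .split (p ++ (u ++ [.fin])) r } := by
  refine det_loop (F := fun x y => { m with
    a := .split (pa ++ x) [], b := .split (pb ++ x) [], c := .split (p ++ x) (y ++ .fin :: r) }) u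
    (by simp [← hb, ← hc, ← ha]) ?_ ?_ ?_
  · intro p' x q hq
    have hx : x ≠ .fin := by rintro rfl; exact hu (by simp [hq])
    refine ⟨by simpa [Instr.copyCAB, Mem.reads] using hx, ?_, stuck_single ?_⟩
    · simp [Instr.copyCAB, Mem.reads, Mem.perform, Mem.answer]
    · simpa [Instr.copyCAB, Mem.reads] using hx
  · simp [Instr.copyCAB, Mem.reads]
  · refine (det_single (i := .copyCAB (· = .fin)) ?_).congr ?_
    · simp [Instr.copyCAB, Mem.reads]
    · simp [Instr.copyCAB, Mem.reads, Mem.perform, Mem.answer]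

/-- The memory while a name is copied from the input. -/
def loadMem (m : Mem) (pi ri : List InputSymbol) (pa pb : List WorkSym) (x y : List Bool) : Mem :=
  { m with
    inp := .split (pi ++ x.map .bit) (y.map .bit ++ ri)
    a := .split (pa ++ x.map .bit) []
    b := .split (pb ++ x.map .bit) [] }

theorem det_loadName {m : Mem} {pi ri : List InputSymbol} {pa pb : List WorkSym} {x : List Bool}
    (t : WorkSym) (hi : m.inp = .split pi (x.map .bit ++ .sep :: ri)) (ha : m.a = .split pa [])
    (hb : m.b = .split pb []) :
    Det B (loadName t) (x.length + 1) m
      { m with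
        inp := .split (pi ++ (x.map .bit ++ [.sep])) ri
        a := .split (pa ++ (x.map .bit ++ [t])) []
        b := .split (pb ++ (x.map .bit ++ [t])) [] } := by
  refine det_loop (F := loadMem m pi (.sep :: ri) pa pb) x (by simp [loadMem, ← hi, ← ha, ← hb])
    ?_ ?_ ?_
  · intro u y v _
    refine ⟨by simp [Instr.loadBit, Mem.reads, loadMem], ?_, stuck_single ?_⟩
    · simp [Instr.loadBit, Mem.reads, loadMem, Mem.perform, Mem.answer]
    · simp [Instr.loadSep, Mem.reads, loadMem]
  · simp [Instr.loadBit, Mem.reads, loadMem]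
  · refine (det_single (i := .loadSep t) ?_).congr ?_
    · simp [Instr.loadSep, Mem.reads, loadMem]
    · simp [Instr.loadSep, loadMem, Mem.perform, Mem.answer]

theorem det_skipUnary {m : Mem} {pi ri : List InputSymbol} {k : ℕ}
    (hi : m.inp = .split pi (List.replicate k .unary ++ .sep :: ri)) :
    Det B skipUnary (k + 1) m
      { m with inp := .split (pi ++ (List.replicate k .unary ++ [.sep])) ri } := by
  have := det_loop (B := B) (i := .skipInput (· = .unary)) (X := single (.skipInput (· = .sep)))
    (m := m) (k := 1) (m' := { m with inp := .split (pi ++ (List.replicate k .unary ++ [.sep])) ri })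
    (F := fun u v => { m with inp := .split (pi ++ u) (v ++ .sep :: ri) })
    (List.replicate k .unary) (by simp [← hi]) ?_ ?_ ?_
  · unfold skipUnary
    simpa using this
  · intro u y v h
    have hy : y = .unary := List.eq_of_mem_replicate (n := k) (by simp [h])
    subst hy
    refine ⟨by simp [Instr.skipInput, Mem.reads], ?_, stuck_single ?_⟩
    · simp [Instr.skipInput, Mem.perform, Mem.answer]
    · simp [Instr.skipInput, Mem.reads]
  · simp [Instr.skipInput, Mem.reads]
  · refine (det_single (i := .skipInput (· = .sep)) ?_).congr ?_
    · simp [Instr.skipInput, Mem.reads]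
    · simp [Instr.skipInput, Mem.perform, Mem.answer]

end Routines

/-! ### Facts and their derivation -/

/-- A symbol of a sentential form: a nonterminal, or a bit string that names a group element. -/
abbrev FSym (b : ℕ) : Type := List Bool ⊕ (Fin b → Bool)

/-- A fact `A ⇒ α`: from `A` a sentential form is derivable that becomes `α` when some adjacent
terminals are multiplied. The left-hand side `none` stands for a new start symbol, called the
goal, from which the start symbol of the grammar is derivable. -/
abbrev Fact (b : ℕ) : Type := Option (List Bool) × List (FSym b)

section

variable {b : ℕ}

/-- A name with an end marker that tells nonterminals from terminals. -/
def encSym : FSym b → List WorkSym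
  | .inl A => A.map .bit ++ [.nonterm]
  | .inr x => (List.ofFn x).map .bit ++ [.term]

def encSyms (α : List (FSym b)) : List WorkSym := α.flatMap encSym

/-- The encoding of a left-hand side. The goal symbol takes the place of a name, so that no
nonterminal can be mistaken for it. -/
def encLhs : Option (List Bool) → List WorkSym
  | none => [.goal]
  | some A => A.map .bit ++ [.nonterm]

/-- The encoding of a fact without its end marker. -/
def encBody (F : Fact b) : List WorkSym := encLhs F.1 ++ encSyms F.2

/-- The content of the first two work tapes behind the left end mark. -/
def encFacts (db : List (Fact b)) : List WorkSym := db.flatMap fun F => encBody F ++ [.fin]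

@[simp] theorem encSyms_nil : encSyms ([] : List (FSym b)) = [] := rfl

@[simp] theorem encSyms_cons (s : FSym b) (α : List (FSym b)) :
    encSyms (s :: α) = encSym s ++ encSyms α := rfl

@[simp] theorem encSyms_append (α β : List (FSym b)) :
    encSyms (α ++ β) = encSyms α ++ encSyms β := by
  simp [encSyms]

@[simp] theorem encFacts_nil : encFacts ([] : List (Fact b)) = [] := rfl

@[simp] theorem encFacts_cons (F : Fact b) (db : List (Fact b)) :
    encFacts (F :: db) = encBody F ++ .fin :: encFacts db := by
  simp [encFacts]

@[simp] theorem encFacts_append (db db' : List (Fact b)) :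
    encFacts (db ++ db') = encFacts db ++ encFacts db' := by
  simp [encFacts]

theorem exists_encSym_eq (s : FSym b) : ∃ (x : List Bool) (t : WorkSym),
    encSym s = x.map .bit ++ [t] ∧ (t = .nonterm ∨ t = .term) := by
  cases s with
  | inl A => exact ⟨A, .nonterm, rfl, .inl rfl⟩
  | inr x => exact ⟨List.ofFn x, .term, rfl, .inr rfl⟩

theorem exists_encLhs_eq (L : Option (List Bool)) : ∃ (x : List Bool) (t : WorkSym),
    encLhs L = x.map .bit ++ [t] ∧
    (t = .nonterm ∧ L = some x ∨ t = .goal ∧ L = none) := by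
  cases L with
  | none => exact ⟨[], .goal, rfl, .inr ⟨rfl, rfl⟩⟩
  | some A => exact ⟨A, .nonterm, rfl, .inl ⟨rfl, rfl⟩⟩

theorem fin_notMem_encSyms (α : List (FSym b)) : .fin ∉ encSyms α := by
  induction α with
  | nil => simp
  | cons s α ih =>
    obtain ⟨x, t, h, rfl | rfl⟩ := exists_encSym_eq s <;> simp [h, ih]

theorem hash_notMem_encSyms (α : List (FSym b)) : .hash ∉ encSyms α := by
  induction α with
  | nil => simp
  | cons s α ih =>
    obtain ⟨x, t, h, rfl | rfl⟩ := exists_encSym_eq s <;> simp [h, ih]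

theorem fin_notMem_encBody (F : Fact b) : .fin ∉ encBody F := by
  obtain ⟨x, t, h, ⟨rfl, -⟩ | ⟨rfl, -⟩⟩ := exists_encLhs_eq F.1 <;>
    simp [encBody, h, fin_notMem_encSyms]

theorem hash_notMem_encBody (F : Fact b) : .hash ∉ encBody F := by
  obtain ⟨x, t, h, ⟨rfl, -⟩ | ⟨rfl, -⟩⟩ := exists_encLhs_eq F.1 <;>
    simp [encBody, h, hash_notMem_encSyms]

theorem hash_notMem_encFacts (db : List (Fact b)) : .hash ∉ encFacts db := by
  induction db with
  | nil => simp
  | cons F db ih => simp [ih, hash_notMem_encBody]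

theorem length_le_encSyms (α : List (FSym b)) : α.length ≤ (encSyms α).length := by
  induction α with
  | nil => simp
  | cons s α ih =>
    obtain ⟨x, t, h, -⟩ := exists_encSym_eq s
    simp [h]; omega

variable {G : Type} [Group G] {c : ℕ} (B : BlackBox G b c)

/-- The beginning `α` of a sentential form is processed up to its remainder `α'`, where a symbol
is copied, replaced with the help of a known fact, or two terminals are multiplied. -/
inductive PassStep (db : List (Fact b)) : List (FSym b) → List (FSym b) → List (FSym b) → Prop
  | copy (s α) : PassStep db (s :: α) α [s]
  | subst (A γ α) (h : (some A, γ) ∈ db) : PassStep db (.inl A :: α) α γ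
  | mul (x y α) : PassStep db (.inr x :: .inr y :: α) α [.inr (B.prod x y)]

/-- The second sentential form results from the first one by one pass. -/
inductive Pass (db : List (Fact b)) : List (FSym b) → List (FSym b) → Prop
  | nil : Pass db [] []
  | step {α α' β γ} (h : PassStep B db α α' β) (h' : Pass db α' γ) : Pass db α (β ++ γ)

/-- A fact that is obtained from known facts by a single pass. -/
def NewFact (db : List (Fact b)) (F : Fact b) : Prop :=
  ∃ α, (F.1, α) ∈ db ∧ Pass B db α F.2

end

/-! ### A round of the program -/

/-- Move a head to the beginning of some fact, or to the end of the last one. -/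
def gotoFact (s : Sel) : Language Instr := rewind s * (skipFact s)∗

/-- Copy the next symbol of a fact. -/
def copySym : Language Instr := copyName fun x => x = .nonterm ∨ x = .term

/-- Replace the next symbol of a fact with the help of a fact that has it as its left-hand side. -/
def substSym : Language Instr := gotoFact .b * (compareName * copyRest)

/-- Multiply the next two terminals of a fact. The first oracle call just brings the head of the
oracle tape to cell `0`. -/
def mulSym : Language Instr :=
  single (.call .valid) * (askName * (askName * (single (.call .prod) * hearName)))

/-- Execute a `PassStep`. -/
def passStep : Language Instr := copySym + (substSym + mulSym)

/-- Choose a fact, make a pass over it, and append the result to the list of facts. -/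
def round : Language Instr :=
  rewind .c * (gotoFact .a * (copyName (fun x => x = .nonterm ∨ x = .goal) * (passStep∗ *
    (single (.copyAC (· = .fin)) * (rewind .c * (toEnd .a * (toEnd .b * appendFact)))))))

section

variable {G : Type} [Group G] {b c : ℕ} {B : BlackBox G b c}

/-- The tape contains the word `w`, preceded by the left end mark. -/
def Holds (t : Tape WorkSym) (w : List WorkSym) : Prop :=
  ∃ p r, t = .split p r ∧ p ++ r = .hash :: w

theorem stuck_skipFact_nil {s : Sel} {m : Mem} {p : List WorkSym} (h : m.get s = .split p []) :
    Stuck B (skipFact s) m := by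
  refine stuck_loop (F := fun _ _ => m) ([] : List Unit) rfl (by simp) ?_ (stuck_single ?_)
  · simp [Instr.scan, h]
  · simp [Instr.scan, h]

theorem stuck_compareName_nil {m : Mem} {p : List WorkSym} (h : m.b = .split p []) :
    Stuck B compareName m := by
  refine stuck_loop (F := fun _ _ => m) ([] : List Unit) rfl (by simp) ?_ (stuck_single ?_)
  · simp [Instr.compare, h, Mem.reads]
  · simp [Instr.compare, h, Mem.reads]

theorem runs_gotoFact {s : Sel} {m m' : Mem} {n : ℕ} {db : List (Fact b)}
    (hm : Holds (m.get s) (encFacts db)) (h : Runs B (gotoFact s) n m m') :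
    ∃ db₁ db₂, db = db₁ ++ db₂ ∧
      m' = m.set s (.split (.hash :: encFacts db₁) (encFacts db₂)) := by
  obtain ⟨p, r, hp, hr⟩ := hm
  obtain ⟨n', -, h'⟩ := (det_rewind hp hr (hash_notMem_encFacts _)).mul_iff.1 h
  refine h'.star_invariant (I := fun m' => ∃ db₁ db₂, db = db₁ ++ db₂ ∧
      m' = m.set s (.split (.hash :: encFacts db₁) (encFacts db₂))) ?_ ⟨[], db, rfl, rfl⟩
  rintro n m₁ m₂ ⟨db₁, db₂, rfl, rfl⟩ hrun
  cases db₂ with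
  | nil => exact absurd hrun (stuck_skipFact_nil (Mem.get_set ..) _ _)
  | cons F db₂ =>
    rw [encFacts_cons] at hrun
    obtain ⟨-, rfl⟩ := (det_skipFact (Mem.get_set ..) (fin_notMem_encBody F) _ _).1 hrun
    exact ⟨db₁ ++ [F], db₂, by simp, by simp⟩

theorem exists_runs_gotoFact {s : Sel} {m : Mem} {db₁ db₂ : List (Fact b)}
    (hm : Holds (m.get s) (encFacts (db₁ ++ db₂))) :
    ∃ n ≤ 2 * (encFacts (db₁ ++ db₂)).length + 2, Runs B (gotoFact s) n m
      (m.set s (.split (.hash :: encFacts db₁) (encFacts db₂))) := by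
  obtain ⟨p, r, hp, hr⟩ := hm
  have h1 := (det_rewind (B := B) hp hr (hash_notMem_encFacts _)).runs
  have hpl : p.length ≤ (encFacts (db₁ ++ db₂)).length + 1 := by
    have := congrArg List.length hr
    simp only [List.length_append, List.length_cons] at this ⊢; omega
  suffices ∀ db₀ db₁, Runs B ((skipFact s)∗) (encFacts db₁).length
      (m.set s (.split (.hash :: encFacts db₀) (encFacts (db₁ ++ db₂))))
      (m.set s (.split (.hash :: encFacts (db₀ ++ db₁)) (encFacts db₂))) by
    refine ⟨_, ?_, h1.mul (this [] db₁)⟩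
    rw [encFacts_append, List.length_append] at *
    omega
  intro db₀ db₁
  induction db₁ generalizing db₀ with
  | nil => simpa using Runs.star_nil _
  | cons F db₁ ih =>
    have h2 := (det_skipFact (B := B) (s := s) (r := encFacts (db₁ ++ db₂))
      (m := m.set s (.split (.hash :: encFacts db₀) (encFacts (F :: db₁ ++ db₂))))
      (by rw [Mem.get_set, List.cons_append, encFacts_cons]) (fin_notMem_encBody F)).runs
    have h3 := ih (db₀ ++ [F])
    have h4 := h2.star_cons (m' := (m.set s (.split (.hash :: encFacts (db₀ ++ F :: db₁))
      (encFacts db₂)))) (n₂ := (encFacts db₁).length) (by simpa using h3)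
    convert h4 using 1
    simp; omega

/-- The memory during a pass over a fact with left-hand side `L`: the remainder `α` of its
right-hand side is on the first work tape, and `β` is the new right-hand side so far. -/
structure PassAt (db : List (Fact b)) (L : Option (List Bool)) (W : ℕ) (α β : List (FSym b))
    (m : Mem) : Prop where
  a : ∃ p r, m.a = .split p (encSyms α ++ .fin :: r) ∧
    p ++ (encSyms α ++ .fin :: r) = .hash :: encFacts db
  b : Holds m.b (encFacts db)
  c : ∃ r, m.c = .split (.hash :: encBody (L, β)) r ∧ .hash ∉ r ∧
    r.length ≤ W - (encBody (L, β)).length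

theorem perform_call (m : Mem) (op : OracleOp) (r : Reads) :
    m.perform B ((Instr.call op).effect r) =
      { m with orc := .split [] (BlackBoxTM.oracleAnswer B m.orc op) } := by
  simp [Instr.call, Mem.perform, Mem.answer, Tape.ofList_eq_split]

theorem det_call (m : Mem) (op : OracleOp) : Det B (single (.call op)) 1 m
    { m with orc := .split [] (BlackBoxTM.oracleAnswer B m.orc op) } :=
  (det_single (i := .call op) trivial).congr (perform_call ..)

theorem encBody_snoc (L : Option (List Bool)) (β γ : List (FSym b)) :
    encBody (L, β ++ γ) = encBody (L, β) ++ encSyms γ := by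
  simp [encBody]

variable {db : List (Fact b)} {L : Option (List Bool)} {W : ℕ} {α β : List (FSym b)}
variable {m m' : Mem} {n : ℕ}

theorem hash_notMem_drop {r : List WorkSym} (h : .hash ∉ r) (k : ℕ) : .hash ∉ r.drop k :=
  fun h' => h (List.mem_of_mem_drop h')

theorem PassAt.det_copySym {s : FSym b} (h : PassAt db L W (s :: α) β m) :
    ∃ m', Det B copySym (encSym s).length m m' ∧ PassAt db L W α (β ++ [s]) m' := by
  obtain ⟨⟨p, r, ha, har⟩, hb, ⟨rc, hc, hh, hl⟩⟩ := h
  obtain ⟨x, t, hx, ht⟩ := exists_encSym_eq s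
  have hd := det_copyName (B := B) (P := fun x => x = .nonterm ∨ x = .term) (by simp) ht
    (m := m) (p := p) (r := encSyms α ++ .fin :: r) (by simpa [hx] using ha) hc
  have hlen : (encSym s).length = x.length + 1 := by simp [hx]
  rw [hlen]
  refine ⟨_, hd, ⟨_, r, rfl, ?_⟩, hb, ⟨_, ?_, hash_notMem_drop hh (x.length + 1), ?_⟩⟩
  · rw [← har]; simp [hx]
  · simp [encBody_snoc, hx]
  · simp [encBody_snoc, hx]; omega

theorem PassAt.stuck_copySym (h : PassAt db L W [] β m) : Stuck B copySym m := by
  obtain ⟨⟨p, r, ha, har⟩, hb, ⟨rc, hc, hh, hl⟩⟩ := h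
  exact stuck_copyName (x := []) (t := .fin) (by simp) (by simp [IsBit]) (by simp)
    (by simpa using ha) hc

theorem PassAt.runs_substSym (h : PassAt db L W α β m) (hr : Runs B substSym n m m') :
    ∃ A γ α', (some A, γ) ∈ db ∧ α = .inl A :: α' ∧ PassAt db L W α' (β ++ γ) m' := by
  obtain ⟨⟨p, r, ha, har⟩, hb, ⟨rc, hc, hh, hl⟩⟩ := h
  obtain ⟨n₁, n₂, m₁, -, h1, h2⟩ := runs_mul.1 hr
  obtain ⟨db₁, db₂, rfl, rfl⟩ := runs_gotoFact (s := .b) hb h1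
  obtain ⟨n₃, n₄, m₂, -, h3, h4⟩ := runs_mul.1 h2
  cases db₂ with
  | nil => exact absurd h3 (stuck_compareName_nil rfl _ _)
  | cons F db₂ =>
    obtain ⟨L', γ⟩ := F
    obtain ⟨x', t', hx', ht'⟩ := exists_encLhs_eq L'
    have htb' : ¬ IsBit t' := by
      rintro ⟨y, rfl⟩; simp at ht'
    cases α with
    | nil =>
      have := (runs_compareName (x := []) (t := .fin) (x' := x') (t' := t')
        (m := m.set .b (.split (.hash :: encFacts db₁) (encFacts ((L', γ) :: db₂))))
        (p := p) (r := r) (p' := .hash :: encFacts db₁)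
        (r' := encSyms γ ++ .fin :: encFacts db₂)
        (by simp [IsBit]) htb' (by simpa [Mem.set] using ha)
        (by simp only [Mem.set, encFacts_cons, encBody, hx', List.append_assoc,
          List.cons_append, List.nil_append])).1 h3
      simp at this
    | cons s α =>
      obtain ⟨x, t, hx, ht⟩ := exists_encSym_eq s
      have htb : ¬ IsBit t := by
        rintro ⟨y, rfl⟩; simp at ht
      obtain ⟨rfl, rfl, rfl, -, rfl⟩ := (runs_compareName (x := x) (t := t) (x' := x') (t' := t')
        (m := m.set .b (.split (.hash :: encFacts db₁) (encFacts ((L', γ) :: db₂))))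
        (p := p) (r := encSyms α ++ .fin :: r) (p' := .hash :: encFacts db₁)
        (r' := encSyms γ ++ .fin :: encFacts db₂) htb htb'
        (by simpa [Mem.set, hx] using ha)
        (by simp only [Mem.set, encFacts_cons, encBody, hx', List.append_assoc,
          List.cons_append, List.nil_append])).1 h3
      obtain ⟨-, rfl⟩ := (det_copyRest (B := B) (fin_notMem_encSyms γ) rfl
        (by simpa [Mem.set] using hc) _ _).1 h4
      have hs : s = .inl x := by
        cases s with
        | inl A =>
          simp only [encSym] at hx
          have := List.append_inj_left' hx rfl
          rw [List.map_injective_iff.2 (fun _ _ h => by simpa using h) this]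
        | inr y =>
          simp only [encSym] at hx
          have := List.append_inj_right' hx rfl
          simp at this
      have hL : L' = some x := by simpa using ht'
      subst hs hL
      refine ⟨x, γ, α, by simp, rfl, ⟨_, r, rfl, ?_⟩, ⟨_, _, rfl, ?_⟩,
        ⟨_, ?_, hash_notMem_drop hh (encSyms γ).length, ?_⟩⟩
      · rw [← har]; simp [hx]
      · simp [encBody, hx']
      · simp [encBody_snoc]
      · simp [encBody_snoc]; omega

theorem PassAt.exists_runs_substSym {A : List Bool} {γ : List (FSym b)}
    (h : PassAt db L W (.inl A :: α) β m) (hA : (some A, γ) ∈ db) :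
    ∃ n ≤ 3 * (encFacts db).length + 2, ∃ m', Runs B substSym n m m' ∧
      PassAt db L W α (β ++ γ) m' := by
  obtain ⟨⟨p, r, ha, har⟩, hb, ⟨rc, hc, hh, hl⟩⟩ := h
  obtain ⟨db₁, db₂, rfl⟩ := List.append_of_mem hA
  obtain ⟨n₁, hn₁, h1⟩ := exists_runs_gotoFact (B := B) (s := .b) (m := m) hb
  have h2 := (runs_compareName (B := B) (x := A) (t := .nonterm) (x' := A) (t' := .nonterm)
    (m := m.set .b (.split (.hash :: encFacts db₁) (encFacts ((some A, γ) :: db₂))))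
    (p := p) (r := encSyms α ++ .fin :: r) (p' := .hash :: encFacts db₁)
    (r' := encSyms γ ++ .fin :: encFacts db₂) (by simp [IsBit]) (by simp [IsBit])
    (by simpa [Mem.set, encSym] using ha)
    (by simp [Mem.set, encBody, encLhs])).2 ⟨rfl, rfl, rfl, rfl, rfl⟩
  have h3 := (det_copyRest (B := B) (fin_notMem_encSyms γ) rfl
    (m := { m.set .b (.split (.hash :: encFacts db₁) (encFacts ((some A, γ) :: db₂))) with
        a := .split (p ++ (A.map .bit ++ [.nonterm])) (encSyms α ++ .fin :: r)
        b := .split (.hash :: encFacts db₁ ++ (A.map .bit ++ [.nonterm]))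
          (encSyms γ ++ .fin :: encFacts db₂) })
    (by simpa [Mem.set] using hc)).runs
  refine ⟨_, ?_, _, h1.mul (h2.mul h3), ⟨_, r, rfl, ?_⟩, ⟨_, _, rfl, ?_⟩,
    ⟨_, ?_, hash_notMem_drop hh (encSyms γ).length, ?_⟩⟩
  · simp only [encFacts_append, encFacts_cons, encBody, encLhs, List.length_append,
      List.length_cons, List.length_map, List.length_nil] at hn₁ ⊢
    omega
  · rw [← har]; simp [encSym]
  · simp [encBody, encLhs]
  · simp [encBody_snoc]
  · simp [encBody_snoc]; omega

theorem det_mulSym {x y : Fin b → Bool} (h : PassAt db L W (.inr x :: .inr y :: α) β m) :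
    ∃ m', Det B mulSym (3 * b + 5) m m' ∧ PassAt db L W α (β ++ [.inr (B.prod x y)]) m' := by
  obtain ⟨⟨p, r, ha, har⟩, hb, ⟨rc, hc, hh, hl⟩⟩ := h
  have h1 := det_call (B := B) m .valid
  have h2 := h1.mul (det_askName (x := List.ofFn x) (p := p)
    (r := encSyms (.inr y :: α) ++ .fin :: r) (by simpa [encSym] using ha) rfl)
  have h3 := det_askName (B := B) (m := { m with
      a := .split (p ++ ((List.ofFn x).map .bit ++ [.term])) (encSyms (.inr y :: α) ++ .fin :: r)
      orc := .split ([] ++ List.ofFn x) ([B.valid (m.orc.bits 0 b)].drop (List.ofFn x).length) })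
    (x := List.ofFn y) (r := encSyms α ++ .fin :: r) (by simp [encSym]; rfl) rfl
  have h4 := h3.mul ((det_call _ .prod).mul (det_hearName rfl hc))
  have hx : ∀ r, (Tape.split ([] ++ List.ofFn x ++ List.ofFn y) r).bits 0 b = x := by
    intro r
    exact Tape.bits_split x [] (List.ofFn y ++ r) _ _ (by simp)
  have hy : ∀ r, (Tape.split ([] ++ List.ofFn x ++ List.ofFn y) r).bits b b = y := by
    intro r
    have := Tape.bits_split y (List.ofFn x) r ([] ++ List.ofFn x ++ List.ofFn y) r (by simp)
    simpa using this
  simp only [BlackBoxTM.oracleAnswer, hx, hy] at h4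
  have h5 := h1.mul ((det_askName (x := List.ofFn x) (p := p)
    (r := encSyms (.inr y :: α) ++ .fin :: r) (by simpa [encSym] using ha) rfl).mul h4)
  rw [show 3 * b + 5 = 1 + ((List.ofFn x).length + 1 + ((List.ofFn y).length + 1 +
    (1 + ((List.ofFn (B.prod x y)).length + 1)))) by simp; omega]
  refine ⟨_, h5, ⟨_, r, rfl, ?_⟩, hb,
    ⟨_, ?_, hash_notMem_drop hh ((List.ofFn (B.prod x y)).length + 1), ?_⟩⟩
  · rw [← har]; simp [encSym]
  · simp [encBody_snoc, encSym]
  · simp [encBody_snoc, encSym]; omega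

theorem PassAt.runs_mulSym (h : PassAt db L W α β m) (hr : Runs B mulSym n m m') :
    ∃ x y α', α = .inr x :: .inr y :: α' := by
  obtain ⟨⟨p, r, ha, har⟩, hb, ⟨rc, hc, hh, hl⟩⟩ := h
  by_contra hcon
  refine (det_call (B := B) m .valid).stuck_mul ?_ _ _ hr
  match α with
  | [] =>
    exact (stuck_askName (x := []) (t := .fin) (by simp [IsBit]) (by simp)
      (by simpa using ha) rfl).mul _
  | .inl A :: α =>
    exact (stuck_askName (x := A) (t := .nonterm) (by simp [IsBit]) (by simp)
      (by simpa [encSym] using ha) rfl).mul _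
  | .inr x :: α =>
    refine (det_askName (x := List.ofFn x) (r := encSyms α ++ .fin :: r)
      (by simpa [encSym] using ha) rfl).stuck_mul ?_
    match α with
    | [] =>
      exact (stuck_askName (x := []) (t := .fin) (by simp [IsBit]) (by simp)
        (by simp; rfl) rfl).mul _
    | .inl A :: α =>
      exact (stuck_askName (x := A) (t := .nonterm) (r := encSyms α ++ .fin :: r)
        (by simp [IsBit]) (by simp) (by simp [encSym]; rfl) rfl).mul _
    | .inr y :: α => exact absurd ⟨x, y, α, rfl⟩ hcon

theorem PassAt.runs_passStep (h : PassAt db L W α β m) (hr : Runs B passStep n m m') :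
    ∃ α' γ, PassStep B db α α' γ ∧ PassAt db L W α' (β ++ γ) m' := by
  rcases runs_add.1 hr with hr | hr
  · cases α with
    | nil => exact absurd hr (h.stuck_copySym _ _)
    | cons s α =>
      obtain ⟨m₁, h1, h2⟩ := h.det_copySym (B := B)
      obtain ⟨-, rfl⟩ := (h1 _ _).1 hr
      exact ⟨α, [s], .copy s α, h2⟩
  rcases runs_add.1 hr with hr | hr
  · obtain ⟨A, γ, α', hA, rfl, h'⟩ := h.runs_substSym hr
    exact ⟨α', γ, .subst A γ α' hA, h'⟩
  · obtain ⟨x, y, α', rfl⟩ := h.runs_mulSym hr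
    obtain ⟨m₁, h1, h2⟩ := det_mulSym (B := B) h
    obtain ⟨-, rfl⟩ := (h1 _ _).1 hr
    exact ⟨α', _, .mul x y α', h2⟩

theorem PassAt.exists_runs_passStep {α' γ : List (FSym b)} (h : PassAt db L W α β m)
    (hs : PassStep B db α α' γ) : ∃ n ≤ 3 * (encFacts db).length + 5, ∃ m',
      Runs B passStep n m m' ∧ PassAt db L W α' (β ++ γ) m' := by
  have hlen : (encSyms α).length ≤ (encFacts db).length := by
    obtain ⟨p, r, -, har⟩ := h.a
    have := congrArg List.length har
    simp only [List.length_append, List.length_cons] at this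
    omega
  cases hs with
  | copy s =>
    obtain ⟨m', h1, h2⟩ := h.det_copySym (B := B)
    rw [encSyms_cons, List.length_append] at hlen
    exact ⟨_, by omega, m', runs_add.2 (.inl h1.runs), h2⟩
  | subst A _ _ hA =>
    obtain ⟨n, hn, m', h1, h2⟩ := h.exists_runs_substSym (B := B) hA
    exact ⟨n, by omega, m', runs_add.2 (.inr (runs_add.2 (.inl h1))), h2⟩
  | mul x y =>
    obtain ⟨m', h1, h2⟩ := det_mulSym (B := B) h
    simp only [encSyms_cons, encSym, List.length_append, List.length_map, List.length_ofFn] at hlen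
    exact ⟨_, by omega, m', runs_add.2 (.inr (runs_add.2 (.inr h1.runs))), h2⟩

end

section

variable {G : Type} [Group G] {b c : ℕ} {B : BlackBox G b c}

/-- Between the rounds, the first two work tapes contain the known facts. The third one contains
the facts written last, possibly followed by remains of longer ones. -/
structure Ready (db : List (Fact b)) (m : Mem) : Prop where
  a : Holds m.a (encFacts db)
  b : Holds m.b (encFacts db)
  c : ∃ w, Holds m.c w ∧ .hash ∉ w ∧ w.length ≤ (encFacts db).length

variable {db : List (Fact b)} {L : Option (List Bool)} {W : ℕ} {α β : List (FSym b)}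
variable {m m' : Mem} {n : ℕ}

theorem PassAt.runs_passStep_star (h : PassAt db L W α [] m) (hr : Runs B (passStep∗) n m m') :
    ∃ α' β, PassAt db L W α' β m' ∧ ∀ δ, Pass B db α' δ → Pass B db α (β ++ δ) := by
  refine hr.star_invariant (I := fun m' => ∃ α' β, PassAt db L W α' β m' ∧
    ∀ δ, Pass B db α' δ → Pass B db α (β ++ δ)) ?_ ⟨α, [], h, fun δ hδ => hδ⟩
  rintro n m₁ m₂ ⟨α', β, h, hp⟩ hr
  obtain ⟨α'', γ, hs, h'⟩ := h.runs_passStep hr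
  refine ⟨α'', β ++ γ, h', fun δ hδ => ?_⟩
  rw [List.append_assoc]
  exact hp _ (.step hs hδ)

theorem PassStep.length_lt {α' γ : List (FSym b)} (h : PassStep B db α α' γ) :
    α'.length < α.length := by
  cases h <;> simp

theorem PassAt.exists_runs_passStep_star {γ : List (FSym b)} (h : PassAt db L W α β m)
    (hp : Pass B db α γ) : ∃ n ≤ α.length * (3 * (encFacts db).length + 5), ∃ m',
      Runs B (passStep∗) n m m' ∧ PassAt db L W [] (β ++ γ) m' := by
  induction hp generalizing β m with
  | nil => exact ⟨0, by simp, m, .star_nil m, by simpa using h⟩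
  | step hs _ ih =>
    obtain ⟨n, hn, m₁, h1, h2⟩ := h.exists_runs_passStep hs
    obtain ⟨n', hn', m', h3, h4⟩ := ih h2
    refine ⟨_, ?_, m', h1.star_cons h3, by simpa using h4⟩
    have := Nat.mul_le_mul_right (3 * (encFacts db).length + 5) hs.length_lt
    rw [Nat.succ_mul] at this
    omega

theorem PassAt.stuck_fin (h : PassAt db L W α β m) (hα : α ≠ []) :
    Stuck B (single (.copyAC (· = .fin))) m := by
  obtain ⟨p, r, ha, -⟩ := h.a
  refine stuck_single ?_
  simp only [Instr.copyAC, Mem.reads, ha, Tape.read_split]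
  rintro ⟨x, hx, rfl⟩
  cases α with
  | nil => exact hα rfl
  | cons s α =>
    have hne : encSym s ≠ [] := by
      obtain ⟨y, t, h, -⟩ := exists_encSym_eq s
      simp [h]
    rw [encSyms_cons, List.append_assoc, List.head?_append_of_ne_nil _ hne] at hx
    exact fin_notMem_encSyms [s] (by simpa using List.mem_of_mem_head? hx)

/-- The end of a round. -/
theorem PassAt.det_finish (h : PassAt db L (encFacts db).length [] β m) :
    ∃ k ≤ 2 * (encFacts db).length + 2 * (encBody (L, β)).length + 9, ∃ m',
      Det B (single (.copyAC (· = .fin)) * (rewind .c * (toEnd .a * (toEnd .b * appendFact))))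
        k m m' ∧ Ready (db ++ [(L, β)]) m' := by
  obtain ⟨⟨pa, ra, ha, har⟩, ⟨pb, rb, hb, hbr⟩, ⟨rc, hc, hh, hl⟩⟩ := h
  rw [encSyms_nil, List.nil_append] at ha har
  have hra := congrArg List.length har
  have hrb := congrArg List.length hbr
  simp only [List.length_append, List.length_cons] at hra hrb
  have h1 := (det_single (B := B) (i := .copyAC (· = .fin)) (m := m)
    (by simp [Instr.copyAC, Mem.reads, ha])).congr (m'' := { m with
      a := .split (pa ++ [.fin]) ra
      c := .split (.hash :: encBody (L, β) ++ [.fin]) rc.tail })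
    (by simp [Instr.copyAC, Mem.reads, Mem.perform, Mem.answer, ha, hc])
  have hw : .hash ∉ encBody (L, β) ++ .fin :: rc.tail := by
    simp only [List.mem_append, List.mem_cons, reduceCtorEq, false_or, not_or]
    exact ⟨hash_notMem_encBody _, fun h => hh (List.mem_of_mem_tail h)⟩
  let m₁ : Mem := { m with
    a := .split (pa ++ [.fin]) ra, c := .split (.hash :: encBody (L, β) ++ [.fin]) rc.tail }
  let m₂ := m₁.set .c (.split [.hash] (encBody (L, β) ++ .fin :: rc.tail))
  let m₃ := m₂.set .a (.split (pa ++ [.fin] ++ ra) [])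
  have h2 : Det B (rewind .c) _ m₁ m₂ := det_rewind (s := .c) rfl (by simp) hw
  have h3 : Det B (toEnd .a) _ m₂ m₃ := det_toEnd rfl
  have h4 : Det B (toEnd .b) _ m₃ (m₃.set .b (.split (pb ++ rb) [])) := det_toEnd hb
  have h5 := det_appendFact (B := B) (m := m₃.set .b (.split (pb ++ rb) []))
    (fin_notMem_encBody (L, β)) rfl rfl rfl
  refine ⟨_, ?_, _, h1.mul (h2.mul (h3.mul (h4.mul h5))), ⟨_, _, rfl, ?_⟩, ⟨_, _, rfl, ?_⟩,
    ⟨encBody (L, β) ++ .fin :: rc.tail,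
    ⟨_, _, rfl, by simp⟩, hw, ?_⟩⟩
  · simp; omega
  · have : pa ++ [.fin] ++ ra = .hash :: encFacts db := by simpa using har
    rw [this]; simp
  · rw [hbr]; simp
  · simp; omega

/-- The begin of a round. -/
theorem det_start {db₁ db₂ : List (Fact b)} {w : List WorkSym}
    (ha : m.a = .split (.hash :: encFacts db₁) (encFacts ((L, α) :: db₂)))
    (hb : Holds m.b (encFacts (db₁ ++ (L, α) :: db₂)))
    (hc : m.c = .split [.hash] w) (hw : .hash ∉ w) :
    ∃ m', Det B (copyName fun x => x = .nonterm ∨ x = .goal) (encLhs L).length m m' ∧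
      PassAt (db₁ ++ (L, α) :: db₂) L w.length α [] m' := by
  obtain ⟨x, t, hx, ht⟩ := exists_encLhs_eq L
  have hlen : (encLhs L).length = x.length + 1 := by simp [hx]
  rw [hlen]
  refine ⟨_, det_copyName (x := x) (t := t) (p := .hash :: encFacts db₁)
    (r := encSyms α ++ .fin :: encFacts db₂) (by simp) (ht.imp And.left And.left)
    (by simpa [encBody, hx] using ha) hc, ⟨_, encFacts db₂, rfl, ?_⟩, hb,
    ⟨_, ?_, hash_notMem_drop hw (x.length + 1), ?_⟩⟩
  · simp [encBody, hx]
  · simp [encBody, hx]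
  · simp [encBody, hx]

theorem stuck_start_nil {p : List WorkSym} {P : WorkSym → Prop} (ha : m.a = .split p []) :
    Stuck B (copyName P) m := by
  refine stuck_loop (F := fun _ _ => m) ([] : List Unit) rfl (by simp) ?_ (stuck_single ?_)
  · simp [Instr.copyAC, Mem.reads, ha]
  · simp [Instr.copyAC, Mem.reads, ha]

theorem PassAt.mono {W' : ℕ} (h : PassAt db L W α β m) (hW : W ≤ W') : PassAt db L W' α β m :=
  ⟨h.a, h.b, h.c.imp fun _ h => ⟨h.1, h.2.1, h.2.2.trans (Nat.sub_le_sub_right hW _)⟩⟩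

theorem Ready.runs_round (h : Ready db m) (hr : Runs B round n m m') :
    ∃ F, NewFact B db F ∧ Ready (db ++ [F]) m' := by
  obtain ⟨ha, hb, w, ⟨pc, rc, hc, hcr⟩, hw, hl⟩ := h
  obtain ⟨_, -, hr₁⟩ := (det_rewind (s := .c) hc hcr hw).mul_iff.1 hr
  obtain ⟨_, _, m₁, -, h1, hr₂⟩ := runs_mul.1 hr₁
  obtain ⟨db₁, db₂, rfl, rfl⟩ := runs_gotoFact (s := .a) (m := m.set .c (.split [.hash] w)) ha h1
  obtain ⟨_, _, m₂, -, h2, hr₃⟩ := runs_mul.1 hr₂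
  cases db₂ with
  | nil => exact absurd h2 (stuck_start_nil (by simp [Mem.set]; rfl) _ _)
  | cons F db₂ =>
    obtain ⟨L, α⟩ := F
    obtain ⟨m₃, h3, h4⟩ := det_start (B := B) (L := L) (α := α) (db₁ := db₁) (db₂ := db₂)
      (m := (m.set .c (.split [.hash] w)).set .a
        (.split (.hash :: encFacts db₁) (encFacts ((L, α) :: db₂)))) rfl hb rfl hw
    obtain ⟨-, rfl⟩ := (h3 _ _).1 h2
    obtain ⟨_, _, m₄, -, h5, hr₄⟩ := runs_mul.1 hr₃
    obtain ⟨α', β, h6, h7⟩ := h4.runs_passStep_star h5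
    by_cases hα : α' = []
    · subst hα
      obtain ⟨_, -, m₅, h8, h9⟩ := (h6.mono hl).det_finish (B := B)
      obtain ⟨-, rfl⟩ := (h8 _ _).1 hr₄
      exact ⟨(L, β), ⟨α, by simp, by simpa using h7 [] .nil⟩, h9⟩
    · exact absurd hr₄ ((h6.stuck_fin hα).mul _ _ _)

theorem Ready.exists_runs_round {F : Fact b} (h : Ready db m) (hF : NewFact B db F) :
    ∃ n ≤ 13 * ((encFacts (db ++ [F])).length + 1) ^ 2, ∃ m', Runs B round n m m' ∧
      Ready (db ++ [F]) m' := by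
  obtain ⟨ha, hb, w, ⟨pc, rc, hc, hcr⟩, hw, hl⟩ := h
  obtain ⟨L, β⟩ := F
  obtain ⟨α, hα, hp⟩ := hF
  obtain ⟨db₁, db₂, rfl⟩ := List.append_of_mem hα
  have h1 := (det_rewind (B := B) (s := .c) hc hcr hw).runs
  obtain ⟨n₂, hn₂, h2⟩ := exists_runs_gotoFact (B := B) (s := .a) (m := m.set .c (.split [.hash] w))
    (db₁ := db₁) (db₂ := (L, α) :: db₂) ha
  obtain ⟨m₃, h3, h4⟩ := det_start (B := B) (L := L) (α := α) (db₁ := db₁) (db₂ := db₂)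
      (m := (m.set .c (.split [.hash] w)).set .a
        (.split (.hash :: encFacts db₁) (encFacts ((L, α) :: db₂)))) rfl hb rfl hw
  obtain ⟨n₅, hn₅, m₄, h5, h6⟩ := (h4.mono hl).exists_runs_passStep_star hp
  obtain ⟨n₇, hn₇, m₅, h7, h8⟩ := h6.det_finish (B := B)
  refine ⟨_, ?_, m₅, h1.mul (h2.mul (h3.runs.mul (h5.mul h7.runs))), h8⟩
  have hlen : pc.length ≤ w.length + 1 := by
    have := congrArg List.length hcr
    simp only [List.length_append, List.length_cons] at this
    omega
  have hα' := length_le_encSyms α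
  have hK : (encLhs L).length + (encSyms α).length ≤
      (encFacts (db₁ ++ (L, α) :: db₂)).length := by
    simp [encBody]; omega
  have hK' : (encFacts (db₁ ++ (L, α) :: db₂ ++ [(L, β)])).length =
      (encFacts (db₁ ++ (L, α) :: db₂)).length + (encBody (L, β)).length + 1 := by
    rw [encFacts_append]
    simp; omega
  simp only [List.nil_append] at hn₇
  rw [hK']
  generalize (encFacts (db₁ ++ (L, α) :: db₂)).length = K at *
  generalize (encBody (L, β)).length = e at *
  have : α.length * (3 * K + 5) ≤ K * (3 * K + 5) := Nat.mul_le_mul_right _ (by omega)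
  nlinarith

end

/-! ### The program -/

/-- Read a production from the input and write it down as a fact. -/
def loadProd : Language Instr :=
  single (.skipInput (· = .binTag)) *
    (loadName .nonterm * (loadName .nonterm * (loadName .nonterm * single (.emit .fin)))) +
  single (.skipInput (· = .termTag)) *
    (loadName .nonterm * (loadName .term * single (.emit .fin)))

/-- Read the input up to the start symbol, and write down the fact about the goal. -/
def header : Language Instr :=
  single .emitHash * (skipUnary * (skipUnary * (single (.emit .goal) *
    (loadName .nonterm * single (.emit .fin)))))

/-- Choose a fact that derives a single terminal from the goal, guess a witness, and check
with the oracle that the terminal is a name of `1`. -/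
def finale : Language Instr :=
  gotoFact .a * (single (.scan .a (· = some .goal) .right) * (single (.call .valid) * (askName *
    (single (.scan .a (· = some .fin) .stay) * ((single (.guess false) + single (.guess true))∗ *
      (single (.call .id) * single .answerYes))))))

/-- The nondeterministic program that decides the problem, as a regular language of instructions. -/
def program : Language Instr := header * (loadProd∗ * (round∗ * finale))

theorem isRegular_single (i : Instr) : (single i).IsRegular := Language.IsRegular.singleton i

theorem isRegular_program : program.IsRegular := by
  simp only [program, header, loadProd, round, finale, gotoFact, passStep, copySym, substSym,
    mulSym, rewind, skipFact, toEnd, copyName, copyRest, askName, hearName, compareName,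
    appendFact, loadName, skipUnary]
  repeat' first
    | exact isRegular_single _
    | apply Language.IsRegular.mul
    | apply Language.IsRegular.add
    | apply Language.IsRegular.kstar

/-! ### Reading the input -/

section

variable {G : Type} [Group G] {b c : ℕ} {B : BlackBox G b c}

/-- A production, read as a fact. -/
def factOfProduction : Production (Fin b → Bool) → Fact b
  | .bin A C D => (some A, [.inl C, .inl D])
  | .term A x => (some A, [.inr x])

/-- The part of the input word that encodes the production. -/
def encProduction (P : Production (Fin b → Bool)) : List InputSymbol :=
  (P.map List.ofFn).encode

/-- The part of the input word that encodes the productions. -/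
def encProductions (Ps : List (Production (Fin b → Bool))) : List InputSymbol :=
  Ps.flatMap encProduction

/-- The fact that the start symbol `S` is derived from the goal. -/
def goalFact (S : List Bool) : Fact b := (none, [.inl S])

/-- The facts that the program knows after reading a grammar. -/
def initFacts (g : CNFGrammar (Fin b → Bool)) : List (Fact b) :=
  goalFact g.start :: g.productions.map factOfProduction

/-- The memory while the productions are read; `Ps` are those that remain. -/
structure Loading (db : List (Fact b)) (Ps : List (Production (Fin b → Bool))) (m : Mem) :
    Prop where
  inp : ∃ p, m.inp = .split p (encProductions Ps)
  a : m.a = .split (.hash :: encFacts db) []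
  b : m.b = .split (.hash :: encFacts db) []
  c : m.c = .split [.hash] []

variable {db : List (Fact b)} {m m' : Mem} {n : ℕ} {P : Production (Fin b → Bool)}
variable {Ps : List (Production (Fin b → Bool))}

theorem Det.add_right {K K' : Language Instr} {k : ℕ} (h : Det B K k m m') (h' : Stuck B K' m) :
    Det B (K + K') k m m' := by
  intro n m''
  rw [runs_add, h]
  exact or_iff_left (h' _ _)

theorem Det.add_left {K K' : Language Instr} {k : ℕ} (h : Det B K k m m') (h' : Stuck B K' m) :
    Det B (K' + K) k m m' := by
  intro n m''
  rw [runs_add, h]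
  exact or_iff_right (h' _ _)

theorem det_emit {pa pb : List WorkSym} (x : WorkSym) (ha : m.a = .split pa [])
    (hb : m.b = .split pb []) : Det B (single (.emit x)) 1 m
      { m with a := .split (pa ++ [x]) [], b := .split (pb ++ [x]) [] } :=
  (det_single (i := .emit x) trivial).congr (by simp [Instr.emit, Mem.perform, Mem.answer, ha, hb])

theorem det_skipInput {p r : List InputSymbol} (x : InputSymbol) (h : m.inp = .split p (x :: r)) :
    Det B (single (.skipInput (· = x))) 1 m { m with inp := .split (p ++ [x]) r } :=
  (det_single (i := .skipInput (· = x)) (by simp [Instr.skipInput, Mem.reads, h])).congr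
    (by simp [Instr.skipInput, Mem.perform, Mem.answer, h])

theorem Loading.det_loadProd (h : Loading db (P :: Ps) m) :
    ∃ m', Det B loadProd ((encProduction P).length + 1) m m' ∧
      Loading (db ++ [factOfProduction P]) Ps m' := by
  obtain ⟨⟨p, hi⟩, ha, hb, hc⟩ := h
  cases P with
  | bin A C D =>
    have h1 := det_skipInput (B := B) (m := m) (p := p) (r := A.map .bit ++ .sep ::
      (C.map .bit ++ .sep :: (D.map .bit ++ .sep :: encProductions Ps))) .binTag
      (by simpa [encProductions, encProduction, Production.map, Production.encode] using hi)
    have h2 := h1.mul ((det_loadName (m := { m with inp := .split (p ++ [.binTag]) (A.map .bit ++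
      .sep :: (C.map .bit ++ .sep :: (D.map .bit ++ .sep :: encProductions Ps))) })
      .nonterm rfl ha hb).mul ((det_loadName .nonterm rfl rfl rfl).mul
        ((det_loadName .nonterm rfl rfl rfl).mul (det_emit .fin rfl rfl))))
    rw [show (encProduction (.bin A C D : Production (Fin b → Bool))).length + 1 =
      1 + (A.length + 1 + (C.length + 1 + (D.length + 1 + 1))) by
        simp [encProduction, Production.map, Production.encode]; omega]
    refine ⟨_, h2.add_right ((stuck_single ?_).mul _), ⟨_, rfl⟩, ?_, ?_, hc⟩
    · simp [Instr.skipInput, Mem.reads, hi, encProductions, encProduction, Production.map,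
        Production.encode]
    · simp [factOfProduction, encBody, encLhs, encSym]
    · simp [factOfProduction, encBody, encLhs, encSym]
  | term A x =>
    have h1 := det_skipInput (B := B) (m := m) (p := p) (r := A.map .bit ++ .sep ::
      ((List.ofFn x).map .bit ++ .sep :: encProductions Ps)) .termTag
      (by simpa [encProductions, encProduction, Production.map, Production.encode] using hi)
    have h2 := h1.mul ((det_loadName (m := { m with inp := .split (p ++ [.termTag]) (A.map .bit ++
      .sep :: ((List.ofFn x).map .bit ++ .sep :: encProductions Ps)) })
      .nonterm rfl ha hb).mul ((det_loadName .term rfl rfl rfl).mul (det_emit .fin rfl rfl)))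
    rw [show (encProduction (.term A x : Production (Fin b → Bool))).length + 1 =
      1 + (A.length + 1 + ((List.ofFn x).length + 1 + 1)) by
        simp [encProduction, Production.map, Production.encode]; omega]
    refine ⟨_, h2.add_left ((stuck_single ?_).mul _), ⟨_, rfl⟩, ?_, ?_, hc⟩
    · simp [Instr.skipInput, Mem.reads, hi, encProductions, encProduction, Production.map,
        Production.encode]
    · simp [factOfProduction, encBody, encLhs, encSym]
    · simp [factOfProduction, encBody, encLhs, encSym]

theorem Loading.stuck_loadProd (h : Loading db [] m) : Stuck B loadProd m := by
  obtain ⟨⟨p, hi⟩, -⟩ := h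
  intro n m' hr
  rcases runs_add.1 hr with hr | hr
  · exact (stuck_single (by simp [Instr.skipInput, Mem.reads, hi, encProductions])).mul _ _ _ hr
  · exact (stuck_single (by simp [Instr.skipInput, Mem.reads, hi, encProductions])).mul _ _ _ hr

theorem Loading.ready (h : Loading db Ps m) : Ready db m :=
  ⟨⟨_, _, h.a, by simp⟩, ⟨_, _, h.b, by simp⟩, [], ⟨_, _, h.c, rfl⟩, by simp, by simp⟩

theorem Loading.runs_loadProd_star (h : Loading db Ps m) (hr : Runs B (loadProd∗) n m m') :
    ∃ Qs, Qs ⊆ Ps ∧ Ready (db ++ Qs.map factOfProduction) m' := by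
  obtain ⟨Qs, Rs, h1, h2⟩ := hr.star_invariant (I := fun m => ∃ Qs Rs, Ps = Qs ++ Rs ∧
    Loading (db ++ Qs.map factOfProduction) Rs m) (by
      rintro n m₁ m₂ ⟨Qs, Rs, h1, h2⟩ hr
      cases Rs with
      | nil => exact absurd hr (h2.stuck_loadProd _ _)
      | cons P Rs =>
        obtain ⟨m₃, h3, h4⟩ := h2.det_loadProd (B := B)
        obtain ⟨-, rfl⟩ := (h3 _ _).1 hr
        exact ⟨Qs ++ [P], Rs, by simp [h1], by simpa using h4⟩) ⟨[], Ps, rfl, by simpa using h⟩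
  exact ⟨Qs, by simp [h1], h2.ready⟩

theorem Loading.exists_runs_loadProd_star (h : Loading db Ps m) :
    ∃ n ≤ 2 * (encProductions Ps).length, ∃ m', Runs B (loadProd∗) n m m' ∧
      Ready (db ++ Ps.map factOfProduction) m' := by
  induction Ps generalizing db m with
  | nil => exact ⟨0, by simp, m, .star_nil m, by simpa using h.ready⟩
  | cons P Ps ih =>
    obtain ⟨m₁, h1, h2⟩ := h.det_loadProd (B := B)
    obtain ⟨n, hn, m₂, h3, h4⟩ := ih h2
    refine ⟨_, ?_, m₂, h1.runs.star_cons h3, by simpa using h4⟩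
    have : 1 ≤ (encProduction P).length := by
      cases P <;> simp [encProduction, Production.map, Production.encode]
    simp only [encProductions, List.flatMap_cons, List.length_append] at hn ⊢
    omega

theorem encode_map_ofFn (g : CNFGrammar (Fin b → Bool)) :
    (g.map List.ofFn).encode = g.start.map .bit ++ .sep :: encProductions g.productions := by
  simp only [CNFGrammar.encode, CNFGrammar.map, encProductions, List.flatMap_map]
  rfl

theorem det_header (g : CNFGrammar (Fin b → Bool)) :
    ∃ m', Det B header (b + c + g.start.length + 6)
      (.init (inputWord b c (g.map List.ofFn).encode)) m' ∧
      Loading [goalFact g.start] g.productions m' := by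
  rw [encode_map_ofFn]
  have h1 := (det_single (B := B) (i := .emitHash) (m := .init (inputWord b c (g.start.map .bit ++
    .sep :: encProductions g.productions))) trivial).congr (m'' :=
      ⟨.split [] (inputWord b c (g.start.map .bit ++ .sep :: encProductions g.productions)),
        .split [.hash] [], .split [.hash] [], .split [.hash] [], .split [] []⟩) (by
      simp [Instr.emitHash, Mem.perform, Mem.answer, Mem.init, Tape.ofList_eq_split])
  have h2 := h1.mul ((det_skipUnary (k := b) rfl).mul ((det_skipUnary (k := c) rfl).mul
    ((det_emit .goal rfl rfl).mul ((det_loadName .nonterm rfl rfl rfl).mul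
      (det_emit .fin rfl rfl)))))
  rw [show b + c + g.start.length + 6 = 1 + (b + 1 + (c + 1 + (1 + (g.start.length + 1 + 1)))) by
    omega]
  refine ⟨_, h2, ⟨_, rfl⟩, ?_, ?_, rfl⟩
  · simp [goalFact, encBody, encLhs, encSym]
  · simp [goalFact, encBody, encLhs, encSym]

/-! ### The final check -/

theorem runs_guess {x : Bool} {p r : List Bool} (h : m.orc = .split p r) :
    Runs B (single (.guess x)) n m m' ↔
      n = 1 ∧ m' = { m with orc := .split (p ++ [x]) r.tail } := by
  rw [det_single (i := .guess x) trivial]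
  simp [Instr.guess, Mem.perform, Mem.answer, h]

theorem runs_guess_star {p r : List Bool} (h : m.orc = .split p r)
    (hr : Runs B ((single (.guess false) + single (.guess true))∗) n m m') :
    ∃ z r', m' = { m with orc := .split (p ++ z) r' } := by
  refine hr.star_invariant (I := fun m' => ∃ z r', m' = { m with orc := .split (p ++ z) r' }) ?_
    ⟨[], r, by simp [← h]⟩
  rintro n m₁ m₂ ⟨z, r', rfl⟩ hr
  rcases runs_add.1 hr with hr | hr
  · obtain ⟨-, rfl⟩ := (runs_guess rfl).1 hr
    exact ⟨z ++ [false], r'.tail, by simp⟩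
  · obtain ⟨-, rfl⟩ := (runs_guess rfl).1 hr
    exact ⟨z ++ [true], r'.tail, by simp⟩

theorem exists_runs_guess_star {p r : List Bool} (h : m.orc = .split p r) (z : List Bool) :
    Runs B ((single (.guess false) + single (.guess true))∗) z.length m
      { m with orc := .split (p ++ z) (r.drop z.length) } := by
  induction z generalizing m p r with
  | nil => simpa [← h] using Runs.star_nil (B := B) m
  | cons x z ih =>
    have h1 : Runs B (single (.guess false) + single (.guess true)) 1 m
        { m with orc := .split (p ++ [x]) r.tail } := by
      cases x
      · exact runs_add.2 (.inl ((runs_guess h).2 ⟨rfl, rfl⟩))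
      · exact runs_add.2 (.inr ((runs_guess h).2 ⟨rfl, rfl⟩))
    have h2 := h1.star_cons (ih rfl)
    simpa [add_comm] using h2

theorem Ready.runs_finale (h : Ready db m) (hr : Runs B finale n m m') :
    ∃ x : Fin b → Bool, (none, [.inr x]) ∈ db ∧ ∃ z, B.id x z = true := by
  obtain ⟨_, _, m₁, -, h1, hr₁⟩ := runs_mul.1 hr
  obtain ⟨db₁, db₂, rfl, rfl⟩ := runs_gotoFact (s := .a) (m := m) h.a h1
  obtain ⟨_, _, m₂, -, h2, hr₂⟩ := runs_mul.1 hr₁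
  cases db₂ with
  | nil => exact absurd h2 (stuck_single (by simp [Instr.scan]) _ _)
  | cons F db₂ =>
    obtain ⟨L, α⟩ := F
    cases L with
    | some A =>
      refine absurd h2 (stuck_single ?_ _ _)
      cases A <;> simp [Instr.scan, encBody, encLhs]
    | none =>
      have h3 : Det B (single (.scan .a (· = some .goal) .right)) 1
          (m.set .a (.split (.hash :: encFacts db₁) (encFacts ((none, α) :: db₂))))
          (m.set .a (.split (.hash :: encFacts db₁ ++ [.goal])
            (encSyms α ++ .fin :: encFacts db₂))) :=
        (det_single (i := .scan .a (· = some .goal) .right)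
          (by simp [Instr.scan, encBody, encLhs])).congr (by simp [Instr.scan, encBody, encLhs])
      obtain ⟨-, rfl⟩ := (h3 _ _).1 h2
      obtain ⟨_, -, hr₃⟩ := (det_call _ .valid).mul_iff.1 hr₂
      cases α with
      | nil =>
        exact absurd hr₃ ((stuck_askName (x := []) (t := .fin) (r := encFacts db₂)
          (by simp [IsBit]) (by simp) (by simp [Mem.set]; rfl) rfl).mul _ _ _)
      | cons s α =>
        cases s with
        | inl A =>
          exact absurd hr₃ ((stuck_askName (x := A) (t := .nonterm)
            (r := encSyms α ++ .fin :: encFacts db₂)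
            (by simp [IsBit]) (by simp) (by simp [Mem.set, encSym]; rfl) rfl).mul _ _ _)
        | inr x =>
          obtain ⟨_, -, hr₄⟩ := (det_askName (x := List.ofFn x)
            (r := encSyms α ++ .fin :: encFacts db₂)
            (by simp [Mem.set, encSym]; rfl) rfl).mul_iff.1 hr₃
          obtain ⟨_, _, m₃, -, h4, hr₅⟩ := runs_mul.1 hr₄
          cases α with
          | cons s α =>
            refine absurd h4 (stuck_single ?_ _ _)
            obtain ⟨y, t, hy, ht⟩ := exists_encSym_eq s
            cases y <;> rcases ht with rfl | rfl <;> simp [Instr.scan, Mem.get, hy]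
          | nil =>
            obtain ⟨-, -, rfl⟩ := runs_single.1 h4
            simp only [Instr.scan, Mem.perform_on, Tape.act_idle, Mem.set_get] at hr₅
            obtain ⟨_, _, m₄, -, h5, hr₆⟩ := runs_mul.1 hr₅
            obtain ⟨z, r', rfl⟩ := runs_guess_star rfl h5
            obtain ⟨_, -, hr₇⟩ := (det_call _ .id).mul_iff.1 hr₆
            obtain ⟨h6, -⟩ := runs_single.1 hr₇
            refine ⟨x, by simp, (Tape.split ([] ++ List.ofFn x ++ z) r').bits b c, ?_⟩
            have hx : (Tape.split (List.ofFn x ++ z) r').bits 0 b = x :=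
              Tape.bits_split x [] (z ++ r') _ _ (by simp)
            simpa [Instr.answerYes, Mem.reads, BlackBoxTM.oracleAnswer, hx] using h6

theorem Ready.exists_runs_finale (h : Ready db m) {x : Fin b → Bool}
    (hx : (none, [.inr x]) ∈ db) {z : Fin c → Bool} (hz : B.id x z = true) :
    ∃ n ≤ 2 * (encFacts db).length + b + c + 8, ∃ m', Runs B finale n m m' := by
  obtain ⟨db₁, db₂, rfl⟩ := List.append_of_mem hx
  obtain ⟨n₁, hn₁, h1⟩ := exists_runs_gotoFact (B := B) (s := .a) (m := m) h.a
  have h2 : Det B (single (.scan .a (· = some .goal) .right)) 1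
      (m.set .a (.split (.hash :: encFacts db₁) (encFacts ((none, [.inr x]) :: db₂))))
      (m.set .a (.split (.hash :: encFacts db₁ ++ [.goal])
        ((List.ofFn x).map .bit ++ .term :: .fin :: encFacts db₂))) :=
    (det_single (i := .scan .a (· = some .goal) .right)
      (by simp [Instr.scan, encBody, encLhs])).congr (by simp [Instr.scan, encBody, encLhs, encSym])

  have h4 := det_single (B := B) (i := .scan .a (· = some .fin) .stay)
    (m := { m.set .a (.split (.hash :: encFacts db₁ ++ [.goal] ++ ((List.ofFn x).map .bit ++
        [.term])) (.fin :: encFacts db₂)) with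
      orc := .split ([] ++ List.ofFn x)
        ([B.valid (m.orc.bits 0 b)].drop (List.ofFn x).length) })
    (by simp [Instr.scan, Mem.get, Mem.set])
  simp only [Instr.scan, Mem.perform_on, Tape.act_idle, Mem.set_get] at h4
  have h5 := exists_runs_guess_star (B := B)
    (m := { m.set .a (.split (.hash :: encFacts db₁ ++ [.goal] ++ ((List.ofFn x).map .bit ++
        [.term])) (.fin :: encFacts db₂)) with
      orc := .split ([] ++ List.ofFn x)
        ([B.valid (m.orc.bits 0 b)].drop (List.ofFn x).length) }) rfl (List.ofFn z)
  have h6 := (det_call (B := B) { m.set .a (.split (.hash :: encFacts db₁ ++ [.goal] ++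
      ((List.ofFn x).map .bit ++ [.term])) (.fin :: encFacts db₂)) with
    orc := .split ([] ++ List.ofFn x ++ List.ofFn z)
      (([B.valid (m.orc.bits 0 b)].drop (List.ofFn x).length).drop (List.ofFn z).length) } .id).runs
  have hx : ∀ r, (Tape.split (List.ofFn x ++ List.ofFn z) r).bits 0 b = x := fun r =>
    Tape.bits_split x [] (List.ofFn z ++ r) _ _ (by simp)
  have hz' : ∀ r, (Tape.split (List.ofFn x ++ List.ofFn z) r).bits b c = z := by
    intro r
    have := Tape.bits_split z (List.ofFn x) r (List.ofFn x ++ List.ofFn z) r (by simp)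
    rw [List.length_ofFn] at this
    exact this
  have h7 := h6.mul (det_single (i := .answerYes)
    (by simp [Instr.answerYes, Mem.reads, BlackBoxTM.oracleAnswer, hx, hz', hz])).runs
  have h8 := h2.runs.mul ((det_call (B := B) _ .valid).runs.mul
    ((det_askName (x := List.ofFn x) rfl rfl).runs.mul (h4.runs.mul (h5.mul h7))))
  refine ⟨_, ?_, _, h1.mul h8⟩
  simp only [List.length_ofFn]
  omega

end

/-! ### What the program computes -/

section

variable {G : Type} [Group G] {b c : ℕ} (B : BlackBox G b c)

/-- `Grow B db n db'` says that `n` passes, each of which results in a short fact, can extend the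
list `db` of known facts to `db'`. -/
inductive Grow (db : List (Fact b)) : ℕ → List (Fact b) → Prop
  | zero : Grow db 0 db
  | succ {n : ℕ} {db' : List (Fact b)} {F : Fact b} (h : Grow db n db') (hF : NewFact B db' F)
      (hl : F.2.length ≤ 5) : Grow db (n + 1) (db' ++ [F])

variable {B}

/-- A property of facts that holds for the initial facts and is preserved by passes holds for the
fact that makes the program accept. -/
theorem program_sound (g : CNFGrammar (Fin b → Bool)) (J : Fact b → Prop)
    (hJ : ∀ F ∈ initFacts g, J F)
    (hJ' : ∀ db F, (∀ F' ∈ db, J F') → NewFact B db F → J F)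
    {v : List Instr} (hv : v ∈ program) {m : Mem}
    (hm : Exec B v (.init (inputWord b c (g.map List.ofFn).encode)) m) :
    ∃ x : Fin b → Bool, J (none, [.inr x]) ∧ ∃ z, B.id x z = true := by
  have hr : Runs B program v.length (.init (inputWord b c (g.map List.ofFn).encode)) m :=
    ⟨v, hv, rfl, hm⟩
  obtain ⟨m₁, h1, h2⟩ := det_header (B := B) g
  obtain ⟨_, -, hr₁⟩ := h1.mul_iff.1 hr
  obtain ⟨_, _, m₂, -, h3, hr₂⟩ := runs_mul.1 hr₁
  obtain ⟨_, _, m₃, -, h4, hr₃⟩ := runs_mul.1 hr₂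
  obtain ⟨Qs, hQ, h5⟩ := h2.runs_loadProd_star h3
  obtain ⟨db, h6, h7⟩ := h4.star_invariant (I := fun m => ∃ db, Ready db m ∧ ∀ F ∈ db, J F) (by
      rintro n m₁ m₂ ⟨db, h6, h7⟩ hr
      obtain ⟨F, hF, h8⟩ := h6.runs_round hr
      refine ⟨_, h8, ?_⟩
      intro F' hF'
      rcases List.mem_append.1 hF' with hF' | hF'
      · exact h7 F' hF'
      · rw [List.mem_singleton.1 hF']
        exact hJ' db F h7 hF) ⟨_, h5, by
      intro F hF
      apply hJ
      rcases List.mem_append.1 hF with hF | hF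
      · rw [List.mem_singleton.1 hF]
        exact List.mem_cons_self
      · exact List.mem_cons_of_mem _ (List.map_subset _ hQ hF)⟩
  obtain ⟨x, hx, hz⟩ := h6.runs_finale hr₃
  exact ⟨x, h7 _ hx, hz⟩

/-- Every symbol of the fact has an encoding of length at most `W`. -/
def Small (W : ℕ) (F : Fact b) : Prop :=
  (encLhs F.1).length ≤ W ∧ ∀ s ∈ F.2, (encSym s).length ≤ W

theorem Pass.small {db : List (Fact b)} {α β : List (FSym b)} {W : ℕ} (h : Pass B db α β)
    (hb : b + 1 ≤ W) (hdb : ∀ F ∈ db, Small W F) (hα : ∀ s ∈ α, (encSym s).length ≤ W) :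
    ∀ s ∈ β, (encSym s).length ≤ W := by
  induction h with
  | nil => simp
  | step h h' ih =>
    intro s hs
    rcases List.mem_append.1 hs with hs | hs
    · cases h with
      | copy s' => rw [List.mem_singleton.1 hs]; exact hα _ (by simp)
      | subst A γ α h => exact (hdb _ h).2 s hs
      | mul x y => rw [List.mem_singleton.1 hs]; simpa [encSym] using hb
    · refine ih (fun s hs' => hα s ?_) s hs
      cases h
      · exact List.mem_cons_of_mem _ hs'
      · exact List.mem_cons_of_mem _ hs'
      · exact List.mem_cons_of_mem _ (List.mem_cons_of_mem _ hs')

theorem NewFact.small {db : List (Fact b)} {F : Fact b} {W : ℕ} (h : NewFact B db F)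
    (hb : b + 1 ≤ W) (hdb : ∀ F ∈ db, Small W F) : Small W F := by
  obtain ⟨α, hα, hp⟩ := h
  exact ⟨(hdb _ hα).1, hp.small hb hdb (hdb _ hα).2⟩

theorem length_encSyms_le {W : ℕ} (α : List (FSym b)) (h : ∀ s ∈ α, (encSym s).length ≤ W) :
    (encSyms α).length ≤ α.length * W := by
  induction α with
  | nil => simp
  | cons s α ih =>
    simp only [List.forall_mem_cons] at h
    have := ih h.2
    simp only [encSyms_cons, List.length_append, List.length_cons, Nat.succ_mul]
    omega

theorem Grow.bounds {db db' : List (Fact b)} {n W : ℕ} (h : Grow B db n db')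
    (hb : b + 1 ≤ W) (hdb : ∀ F ∈ db, Small W F) :
    (∀ F ∈ db', Small W F) ∧ (encFacts db').length ≤ (encFacts db).length + n * (6 * W + 1) := by
  induction h with
  | zero => exact ⟨hdb, by simp⟩
  | @succ n db' F h hF hl ih =>
    have hs := hF.small hb ih.1
    refine ⟨?_, ?_⟩
    · simp only [List.mem_append, List.mem_singleton]
      rintro F' (hF' | rfl)
      exacts [ih.1 F' hF', hs]
    · have h1 := length_encSyms_le F.2 hs.2
      have h2 : F.2.length * W ≤ 5 * W := Nat.mul_le_mul_right _ hl
      have h3 := hs.1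
      simp only [encFacts_append, encFacts_cons, encFacts_nil, encBody, List.length_append,
        List.length_cons, List.length_nil, Nat.add_mul, one_mul]
      omega

theorem Runs.star_snoc {L : Language Instr} {n₁ n₂ : ℕ} {m m₁ m' : Mem}
    (h₁ : Runs B (L∗) n₁ m m₁) (h₂ : Runs B L n₂ m₁ m') : Runs B (L∗) (n₁ + n₂) m m' := by
  obtain ⟨_, ⟨S, rfl, hS⟩, rfl, hv⟩ := h₁
  obtain ⟨w, hw, rfl, hw'⟩ := h₂
  refine ⟨S.flatten ++ w, ⟨S ++ [w], by simp, ?_⟩, by simp, (exec_append ..).2 ⟨_, hv, hw'⟩⟩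
  intro y hy
  rcases List.mem_append.1 hy with hy | hy
  · exact hS y hy
  · rwa [List.mem_singleton.1 hy]

theorem Ready.exists_runs_round_star {db db' : List (Fact b)} {m : Mem} {n : ℕ} (h : Ready db m)
    (hg : Grow B db n db') : ∃ k ≤ n * (13 * ((encFacts db').length + 1) ^ 2), ∃ m',
      Runs B (round∗) k m m' ∧ Ready db' m' := by
  induction hg with
  | zero => exact ⟨0, by simp, m, .star_nil m, h⟩
  | @succ n db' F hg hF hl ih =>
    obtain ⟨k, hk, m₁, h1, h2⟩ := ih
    obtain ⟨k', hk', m₂, h3, h4⟩ := h2.exists_runs_round hF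
    have hle : (encFacts db').length ≤ (encFacts (db' ++ [F])).length := by
      simp [encFacts_append]
    refine ⟨k + k', ?_, m₂, h1.star_snoc h3, h4⟩
    rw [Nat.add_mul, one_mul]
    refine Nat.add_le_add (hk.trans ?_) hk'
    gcongr

theorem encProduction_bounds {W : ℕ} {P : Production (Fin b → Bool)}
    (h : (encProduction P).length ≤ W) :
    Small W (factOfProduction P) := by
  cases P <;> simp [encProduction, Production.map, Production.encode] at h <;>
    simp [Small, factOfProduction, encLhs, encSym] <;> omega

theorem length_encFacts_productions (Ps : List (Production (Fin b → Bool))) :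
    (encFacts (Ps.map factOfProduction)).length = (encProductions Ps).length := by
  induction Ps with
  | nil => rfl
  | cons P Ps ih =>
    simp only [List.map_cons, encFacts_cons, encProductions, List.flatMap_cons,
      List.length_append, List.length_cons, ih]
    cases P <;> simp [encBody, encLhs, encSym, factOfProduction, encProduction, Production.map,
      Production.encode] <;> omega

theorem length_inputWord (g : CNFGrammar (Fin b → Bool)) :
    (inputWord b c (g.map List.ofFn).encode).length =
      b + c + g.start.length + (encProductions g.productions).length + 3 := by
  simp [inputWord, encode_map_ofFn]; omega

theorem length_encFacts_initFacts (g : CNFGrammar (Fin b → Bool)) :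
    (encFacts (initFacts g)).length ≤ (inputWord b c (g.map List.ofFn).encode).length := by
  rw [length_inputWord, initFacts, encFacts_cons, List.length_append, List.length_cons,
    length_encFacts_productions]
  simp [goalFact, encBody, encLhs, encSym]
  omega

theorem small_initFacts (g : CNFGrammar (Fin b → Bool)) :
    ∀ F ∈ initFacts g, Small (inputWord b c (g.map List.ofFn).encode).length F := by
  rw [length_inputWord]
  simp only [initFacts, List.mem_cons, List.mem_map]
  rintro F (rfl | ⟨P, hP, rfl⟩)
  · simp [Small, goalFact, encLhs, encSym]
    omega
  · refine encProduction_bounds (le_trans ?_ (Nat.le_add_right _ 3))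
    have : (encProduction P).length ≤ (encProductions g.productions).length := by
      rw [encProductions, List.length_flatMap]
      exact List.single_le_sum (by simp) _ (List.mem_map_of_mem hP)
    omega

/-- If few passes lead to a fact that derives a name of `1` from the goal, then the program has a
short accepting execution. -/
theorem program_complete (g : CNFGrammar (Fin b → Bool)) {r : ℕ} {db : List (Fact b)}
    (hg : Grow B (initFacts g) r db) {x : Fin b → Bool} (hx : (none, [.inr x]) ∈ db)
    {z : Fin c → Bool} (hz : B.id x z = true) {W : ℕ}
    (hW : (inputWord b c (g.map List.ofFn).encode).length = W) :
    ∃ v ∈ program, v.length ≤ 20 * (r + 1) * (W + r * (6 * W + 1) + 1) ^ 2 ∧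
      ∃ m, Exec B v (.init (inputWord b c (g.map List.ofFn).encode)) m := by
  have hlen := length_inputWord (c := c) g
  obtain ⟨m₁, h1, h2⟩ := det_header (B := B) g
  obtain ⟨n₂, hn₂, m₂, h3, h4⟩ := h2.exists_runs_loadProd_star (B := B)
  obtain ⟨n₃, hn₃, m₃, h5, h6⟩ := h4.exists_runs_round_star (B := B) hg
  obtain ⟨n₄, hn₄, m₄, h7⟩ := h6.exists_runs_finale hx hz
  obtain ⟨v, hv, hvl, hm⟩ := h1.runs.mul (h3.mul (h5.mul h7))
  refine ⟨v, hv, ?_, m₄, hm⟩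
  have hK := (hg.bounds (by omega) (small_initFacts (c := c) g)).2
  have hK0 := length_encFacts_initFacts (c := c) g
  rw [hW] at *
  have hK' : (encFacts db).length ≤ W + r * (6 * W + 1) := hK.trans (by omega)
  generalize (encFacts db).length = K at *
  have h8 : n₃ ≤ r * (13 * (W + r * (6 * W + 1) + 1) ^ 2) := hn₃.trans (by gcongr)
  have h9 : W ≤ W + r * (6 * W + 1) := Nat.le_add_right _ _
  generalize W + r * (6 * W + 1) = M at *
  rw [hvl]
  have h10 : 3 ≤ W := by omega
  have h11 : b + c + g.start.length + 6 + (n₂ + n₄) ≤ 20 * (M + 1) ^ 2 := by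
    have : b + c + g.start.length + 6 + (n₂ + n₄) ≤ 6 * M + 11 := by omega
    nlinarith
  nlinarith

end

/-! ### Values of nonterminals -/

theorem CNFGrammar.mem_rules {T : Type} {X : CNFGrammar T} {r : ContextFreeRule T (List Bool)} :
    r ∈ X.toCFG.rules ↔ ∃ P ∈ X.productions, P.toRule = r := by
  classical exact List.mem_toFinset.trans List.mem_map

theorem CNFGrammar.derives_of_rule {T : Type} {X : CNFGrammar T} {A : List Bool}
    {α : List (Symbol T (List Bool))} (h : ∃ P ∈ X.productions, P.toRule = ⟨A, α⟩) :
    X.toCFG.Derives [.nonterminal A] α := by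
  refine Relation.ReflTransGen.single ⟨⟨A, α⟩, CNFGrammar.mem_rules.2 h, ?_⟩
  have h := ContextFreeRule.Rewrites.head (r := (⟨A, α⟩ : ContextFreeRule T (List Bool))) []
  rw [List.append_nil] at h
  exact h

section

variable {G : Type} [Group G]

/-- `Val X A v` says that `A` derives in the grammar `X` a word with product `v`. -/
inductive Val (X : CNFGrammar G) : List Bool → G → Prop
  | term {A : List Bool} {v : G} (h : .term A v ∈ X.productions) : Val X A v
  | bin {A C D : List Bool} {v w : G} (h : .bin A C D ∈ X.productions) (hC : Val X C v)
      (hD : Val X D w) : Val X A (v * w)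

/-- The product of some choice of values for the symbols of a form. -/
def Evals {σ : Type} (R : σ → G → Prop) : List σ → G → Prop
  | [], v => v = 1
  | s :: α, v => ∃ x y, R s x ∧ Evals R α y ∧ v = x * y

variable {σ : Type} {R : σ → G → Prop}

theorem evals_append {α β : List σ} {v : G} :
    Evals R (α ++ β) v ↔ ∃ x y, Evals R α x ∧ Evals R β y ∧ v = x * y := by
  induction α generalizing v with
  | nil => simp [Evals]
  | cons s α ih =>
    simp only [List.cons_append, Evals, ih]
    constructor
    · rintro ⟨x, _, hx, ⟨y, z, hy, hz, rfl⟩, rfl⟩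
      exact ⟨x * y, z, ⟨x, y, hx, hy, rfl⟩, hz, (mul_assoc ..).symm⟩
    · rintro ⟨_, z, ⟨x, y, hx, hy, rfl⟩, hz, rfl⟩
      exact ⟨x, y * z, hx, ⟨y, z, hy, hz, rfl⟩, mul_assoc ..⟩

theorem evals_singleton {s : σ} {v : G} : Evals R [s] v ↔ R s v := by
  simp [Evals]

variable {X : CNFGrammar G}

theorem Val.exists_derives {A : List Bool} {v : G} (h : Val X A v) :
    ∃ w : List G, w.prod = v ∧ X.toCFG.Derives [.nonterminal A] (w.map .terminal) := by
  induction h with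
  | @term A v h =>
    exact ⟨[v], by simp, CNFGrammar.derives_of_rule ⟨_, h, rfl⟩⟩
  | @bin A C D v₁ v₂ h _ _ ih₁ ih₂ =>
    obtain ⟨w₁, rfl, h₁⟩ := ih₁
    obtain ⟨w₂, rfl, h₂⟩ := ih₂
    refine ⟨w₁ ++ w₂, by simp, (CNFGrammar.derives_of_rule ⟨_, h, rfl⟩).trans ?_⟩
    have h₃ := (h₁.append_right [.nonterminal D]).trans (h₂.append_left (w₁.map .terminal))
    rw [List.map_append]
    exact h₃

/-- The values of a symbol of the grammar. -/
def symbolVal (X : CNFGrammar G) : Symbol G (List Bool) → G → Prop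
  | .terminal x, v => x = v
  | .nonterminal A, v => Val X A v

theorem evals_terminals (w : List G) : Evals (symbolVal X) (w.map .terminal) w.prod := by
  induction w with
  | nil => simp [Evals]
  | cons x w ih => exact ⟨x, w.prod, rfl, ih, by simp⟩

/-- Going backwards through a derivation, a word is parsed into values of the symbols. -/
theorem evals_of_derives {α : List (Symbol G (List Bool))} {w : List G}
    (h : X.toCFG.Derives α (w.map .terminal)) : Evals (symbolVal X) α w.prod := by
  induction h using Relation.ReflTransGen.head_induction_on with
  | refl => exact evals_terminals w
  | head h _ ih =>
    obtain ⟨r, hr, h⟩ := h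
    obtain ⟨p, q, rfl, rfl⟩ := h.exists_parts
    obtain ⟨P, hP, rfl⟩ := CNFGrammar.mem_rules.1 hr
    obtain ⟨_, z, h1, hz, h2⟩ := evals_append.1 ih
    obtain ⟨x, y, hx, hy, rfl⟩ := evals_append.1 h1
    rw [h2]
    refine evals_append.2 ⟨_, z, evals_append.2 ⟨x, y, hx, evals_singleton.2 ?_, rfl⟩, hz, rfl⟩
    cases P with
    | bin A C D =>
      obtain ⟨y₁, y₂, hy₁, hy₂, rfl⟩ := hy
      exact .bin hP hy₁ (evals_singleton.1 hy₂)
    | term A a =>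
      obtain rfl : a = y := evals_singleton.1 hy
      exact .term hP

theorem val_start_iff : Val X X.start 1 ↔ ∃ w ∈ X.toCFG.language, w.prod = 1 := by
  constructor
  · intro h
    obtain ⟨w, hw, h⟩ := h.exists_derives
    exact ⟨w, (ContextFreeGrammar.mem_language_iff ..).2 h, hw⟩
  · rintro ⟨w, hw, h⟩
    have := evals_of_derives ((ContextFreeGrammar.mem_language_iff ..).1 hw)
    rw [h] at this
    exact evals_singleton.1 this

/-! ### Soundness of the program -/

variable {b c : ℕ} (B : BlackBox G b c) (X)

/-- The values of a symbol of a fact. -/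
def fsymVal : FSym b → G → Prop
  | .inl A, v => Val X A v
  | .inr x, v => B.f x = some v

/-- The values of a left-hand side; those of the goal are those of the start symbol. -/
def lhsVal : Option (List Bool) → G → Prop
  | none, v => Val X X.start v
  | some A, v => Val X A v

/-- All terminals in `α` are names of group elements. -/
def NamesValid (α : List (FSym b)) : Prop := ∀ x, .inr x ∈ α → ∃ v, B.f x = some v

/-- What a fact claims about the grammar and the group. -/
def Holding (F : Fact b) : Prop :=
  NamesValid B F.2 ∧ ∀ v, Evals (fsymVal X B) F.2 v → lhsVal X F.1 v

variable {B X} {db : List (Fact b)}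

/-- A pass keeps the terminals valid, and adds no values. -/
theorem Pass.sound {α β : List (FSym b)} (h : Pass B db α β) (hdb : ∀ F ∈ db, Holding X B F)
    (hα : NamesValid B α) :
    NamesValid B β ∧ ∀ v, Evals (fsymVal X B) β v → Evals (fsymVal X B) α v := by
  induction h with
  | nil => exact ⟨hα, fun v h => h⟩
  | @step α α' β γ h h' ih =>
    suffices NamesValid B β ∧ NamesValid B α' ∧ ∀ x y, Evals (fsymVal X B) β x →
        Evals (fsymVal X B) α' y → Evals (fsymVal X B) α (x * y) by
      obtain ⟨h1, h2, h3⟩ := this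
      obtain ⟨h4, h5⟩ := ih h2
      refine ⟨fun x hx => (List.mem_append.1 hx).elim (h1 x) (h4 x), ?_⟩
      intro v hv
      obtain ⟨x, y, hx, hy, rfl⟩ := evals_append.1 hv
      exact h3 x y hx (h5 y hy)
    have hα' : NamesValid B α' := fun x hx => hα x (by cases h <;> simp [hx])
    cases h with
    | copy s =>
      refine ⟨fun x hx => hα x ?_, hα', fun x y hx hy => ⟨x, y, evals_singleton.1 hx, hy, rfl⟩⟩
      rw [List.mem_singleton] at hx
      simp [hx]
    | subst A _ _ h =>
      exact ⟨(hdb _ h).1, hα', fun x y hx hy => ⟨x, y, (hdb _ h).2 x hx, hy, rfl⟩⟩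
    | mul x y =>
      obtain ⟨v, hv⟩ := hα x (by simp)
      obtain ⟨w, hw⟩ := hα y (by simp)
      have hp := B.prod_spec x y v w hv hw
      refine ⟨fun z hz => ?_, hα', fun x₁ y₁ hx₁ hy₁ => ?_⟩
      · simp only [List.mem_singleton, Sum.inr.injEq] at hz
        exact ⟨_, hz ▸ hp⟩
      · have hx₂ : B.f (B.prod x y) = some x₁ := (evals_singleton (R := fsymVal X B)).1 hx₁
        obtain rfl : v * w = x₁ := by simpa [hp] using hx₂
        exact ⟨v, w * y₁, hv, ⟨w, y₁, hw, hy₁, rfl⟩, mul_assoc ..⟩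

theorem NewFact.holding {F : Fact b} (h : NewFact B db F) (hdb : ∀ F ∈ db, Holding X B F) :
    Holding X B F := by
  obtain ⟨α, hα, hp⟩ := h
  have h1 := hp.sound hdb (hdb _ hα).1
  exact ⟨h1.1, fun v hv => (hdb _ hα).2 v (h1.2 v hv)⟩

variable {Y : CNFGrammar (Fin b → Bool)}

theorem start_eq (hY : Y.map B.f = X.map some) : Y.start = X.start :=
  congrArg CNFGrammar.start hY

theorem productions_eq (hY : Y.map B.f = X.map some) :
    Y.productions.map (Production.map B.f) = X.productions.map (Production.map some) :=
  congrArg CNFGrammar.productions hY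

theorem holding_initFacts (hY : Y.map B.f = X.map some) : ∀ F ∈ initFacts Y, Holding X B F := by
  simp only [initFacts, List.mem_cons, List.mem_map]
  rintro F (rfl | ⟨P, hP, rfl⟩)
  · refine ⟨fun x hx => ?_, fun v hv => ?_⟩
    · simp [goalFact] at hx
    · have : Val X Y.start v := evals_singleton.1 hv
      rwa [start_eq hY] at this
  · have h1 := List.mem_map_of_mem (f := Production.map B.f) hP
    rw [productions_eq hY, List.mem_map] at h1
    obtain ⟨Q, hQ, h1⟩ := h1
    cases P <;> cases Q <;> simp only [Production.map, Production.bin.injEq,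
      Production.term.injEq, reduceCtorEq] at h1
    · obtain ⟨rfl, rfl, rfl⟩ := h1
      refine ⟨fun x hx => by simp [factOfProduction] at hx, fun v hv => ?_⟩
      obtain ⟨x, y, hx, hy, rfl⟩ := hv
      exact .bin hQ hx (evals_singleton.1 hy)
    · obtain ⟨rfl, h1⟩ := h1
      refine ⟨fun x hx => ?_, fun v hv => ?_⟩
      · simp only [factOfProduction, List.mem_singleton, Sum.inr.injEq] at hx
        exact ⟨_, by rw [hx, ← h1]⟩
      · have hx : B.f _ = some v := (evals_singleton (R := fsymVal X B)).1 hv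
        rw [← h1, Option.some_inj] at hx
        exact hx ▸ .term hQ

/-- If the program has an accepting execution, then `1` is a value of the start symbol. -/
theorem val_of_program (hY : Y.map B.f = X.map some) {v : List Instr} (hv : v ∈ program) {m : Mem}
    (hm : Exec B v (.init (inputWord b c (Y.map List.ofFn).encode)) m) : Val X X.start 1 := by
  obtain ⟨x, ⟨h1, h2⟩, z, hz⟩ := program_sound Y (Holding X B) (holding_initFacts hY)
    (fun _ _ h h' => h'.holding h) hv hm
  obtain ⟨w, hw⟩ := h1 x (by simp)
  obtain rfl := (B.id_spec x w hw).2 ⟨z, hz⟩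
  exact h2 1 (evals_singleton.2 hw)

end

/-! ### Extending the known facts -/

section

variable {G : Type} [Group G] {b c : ℕ} {B : BlackBox G b c}
variable {db db' : List (Fact b)} {n n' : ℕ}

theorem Pass.append {α α' β β' : List (FSym b)} (h : Pass B db α β) (h' : Pass B db α' β') :
    Pass B db (α ++ α') (β ++ β') := by
  induction h with
  | nil => exact h'
  | @step α α₁ γ β h _ ih =>
    rw [List.append_assoc]
    refine .step (α' := α₁ ++ α') ?_ ih
    cases h with
    | copy s => exact .copy s _
    | subst A _ _ h => exact .subst A _ _ h
    | mul x y => exact .mul x y _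

theorem Pass.refl (α : List (FSym b)) : Pass B db α α := by
  induction α with
  | nil => exact .nil
  | cons s α ih => exact .step (.copy s α) ih

theorem Pass.subst {A : List Bool} {γ : List (FSym b)} (h : (some A, γ) ∈ db) :
    Pass B db [.inl A] γ := by
  simpa using Pass.step (.subst A γ [] h) .nil

theorem Pass.mul (x y : Fin b → Bool) : Pass B db [.inr x, .inr y] [.inr (B.prod x y)] :=
  .step (.mul x y []) .nil

theorem Grow.subset (h : Grow B db n db') : db ⊆ db' := by
  induction h with
  | zero => exact List.Subset.refl _
  | succ _ _ _ ih => exact List.Subset.trans ih (List.subset_append_left _ _)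

theorem Grow.trans {db'' : List (Fact b)} (h : Grow B db n db') (h' : Grow B db' n' db'') :
    Grow B db (n + n') db'' := by
  induction h' with
  | zero => exact h
  | succ _ hF hl ih => exact .succ ih hF hl

/-- At most `n` passes can extend the list of known facts to one that satisfies `Q`. -/
def Can (B : BlackBox G b c) (db : List (Fact b)) (n : ℕ) (Q : List (Fact b) → Prop) : Prop :=
  ∃ k ≤ n, ∃ db', Grow B db k db' ∧ Q db'

variable {Q Q' : List (Fact b) → Prop}

theorem Can.of (n : ℕ) (h : Q db) : Can B db n Q := ⟨0, Nat.zero_le n, db, .zero, h⟩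

theorem Can.mono (h : Can B db n Q) (hn : n ≤ n') : Can B db n' Q := by
  obtain ⟨k, hk, h⟩ := h
  exact ⟨k, hk.trans hn, h⟩

theorem Can.bind (h : Can B db n Q) (h' : ∀ db', db ⊆ db' → Q db' → Can B db' n' Q') :
    Can B db (n + n') Q' := by
  obtain ⟨k, hk, db₁, hg, h⟩ := h
  obtain ⟨k', hk', db₂, hg', h''⟩ := h' db₁ hg.subset h
  exact ⟨k + k', Nat.add_le_add hk hk', db₂, hg.trans hg', h''⟩

theorem Can.imp (h : Can B db n Q) (h' : ∀ db', db ⊆ db' → Q db' → Q' db') : Can B db n Q' :=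
  h.bind (n' := 0) fun db' hs hQ => .of 0 (h' db' hs hQ)

theorem Can.newFact {F : Fact b} (hF : NewFact B db F) (hl : F.2.length ≤ 5)
    (h : ∀ db', db ⊆ db' → F ∈ db' → Q db') : Can B db 1 Q :=
  ⟨1, le_rfl, _, .succ .zero hF hl, h _ (List.subset_append_left _ _) (by simp)⟩

/-- If a bounded measure can be increased within `s` passes unless a goal is reached, then the
goal can be reached. -/
theorem Can.iterate (Φ : List (Fact b) → ℕ) (s M : ℕ) (hI : Q db)
    (hM : ∀ db, Q db → Φ db ≤ M)
    (hstep : ∀ db, Q db → Q' db ∨ Can B db s fun db' => Q db' ∧ Φ db < Φ db') :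
    Can B db (s * M) Q' := by
  suffices ∀ i db, Q db → M ≤ Φ db + i → Can B db (s * i) Q' from this M db hI (by omega)
  intro i
  induction i with
  | zero =>
    intro db hI hi
    rcases hstep db hI with h | ⟨k, -, db', -, h, h'⟩
    · exact .of _ h
    · have := hM db' h
      omega
  | succ i ih =>
    intro db hI hi
    rcases hstep db hI with h | h
    · exact .of _ h
    · refine (h.bind (n' := s * i) fun db' _ h' => ih db' h'.1 (by omega)).mono ?_
      rw [Nat.mul_succ, add_comm]

/-- Several goals can be reached one after the other. -/
theorem Can.forall_finset {ι : Type} (S : Finset ι) (R : ι → List (Fact b) → Prop)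
    (hR : ∀ i db db', db ⊆ db' → R i db → R i db')
    (h : ∀ i ∈ S, ∀ db', db ⊆ db' → Can B db' n (R i)) :
    Can B db (S.card * n) fun db' => ∀ i ∈ S, R i db' := by
  classical
  induction S using Finset.induction_on with
  | empty => exact .of _ (by simp)
  | insert i S hi ih =>
    have h1 := (ih fun j hj => h j (Finset.mem_insert_of_mem hj)).bind fun db' hs hQ =>
      (h i (Finset.mem_insert_self i S) db' hs).imp (Q' := fun db' => ∀ j ∈ insert i S, R j db')
        fun db'' hs' hR' j hj => by
          rcases Finset.mem_insert.1 hj with rfl | hj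
          · exact hR'
          · exact hR j _ _ hs' (hQ j hj)
    rwa [Finset.card_insert_of_notMem hi, Nat.add_mul, one_mul]

/-! ### Known values and contexts -/

variable (B) in
/-- A word of at most one name whose value is `u`; the empty word has value `1`. -/
def Rep (α : List (FSym b)) (u : G) : Prop :=
  α = [] ∧ u = 1 ∨ ∃ x, α = [.inr x] ∧ B.f x = some u

theorem Rep.length_le {α : List (FSym b)} {u : G} (h : Rep B α u) : α.length ≤ 1 := by
  rcases h with ⟨rfl, -⟩ | ⟨x, rfl, -⟩ <;> simp

theorem Rep.name {x : Fin b → Bool} {u : G} (h : B.f x = some u) : Rep B [.inr x] u :=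
  .inr ⟨x, rfl, h⟩

theorem Rep.nil : Rep B ([] : List (FSym b)) 1 := .inl ⟨rfl, rfl⟩

theorem Rep.mul {α β : List (FSym b)} {u v : G} (h : Rep B α u) (h' : Rep B β v) :
    ∃ γ, Rep B γ (u * v) ∧ (∀ db, Pass B db (α ++ β) γ) ∧ (α ≠ [] ∨ β ≠ [] → γ ≠ []) := by
  rcases h with ⟨rfl, rfl⟩ | ⟨x, rfl, hx⟩
  · exact ⟨β, by simpa using h', fun db => .refl _, by simp⟩
  · rcases h' with ⟨rfl, rfl⟩ | ⟨y, rfl, hy⟩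
    · exact ⟨_, by simpa using Rep.name hx, fun db => .refl _, by simp⟩
    · exact ⟨_, .name (B.prod_spec x y u v hx hy), fun db => .mul x y, by simp⟩

theorem Rep.exists_name {α : List (FSym b)} {u : G} (h : Rep B α u) (h' : α ≠ []) :
    ∃ x, α = [.inr x] ∧ B.f x = some u :=
  h.resolve_left fun h => h' h.1

variable (B) in
/-- It is known that `A` derives a word with product `v`. -/
def HasVal (db : List (Fact b)) (A : List Bool) (v : G) : Prop :=
  ∃ x, B.f x = some v ∧ (some A, [.inr x]) ∈ db

variable (B) in
/-- It is known that `A` derives a word with a single nonterminal `C`, such that the terminals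
to the left of `C` have the product `p.1` and those to the right have the product `p.2`. -/
def HasCon (db : List (Fact b)) (A C : List Bool) (p : G × Gᵐᵒᵖ) : Prop :=
  A = C ∧ p = 1 ∨ ∃ α β, Rep B α p.1 ∧ Rep B β p.2.unop ∧ (some A, α ++ .inl C :: β) ∈ db

theorem HasVal.mono {A : List Bool} {v : G} (h : HasVal B db A v) (hs : db ⊆ db') :
    HasVal B db' A v := by
  obtain ⟨x, hx, h⟩ := h
  exact ⟨x, hx, hs h⟩

theorem HasCon.mono {A C : List Bool} {p : G × Gᵐᵒᵖ} (h : HasCon B db A C p) (hs : db ⊆ db') :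
    HasCon B db' A C p := by
  rcases h with h | ⟨α, β, hα, hβ, h⟩
  · exact .inl h
  · exact .inr ⟨α, β, hα, hβ, hs h⟩

theorem HasCon.refl (A : List Bool) : HasCon B db A A 1 := .inl ⟨rfl, rfl⟩

variable {A C D : List Bool} {u v : G} {p q : G × Gᵐᵒᵖ}

theorem HasVal.bin (h : (some A, [.inl C, .inl D]) ∈ db) (hC : HasVal B db C u)
    (hD : HasVal B db D v) : Can B db 2 (HasVal B · A (u * v)) := by
  obtain ⟨x, hx, hC⟩ := hC
  obtain ⟨y, hy, hD⟩ := hD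
  refine Can.bind (n := 1) (n' := 1) (.newFact (F := (some A, [.inr x, .inr y])) (Q := fun db' =>
    (some A, [.inr x, .inr y]) ∈ db') ⟨_, h, (Pass.subst hC).append (.subst hD)⟩ (by simp)
    fun _ _ h => h) fun db' hs h' => ?_
  exact .newFact (F := (some A, [.inr (B.prod x y)])) ⟨_, h', .mul x y⟩ (by simp) fun _ _ h =>
    ⟨_, B.prod_spec x y u v hx hy, h⟩

theorem HasVal.hasCon_left (h : (some A, [.inl C, .inl D]) ∈ db) (hC : HasVal B db C u) :
    Can B db 1 (HasCon B · A D (u, 1)) := by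
  obtain ⟨x, hx, hC⟩ := hC
  exact .newFact (F := (some A, [.inr x, .inl D])) ⟨_, h, (Pass.subst hC).append (.refl _)⟩
    (by simp) fun _ _ h => .inr ⟨_, _, .name hx, .nil, h⟩

theorem HasVal.hasCon_right (h : (some A, [.inl C, .inl D]) ∈ db) (hD : HasVal B db D u) :
    Can B db 1 (HasCon B · A C (1, .op u)) := by
  obtain ⟨x, hx, hD⟩ := hD
  exact .newFact (F := (some A, [.inl C, .inr x])) ⟨_, h, (Pass.refl [.inl C]).append (.subst hD)⟩
    (by simp) fun _ _ h => .inr ⟨_, _, .nil, .name hx, h⟩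

theorem HasCon.comp (h : HasCon B db A C p) (h' : HasCon B db C D q) :
    Can B db 2 (HasCon B · A D (p * q)) := by
  rcases h with ⟨rfl, rfl⟩ | ⟨α, β, hα, hβ, h⟩
  · exact .of _ (by simpa using h')
  rcases h' with ⟨rfl, rfl⟩ | ⟨α', β', hα', hβ', h'⟩
  · exact .of _ (.inr ⟨α, β, by simpa using hα, by simpa using hβ, h⟩)
  obtain ⟨γ, hγ, h1, -⟩ := hα.mul hα'
  obtain ⟨δ, hδ, h2, -⟩ := hβ'.mul hβ
  have l1 := hα.length_le
  have l2 := hα'.length_le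
  have l3 := hβ.length_le
  have l4 := hβ'.length_le
  have l5 := hγ.length_le
  have l6 := hδ.length_le
  refine Can.bind (n := 1) (n' := 1) (.newFact (F := (some A, (α ++ α') ++ .inl D :: (β' ++ β)))
    (Q := fun db' => (some A, (α ++ α') ++ .inl D :: (β' ++ β)) ∈ db') ⟨_, h, ?_⟩
    (by simp; omega) fun _ _ h => h) fun db' hs h' => ?_
  · have := (Pass.refl (B := B) (db := db) α).append ((Pass.subst h').append (.refl β))
    simpa using this
  · refine .newFact (F := (some A, γ ++ .inl D :: δ))
      ⟨_, h', (h1 db').append ((Pass.refl [.inl D]).append (h2 db'))⟩ (by simp; omega)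
      fun _ _ h => .inr ⟨γ, δ, hγ, hδ, h⟩

theorem HasCon.val (h : HasCon B db A C p) (hC : HasVal B db C v) :
    Can B db 3 (HasVal B · A (p.1 * v * p.2.unop)) := by
  rcases h with ⟨rfl, rfl⟩ | ⟨α, β, hα, hβ, h⟩
  · exact .of _ (by simpa using hC)
  obtain ⟨x, hx, hC⟩ := hC
  obtain ⟨γ, hγ, h1, h1'⟩ := hα.mul (.name hx)
  obtain ⟨δ, hδ, h2, h2'⟩ := hγ.mul hβ
  have hγ' : γ ≠ [] := h1' (by simp)
  obtain ⟨y, rfl, hy⟩ := hδ.exists_name (h2' (.inl hγ'))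
  have l1 := hα.length_le
  have l2 := hβ.length_le
  have l3 := hγ.length_le
  refine Can.bind (n := 1) (n' := 2) (.newFact (F := (some A, (α ++ [.inr x]) ++ β))
    (Q := fun db' => (some A, (α ++ [.inr x]) ++ β) ∈ db') ⟨_, h, ?_⟩ (by simp; omega)
    fun _ _ h => h) fun db' hs h' => ?_
  · have := (Pass.refl (B := B) (db := db) α).append ((Pass.subst hC).append (.refl β))
    simpa using this
  refine Can.bind (n := 1) (n' := 1) (.newFact (F := (some A, γ ++ β))
    (Q := fun db' => (some A, γ ++ β) ∈ db') ⟨_, h', (h1 db').append (.refl _)⟩ (by simp; omega)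
    fun _ _ h => h) fun db'' hs h'' => ?_
  exact .newFact (F := (some A, [.inr y])) ⟨_, h'', h2 db''⟩ (by simp) fun _ _ h => ⟨y, hy, h⟩

theorem HasVal.goal (h : (none, [.inl A]) ∈ db) (hA : HasVal B db A v) :
    Can B db 1 fun db' => ∃ x, B.f x = some v ∧ (none, [.inr x]) ∈ db' := by
  obtain ⟨x, hx, hA⟩ := hA
  exact .newFact (F := (none, [.inr x])) ⟨_, h, .subst hA⟩ (by simp) fun _ _ h => ⟨x, hx, h⟩

/-- If a context from `A` to itself is known, then so are its powers, after few passes. -/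
theorem HasCon.pow (h : HasCon B db A A p) (n : ℕ) :
    Can B db (4 * Nat.size n) (HasCon B · A A (p ^ n)) := by
  induction n using Nat.binaryRec' with
  | zero => exact .of _ (by simpa using HasCon.refl A)
  | bit x n hn ih =>
    by_cases h0 : Nat.bit x n = 0
    · rw [h0, pow_zero]
      exact .of _ (.refl A)
    rw [Nat.size_bit h0]
    refine Can.mono (n := 4 * n.size + (2 + 2)) (ih.bind fun db₁ hs₁ h₁ => (h₁.comp h₁).bind
      fun db₂ hs₂ h₂ => ?_) (by omega)
    rw [← pow_add, ← two_mul] at h₂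
    cases x with
    | false => exact .of _ h₂
    | true => simpa [Nat.bit, pow_succ] using h₂.comp ((h.mono hs₁).mono hs₂)

end

/-! ### Subgroups and cubes in finite groups -/

section

variable {H : Type} [Group H]

theorem log_card_le_of_le [Finite H] {K L : Subgroup H} (h : K ≤ L) :
    Nat.log 2 (Nat.card K) ≤ Nat.log 2 (Nat.card L) :=
  Nat.log_mono_right (Nat.le_of_dvd Nat.card_pos (Subgroup.card_dvd_of_le h))

theorem log_card_lt_of_lt [Finite H] {K L : Subgroup H} (h : K < L) :
    Nat.log 2 (Nat.card K) < Nat.log 2 (Nat.card L) := by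
  obtain ⟨n, hn⟩ := Subgroup.card_dvd_of_le h.le
  have hpos : 0 < Nat.card L := Nat.card_pos
  have h2 : 2 ≤ n := by
    by_contra hn2
    refine h.not_ge (Subgroup.eq_of_le_of_card_ge h.le ?_).ge
    have : n ≤ 1 := by omega
    rw [hn]
    exact (Nat.mul_le_mul_left _ this).trans (mul_one _).le
  calc Nat.log 2 (Nat.card K) < Nat.log 2 (Nat.card K * 2) := by
        rw [Nat.log_mul_base one_lt_two Nat.card_pos.ne']
        exact Nat.lt_succ_self _
    _ ≤ Nat.log 2 (Nat.card L) := Nat.log_mono_right (hn ▸ Nat.mul_le_mul_left _ h2)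

/-- In a finite group, a set that contains `1` and is closed under multiplication from the right
by the elements of `T` contains the subgroup generated by `T`. -/
theorem closure_subset_of_mul_mem [Finite H] {T S : Set H} (h1 : 1 ∈ S)
    (h : ∀ x ∈ S, ∀ t ∈ T, x * t ∈ S) : (Subgroup.closure T : Set H) ⊆ S := by
  suffices ∀ x ∈ Submonoid.closure T, x ∈ S from fun x hx => this x <| by
    rw [← Subgroup.closure_toSubmonoid_of_finite]
    exact hx
  intro x hx
  induction hx using Submonoid.closure_induction_right with
  | one => exact h1
  | mul_right x hx t ht ih => exact h x ih t ht

/-- The products of the subsequences of a list, in reverse order. -/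
def cube : List H → Set H
  | [] => {1}
  | z :: zs => cube zs ∪ (· * z) '' cube zs

theorem one_mem_cube (zs : List H) : 1 ∈ cube zs := by
  induction zs with
  | nil => rfl
  | cons z zs ih => exact .inl ih

/-- If `z` is not a quotient of two elements of a cube, then adding it to the list doubles the
size of the cube. -/
theorem ncard_cube_cons [Finite H] {z : H} {zs : List H}
    (h : ∀ x ∈ cube zs, ∀ y ∈ cube zs, z ≠ x⁻¹ * y) :
    (cube (z :: zs)).ncard = 2 * (cube zs).ncard := by
  rw [cube, Set.ncard_union_eq ?_ (Set.toFinite _) (Set.toFinite _),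
    Set.ncard_image_of_injective _ (mul_left_injective z), two_mul]
  rw [Set.disjoint_left]
  rintro _ hy ⟨x, hx, rfl⟩
  exact h x hx _ hy (by simp)

theorem length_le_of_ncard_cube [Finite H] {zs : List H} (h : (cube zs).ncard = 2 ^ zs.length)
    {n : ℕ} (hn : Nat.card H ≤ 2 ^ n) : zs.length ≤ n := by
  refine (Nat.pow_le_pow_iff_right one_lt_two).1 (h ▸ le_trans ?_ hn)
  exact Set.ncard_le_card _

theorem inv_eq_pow [Finite H] (x : H) : x⁻¹ = x ^ (orderOf x - 1) := by
  rw [inv_eq_iff_mul_eq_one, ← pow_succ', Nat.sub_add_cancel (orderOf_pos x), pow_orderOf_eq_one]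

theorem size_orderOf_le [Finite H] (x : H) {n : ℕ} (hn : Nat.card H ≤ 2 ^ n) :
    Nat.size (orderOf x - 1) ≤ n := by
  rw [Nat.size_le]
  have h1 : orderOf x ≤ Nat.card H := orderOf_le_card
  have h2 := orderOf_pos x
  omega

end

/-! ### Enough values and contexts -/

/-- The nonterminals in a production. -/
def Production.nonterminals {T : Type} : Production T → List (List Bool)
  | .bin A C D => [A, C, D]
  | .term A _ => [A]

/-- The nonterminals in the productions of a grammar. -/
def CNFGrammar.nonterminals {T : Type} (X : CNFGrammar T) : Finset (List Bool) :=
  (X.productions.flatMap Production.nonterminals).toFinset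

theorem CNFGrammar.mem_nonterminals {T : Type} {X : CNFGrammar T} {P : Production T}
    (hP : P ∈ X.productions) {A : List Bool} (hA : A ∈ P.nonterminals) : A ∈ X.nonterminals :=
  List.mem_toFinset.2 (List.mem_flatMap.2 ⟨P, hP, hA⟩)

section

variable {G : Type} [Group G] {b c : ℕ} {B : BlackBox G b c} {X : CNFGrammar G}
variable {db db' : List (Fact b)} {A C D : List Bool} {u v : G} {p q : G × Gᵐᵒᵖ}

variable (B X) in
/-- The productions of the grammar are known. -/
structure Knows (db : List (Fact b)) : Prop where
  bin : ∀ {A C D}, .bin A C D ∈ X.productions → (some A, [.inl C, .inl D]) ∈ db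
  term : ∀ {A v}, .term A v ∈ X.productions → HasVal B db A v
  goal : (none, [.inl X.start]) ∈ db

theorem Knows.mono (h : Knows B X db) (hs : db ⊆ db') : Knows B X db' :=
  ⟨fun hP => hs (h.bin hP), fun hP => (h.term hP).mono hs, hs h.goal⟩

variable (B) in
open Classical in
/-- The number of the nonterminals with a known value. -/
noncomputable def numVal (X : CNFGrammar G) (db : List (Fact b)) : ℕ :=
  (X.nonterminals.filter fun A => ∃ v, HasVal B db A v).card

theorem numVal_le (X : CNFGrammar G) (db : List (Fact b)) :
    numVal B X db ≤ X.nonterminals.card := by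
  classical exact Finset.card_filter_le _ _

theorem numVal_lt (hs : db ⊆ db') (hA : A ∈ X.nonterminals) (h : ∀ v, ¬ HasVal B db A v)
    (h' : HasVal B db' A v) : numVal B X db < numVal B X db' := by
  classical
  refine Finset.card_lt_card (Finset.ssubset_iff_of_subset ?_ |>.2 ⟨A, ?_, ?_⟩)
  · intro C hC
    simp only [Finset.mem_filter] at hC ⊢
    exact ⟨hC.1, hC.2.imp fun v h => h.mono hs⟩
  · simp only [Finset.mem_filter]
    exact ⟨hA, v, h'⟩
  · simp [h]

theorem Val.exists_hasVal (hk : Knows B X db) (h : Val X A v) : (∃ u, HasVal B db A u) ∨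
    Can B db 2 fun db' => Knows B X db' ∧ numVal B X db < numVal B X db' := by
  induction h with
  | term h => exact .inl ⟨_, hk.term h⟩
  | @bin A C D u v h _ _ ih₁ ih₂ =>
    by_cases hA : ∃ u, HasVal B db A u
    · exact .inl hA
    rcases ih₁ with ⟨u, hu⟩ | h₁
    · rcases ih₂ with ⟨v, hv⟩ | h₂
      · refine .inr ((HasVal.bin (hk.bin h) hu hv).imp fun db' hs h' => ⟨hk.mono hs, ?_⟩)
        exact numVal_lt hs (CNFGrammar.mem_nonterminals h (by simp [Production.nonterminals]))
          (fun v hv => hA ⟨v, hv⟩) h'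
      · exact .inr h₂
    · exact .inr h₁

/-- A value of every productive nonterminal can be computed. -/
theorem can_hasVal (hk : Knows B X db) : Can B db (2 * X.nonterminals.card) fun db' =>
    Knows B X db' ∧ ∀ A v, Val X A v → ∃ u, HasVal B db' A u := by
  refine Can.iterate (Q := Knows B X) (numVal B X) 2 _ hk (fun db _ => numVal_le X db) ?_
  intro db hk
  by_cases h : ∀ A v, Val X A v → ∃ u, HasVal B db A u
  · exact .inl ⟨hk, h⟩
  · push Not at h
    obtain ⟨A, v, hv, h⟩ := h
    exact .inr ((hv.exists_hasVal hk).resolve_left fun ⟨u, hu⟩ => h u hu)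

variable (B) in
/-- The subgroup that is generated by the quotients of the known values of a nonterminal. -/
def heap (db : List (Fact b)) (A : List Bool) : Subgroup G :=
  Subgroup.closure {d | ∃ u v, HasVal B db A u ∧ HasVal B db A v ∧ d = u * v⁻¹}

theorem HasVal.mem_heap (hu : HasVal B db A u) (hv : HasVal B db A v) : u * v⁻¹ ∈ heap B db A :=
  Subgroup.subset_closure ⟨u, v, hu, hv, rfl⟩

theorem heap_le {K : Subgroup G}
    (h : ∀ u v, HasVal B db A u → HasVal B db A v → u * v⁻¹ ∈ K) : heap B db A ≤ K := by
  rw [heap, Subgroup.closure_le]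
  rintro _ ⟨u, v, hu, hv, rfl⟩
  exact h u v hu hv

theorem heap_mono (hs : db ⊆ db') : heap B db A ≤ heap B db' A :=
  heap_le fun _ _ hu hv => (hu.mono hs).mem_heap (hv.mono hs)

variable (B) in
/-- Up to the heaps, the values of the nonterminals are known. -/
def Covered (X : CNFGrammar G) (db : List (Fact b)) : Prop :=
  ∀ A v, Val X A v → ∃ u, HasVal B db A u ∧ v * u⁻¹ ∈ heap B db A

theorem Covered.mono (h : Covered B X db) (hs : db ⊆ db') : Covered B X db' := by
  intro A v hv
  obtain ⟨u, hu, h⟩ := h A v hv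
  exact ⟨u, hu.mono hs, heap_mono hs h⟩

/-- If the heaps cannot be enlarged by products of two known values, then they are large
enough. -/
theorem covered_of_closed (hk : Knows B X db) (hv : ∀ A v, Val X A v → ∃ u, HasVal B db A u)
    (h : ∀ A C D u v w, .bin A C D ∈ X.productions → HasVal B db C u → HasVal B db D v →
      HasVal B db A w → u * v * w⁻¹ ∈ heap B db A) : Covered B X db := by
  intro A v hA
  obtain ⟨u, hu⟩ := hv A v hA
  refine ⟨u, hu, ?_⟩
  induction hA generalizing u with
  | term hP => exact (hk.term hP).mem_heap hu
  | @bin A C D x y hP hC hD ih₁ ih₂ =>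
    obtain ⟨e, he⟩ := hv C x hC
    obtain ⟨f, hf⟩ := hv D y hD
    have h1 := ih₁ e he
    have h2 := ih₂ f hf
    have h3 : heap B db C ≤ heap B db A := heap_le fun s t hs ht => by
      have := mul_mem (h A C D s f u hP hs hf hu) (inv_mem (h A C D t f u hP ht hf hu))
      simpa [mul_assoc] using this
    have h4 : heap B db D ≤ (heap B db A).comap (MulAut.conj e).toMonoidHom :=
      heap_le fun s t hs ht => by
        have := mul_mem (h A C D e s u hP he hs hu) (inv_mem (h A C D e t u hP he ht hu))
        simpa [mul_assoc] using this
    have h5 := mul_mem (mul_mem (h3 h1) (h4 h2)) (h A C D e f u hP he hf hu)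
    simpa [mul_assoc] using h5

variable [Finite G]

/-- The values of the nonterminals can be covered, as each heap grows at most `b` times. -/
theorem can_covered (hG : Nat.card G ≤ 2 ^ b) (hk : Knows B X db)
    (hv : ∀ A v, Val X A v → ∃ u, HasVal B db A u) :
    Can B db (2 * (X.nonterminals.card * b)) fun db' => Knows B X db' ∧ Covered B X db' := by
  refine Can.iterate (Q := fun db => Knows B X db ∧ ∀ A v, Val X A v → ∃ u, HasVal B db A u)
    (fun db => ∑ A ∈ X.nonterminals, Nat.log 2 (Nat.card (heap B db A))) 2 _ ⟨hk, hv⟩ ?_ ?_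
  · intro db _
    rw [← smul_eq_mul]
    refine Finset.sum_le_card_nsmul _ _ _ fun A _ => ?_
    refine (Nat.log_mono_right ((Subgroup.card_le_card_group _).trans hG)).trans ?_
    rw [Nat.log_pow one_lt_two]
  · rintro db ⟨hk, hv⟩
    by_cases h : ∀ A C D u v w, .bin A C D ∈ X.productions → HasVal B db C u → HasVal B db D v →
      HasVal B db A w → u * v * w⁻¹ ∈ heap B db A
    · exact .inl ⟨hk, covered_of_closed hk hv h⟩
    · push Not at h
      obtain ⟨A, C, D, u, v, w, hP, hC, hD, hA, hn⟩ := h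
      refine .inr ((HasVal.bin (hk.bin hP) hC hD).imp fun db' hs h' => ⟨⟨hk.mono hs, ?_⟩, ?_⟩)
      · exact fun A v h => (hv A v h).imp fun u hu => hu.mono hs
      · refine Finset.sum_lt_sum (fun A _ => log_card_le_of_le (heap_mono hs)) ⟨A, ?_, ?_⟩
        · exact CNFGrammar.mem_nonterminals hP (by simp [Production.nonterminals])
        · refine log_card_lt_of_lt (lt_of_le_of_ne (heap_mono hs) fun he => hn ?_)
          rw [he]
          exact h'.mem_heap (hA.mono hs)

end

/-! ### Contexts -/

section

variable {G : Type} [Group G] {b c : ℕ} {B : BlackBox G b c} {X : CNFGrammar G}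
variable {db db' : List (Fact b)} {A C D : List Bool} {u v : G} {p q : G × Gᵐᵒᵖ}

/-- `Con X A C p` says that `A` derives a word with a single nonterminal `C`, such that the
terminals to the left of `C` have the product `p.1` and those to the right have the product
`p.2`. As `p.2` lies in the opposite group, nested contexts are multiplied. -/
inductive Con (X : CNFGrammar G) (A : List Bool) : List Bool → G × Gᵐᵒᵖ → Prop
  | refl : Con X A A 1
  | left {C D E : List Bool} {p : G × Gᵐᵒᵖ} {u : G} (h : Con X A C p)
      (hP : .bin C D E ∈ X.productions) (hD : Val X D u) : Con X A E (p * (u, 1))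
  | right {C D E : List Bool} {p : G × Gᵐᵒᵖ} {u : G} (h : Con X A C p)
      (hP : .bin C D E ∈ X.productions) (hE : Val X E u) : Con X A D (p * (1, .op u))

theorem Con.trans (h : Con X A C p) (h' : Con X C D q) : Con X A D (p * q) := by
  induction h' with
  | refl => simpa using h
  | left _ hP hD ih =>
    rw [← mul_assoc]
    exact ih.left hP hD
  | right _ hP hE ih =>
    rw [← mul_assoc]
    exact ih.right hP hE

theorem Con.val (h : Con X A C p) (hv : Val X C v) : Val X A (p.1 * v * p.2.unop) := by
  induction h generalizing v with
  | refl => simpa using hv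
  | left _ hP hD ih => simpa [mul_assoc] using ih (.bin hP hD hv)
  | right _ hP hE ih => simpa [mul_assoc] using ih (.bin hP hv hE)

theorem Con.mem_nonterminals (h : Con X A C p) (hA : A ∈ X.nonterminals) : C ∈ X.nonterminals := by
  cases h with
  | refl => exact hA
  | left _ hP => exact CNFGrammar.mem_nonterminals hP (by simp [Production.nonterminals])
  | right _ hP => exact CNFGrammar.mem_nonterminals hP (by simp [Production.nonterminals])

variable (B) in
/-- For all pairs of nonterminals that are connected by a context, one such context is known. -/
def Connected (X : CNFGrammar G) (db : List (Fact b)) : Prop :=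
  ∀ A C p, A ∈ X.nonterminals → Con X A C p → ∃ q, HasCon B db A C q

variable (B) in
open Classical in
/-- The number of the pairs of nonterminals with a known context. -/
noncomputable def numCon (X : CNFGrammar G) (db : List (Fact b)) : ℕ :=
  ((X.nonterminals ×ˢ X.nonterminals).filter fun P => ∃ q, HasCon B db P.1 P.2 q).card

theorem numCon_le (X : CNFGrammar G) (db : List (Fact b)) :
    numCon B X db ≤ X.nonterminals.card * X.nonterminals.card := by
  classical exact (Finset.card_filter_le _ _).trans (Finset.card_product _ _).le

theorem numCon_lt (hs : db ⊆ db') (hA : A ∈ X.nonterminals) (hC : C ∈ X.nonterminals)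
    (h : ∀ q, ¬ HasCon B db A C q) (h' : HasCon B db' A C q) :
    numCon B X db < numCon B X db' := by
  classical
  refine Finset.card_lt_card (Finset.ssubset_iff_of_subset ?_ |>.2 ⟨(A, C), ?_, ?_⟩)
  · intro P hP
    simp only [Finset.mem_filter] at hP ⊢
    exact ⟨hP.1, hP.2.imp fun v h => h.mono hs⟩
  · simp only [Finset.mem_filter, Finset.mem_product]
    exact ⟨⟨hA, hC⟩, q, h'⟩
  · simp [h]

theorem Con.exists_hasCon (hk : Knows B X db) (hc : Covered B X db) (hA : A ∈ X.nonterminals)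
    (h : Con X A C p) : (∃ q, HasCon B db A C q) ∨ Can B db 3 fun db' =>
      (Knows B X db' ∧ Covered B X db') ∧ numCon B X db < numCon B X db' := by
  have key : ∀ {E : List Bool} {q : G × Gᵐᵒᵖ}, E ∈ X.nonterminals →
      Can B db 3 (HasCon B · A E q) → (∃ q, HasCon B db A E q) ∨ Can B db 3 fun db' =>
      (Knows B X db' ∧ Covered B X db') ∧ numCon B X db < numCon B X db' := by
    intro E q hE h'
    by_cases hq : ∃ q, HasCon B db A E q
    · exact .inl hq
    · exact .inr (h'.imp fun db' hs h' => ⟨⟨hk.mono hs, hc.mono hs⟩,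
        numCon_lt hs hA hE (fun q hq' => hq ⟨q, hq'⟩) h'⟩)
  induction h with
  | refl => exact .inl ⟨1, .refl A⟩
  | @left C D E p u h hP hD ih =>
    rcases ih with ⟨q, hq⟩ | ih
    · obtain ⟨v, hv, -⟩ := hc D u hD
      refine key (CNFGrammar.mem_nonterminals hP (by simp [Production.nonterminals]))
        (q := q * (v, 1)) ((HasVal.hasCon_left (hk.bin hP) hv).bind (n' := 2) fun db' hs h' =>
          (hq.mono hs).comp h')
    · exact .inr ih
  | @right C D E p u h hP hE ih =>
    rcases ih with ⟨q, hq⟩ | ih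
    · obtain ⟨v, hv, -⟩ := hc E u hE
      refine key (CNFGrammar.mem_nonterminals hP (by simp [Production.nonterminals]))
        (q := q * (1, .op v)) ((HasVal.hasCon_right (hk.bin hP) hv).bind (n' := 2)
          fun db' hs h' => (hq.mono hs).comp h')
    · exact .inr ih

/-- A context for every connected pair of nonterminals can be computed. -/
theorem can_connected (hk : Knows B X db) (hc : Covered B X db) :
    Can B db (3 * (X.nonterminals.card * X.nonterminals.card)) fun db' =>
      (Knows B X db' ∧ Covered B X db') ∧ Connected B X db' := by
  refine Can.iterate (Q := fun db => Knows B X db ∧ Covered B X db) (numCon B X) 3 _ ⟨hk, hc⟩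
    (fun db _ => numCon_le X db) ?_
  rintro db ⟨hk, hc⟩
  by_cases h : Connected B X db
  · exact .inl ⟨⟨hk, hc⟩, h⟩
  · unfold Connected at h
    push Not at h
    obtain ⟨A, C, p, hA, hp, h⟩ := h
    exact .inr ((hp.exists_hasCon hk hc hA).resolve_left fun ⟨q, hq⟩ => h q hq)

/-! ### Pumps -/

variable (B) in
/-- The contexts from `A` to itself that can be computed within five passes. -/
def pumps (db : List (Fact b)) (A : List Bool) : Set (G × Gᵐᵒᵖ) :=
  {t | ∀ db', db ⊆ db' → Can B db' 5 (HasCon B · A A t)}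

theorem mul_mem_pumps (hp : HasCon B db A C p) (hq : HasCon B db C A q) :
    p * q ∈ pumps B db A :=
  fun _ hs => ((hp.mono hs).comp (hq.mono hs)).mono (by norm_num)

theorem mul_left_mul_mem_pumps {E : List Bool} (hk : Knows B X db) (hp : HasCon B db A C p)
    (hP : .bin C D E ∈ X.productions) (hD : HasVal B db D u) (hq : HasCon B db E A q) :
    p * (u, 1) * q ∈ pumps B db A := fun _ hs =>
  ((HasVal.hasCon_left (hs (hk.bin hP)) (hD.mono hs)).bind (n' := 2) fun _ hs' h =>
    ((hp.mono hs).mono hs').comp h).bind (n := 3) (n' := 2) fun _ hs' h =>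
      h.comp ((hq.mono hs).mono hs')

theorem mul_right_mul_mem_pumps {E : List Bool} (hk : Knows B X db) (hp : HasCon B db A C p)
    (hP : .bin C D E ∈ X.productions) (hE : HasVal B db E u) (hq : HasCon B db D A q) :
    p * (1, .op u) * q ∈ pumps B db A := fun _ hs =>
  ((HasVal.hasCon_right (hs (hk.bin hP)) (hE.mono hs)).bind (n' := 2) fun _ hs' h =>
    ((hp.mono hs).mono hs').comp h).bind (n := 3) (n' := 2) fun _ hs' h =>
      h.comp ((hq.mono hs).mono hs')

end

section

variable {G : Type} [Group G] {b c : ℕ} {B : BlackBox G b c} {X : CNFGrammar G}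
variable {db db' : List (Fact b)} {A C D : List Bool} {u v : G} {p q : G × Gᵐᵒᵖ}

/-- Every context from `A` to `C`, followed by a known context back to `A`, belongs to the group
generated by the pumps of `A`. -/
theorem Con.mul_mem_closure_pumps (hk : Knows B X db) (hc : Covered B X db)
    (hn : Connected B X db) (hA : A ∈ X.nonterminals) (h : Con X A C p) {q' : G × Gᵐᵒᵖ}
    (hq : HasCon B db C A q) (hq' : Con X C A q') :
    p * q ∈ Subgroup.closure (pumps B db A) := by
  induction h generalizing q q' with
  | refl => exact Subgroup.subset_closure (mul_mem_pumps (.refl A) hq)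
  | @left C D E p u h hP hD ih =>
    have hC : Con X C A ((u, 1) * q') := by simpa using (Con.refl.left hP hD).trans hq'
    obtain ⟨r, hr⟩ := hn A C p hA h
    obtain ⟨r', hr'⟩ := hn C A _ (h.mem_nonterminals hA) hC
    obtain ⟨e, he, hu⟩ := hc D u hD
    have h1 := ih hr' hC
    have h2 := Subgroup.subset_closure (mul_mem_pumps hr hr')
    have h3 : ∀ w, HasVal B db D w →
        r * MonoidHom.inl G Gᵐᵒᵖ w * q ∈ Subgroup.closure (pumps B db A) := fun w hw =>
      Subgroup.subset_closure (mul_left_mul_mem_pumps hk hr hP hw hq)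
    have h4 : heap B db D ≤ (Subgroup.closure (pumps B db A)).comap
        ((MulAut.conj r).toMonoidHom.comp (MonoidHom.inl G Gᵐᵒᵖ)) := heap_le fun s t hs ht => by
      have := mul_mem (h3 s hs) (inv_mem (h3 t ht))
      rw [Subgroup.mem_comap, MonoidHom.comp_apply, map_mul, map_inv]
      simpa only [MulEquiv.coe_toMonoidHom, MulAut.conj_apply, mul_assoc, mul_inv_rev,
        mul_inv_cancel_left] using this
    have h5 := mul_mem (mul_mem (mul_mem h1 (inv_mem h2)) (h4 hu)) (h3 e he)
    change p * MonoidHom.inl G Gᵐᵒᵖ u * q ∈ _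
    rw [MonoidHom.comp_apply, map_mul, map_inv] at h5
    simpa only [MulEquiv.coe_toMonoidHom, MulAut.conj_apply, mul_assoc, mul_inv_rev,
      mul_inv_cancel_left, inv_mul_cancel_left] using h5
  | @right C D E p u h hP hE ih =>
    have hC : Con X C A ((1, .op u) * q') := by simpa using (Con.refl.right hP hE).trans hq'
    obtain ⟨r, hr⟩ := hn A C p hA h
    obtain ⟨r', hr'⟩ := hn C A _ (h.mem_nonterminals hA) hC
    obtain ⟨e, he, hu⟩ := hc E u hE
    have h1 := ih hr' hC
    have h2 := Subgroup.subset_closure (mul_mem_pumps hr hr')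
    have h3 : ∀ w, HasVal B db E w →
        r * MonoidHom.inr G Gᵐᵒᵖ (.op w) * q ∈ Subgroup.closure (pumps B db A) := fun w hw =>
      Subgroup.subset_closure (mul_right_mul_mem_pumps hk hr hP hw hq)
    change p * MonoidHom.inr G Gᵐᵒᵖ (.op u) * q ∈ _
    generalize MonoidHom.inr G Gᵐᵒᵖ = φ at h3 ⊢
    -- The map to the opposite group becomes a homomorphism when it is composed with inversion.
    have h4 : heap B db E ≤ (Subgroup.closure (pumps B db A)).comap
        ((MulAut.conj q⁻¹).toMonoidHom.comp (φ.comp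
          (MulEquiv.inv' G).toMonoidHom)) := heap_le fun s t hs ht => by
      have := mul_mem (inv_mem (h3 s hs)) (h3 t ht)
      rw [Subgroup.mem_comap, MonoidHom.comp_apply, MonoidHom.comp_apply]
      simpa [mul_assoc, MulOpposite.op_mul, map_mul, map_inv] using this
    have h5 := mul_mem (mul_mem (mul_mem h1 (inv_mem h2)) (h3 e he)) (inv_mem (h4 hu))
    simpa [mul_assoc] using h5

/-! ### Short products of pumps -/

theorem can_of_mem_cube {zs : List (G × Gᵐᵒᵖ)} (h : ∀ z ∈ zs, HasCon B db A A z) {x : G × Gᵐᵒᵖ}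
    (hx : x ∈ cube zs) : Can B db (2 * zs.length) (HasCon B · A A x) := by
  induction zs generalizing x with
  | nil =>
    obtain rfl : x = 1 := hx
    exact .of _ (.refl A)
  | cons z zs ih =>
    simp only [List.forall_mem_cons] at h
    rcases hx with hx | ⟨x, hx, rfl⟩
    · exact (ih h.2 hx).mono (by simp)
    · exact (ih h.2 hx).bind (n' := 2) fun _ hs h' => h'.comp (h.1.mono hs)

variable (B X) in
/-- A list of at most `m` contexts from `A` to itself is known such that all contexts from `A` to
itself are quotients of two elements of its cube. -/
def Pumpable (m : ℕ) (db : List (Fact b)) (A : List Bool) : Prop :=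
  ∃ zs : List (G × Gᵐᵒᵖ), zs.length ≤ m ∧ (∀ z ∈ zs, HasCon B db A A z) ∧
    ∀ p, Con X A A p → ∃ x ∈ cube zs, ∃ y ∈ cube zs, p = x⁻¹ * y

theorem Pumpable.mono {m : ℕ} (h : Pumpable B X m db A) (hs : db ⊆ db') :
    Pumpable B X m db' A := by
  obtain ⟨zs, hl, h, h'⟩ := h
  exact ⟨zs, hl, fun z hz => (h z hz).mono hs, h'⟩

variable [Finite (G × Gᵐᵒᵖ)]

theorem can_inv_mul {m : ℕ} (hm : Nat.card (G × Gᵐᵒᵖ) ≤ 2 ^ m) {zs : List (G × Gᵐᵒᵖ)}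
    (hl : zs.length ≤ m) (h : ∀ z ∈ zs, HasCon B db A A z) {x y : G × Gᵐᵒᵖ}
    (hx : x ∈ cube zs) (hy : y ∈ cube zs) :
    Can B db (8 * m + 2) (HasCon B · A A (x⁻¹ * y)) := by
  have hs := size_orderOf_le x hm
  rw [inv_eq_pow x]
  refine Can.mono (n := 2 * zs.length + (4 * Nat.size (orderOf x - 1) + (2 * zs.length + 2)))
    ((can_of_mem_cube h hx).bind fun db₁ hs₁ h₁ => (h₁.pow _).bind fun db₂ hs₂ h₂ =>
      (can_of_mem_cube (fun z hz => ((h z hz).mono hs₁).mono hs₂) hy).bind fun db₃ hs₃ h₃ =>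
        (h₂.mono hs₃).comp h₃) (by omega)

/-- Short products of pumps yield all contexts from `A` to itself: as long as the quotients of a cube
of known contexts are not closed under multiplication by pumps, the cube can be doubled, and this
happens at most `m` times. -/
theorem can_pumpable {m : ℕ} (hm : Nat.card (G × Gᵐᵒᵖ) ≤ 2 ^ m) (hk : Knows B X db)
    (hc : Covered B X db) (hn : Connected B X db) (hA : A ∈ X.nonterminals) (hs : db ⊆ db') :
    Can B db' ((8 * m + 9) * (m + 1)) (Pumpable B X m · A) := by
  suffices ∀ i (zs : List (G × Gᵐᵒᵖ)) db', db ⊆ db' → (∀ z ∈ zs, HasCon B db' A A z) →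
      (cube zs).ncard = 2 ^ zs.length → m + 1 ≤ zs.length + i →
      Can B db' ((8 * m + 9) * i) (Pumpable B X m · A) from
    this (m + 1) [] db' hs (by simp) (by simp [cube]) (by simp)
  intro i
  induction i with
  | zero =>
    intro zs db' _ _ hz hi
    have := length_le_of_ncard_cube hz hm
    omega
  | succ i ih =>
    intro zs db' hs hz hz' hi
    have hl := length_le_of_ncard_cube hz' hm
    by_cases h : ∀ x ∈ {x | ∃ y ∈ cube zs, ∃ z ∈ cube zs, x = y⁻¹ * z}, ∀ t ∈ pumps B db A,
        x * t ∈ {x | ∃ y ∈ cube zs, ∃ z ∈ cube zs, x = y⁻¹ * z}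
    · refine .of _ ⟨zs, hl, hz, fun p hp => ?_⟩
      have h1 := hp.mul_mem_closure_pumps hk hc hn hA (.refl A) .refl
      rw [mul_one] at h1
      exact closure_subset_of_mul_mem (S := {x | ∃ y ∈ cube zs, ∃ z ∈ cube zs, x = y⁻¹ * z})
        ⟨1, one_mem_cube zs, 1, one_mem_cube zs, by simp⟩ h h1
    · simp only [Set.mem_ofPred_eq] at h
      push Not at h
      obtain ⟨_, ⟨x, hx, y, hy, rfl⟩, t, ht, h⟩ := h
      refine Can.mono (n := (8 * m + 2 + (5 + 2)) + (8 * m + 9) * i)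
        (((can_inv_mul hm hl hz hx hy).bind fun db₁ hs₁ h₁ =>
          (ht db₁ (List.Subset.trans hs hs₁)).bind fun db₂ hs₂ h₂ => (h₁.mono hs₂).comp h₂).bind
        fun db₃ hs₃ h₃ => ih ((x⁻¹ * y * t) :: zs) db₃ (List.Subset.trans hs hs₃) ?_ ?_ ?_)
        (by rw [Nat.mul_succ]; omega)
      · simp only [List.forall_mem_cons]
        exact ⟨h₃, fun z hz₁ => (hz z hz₁).mono hs₃⟩
      · rw [ncard_cube_cons fun x hx y hy => h x hx y hy, hz', List.length_cons, pow_succ']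
      · simp only [List.length_cons]
        omega

end

/-! ### Acyclic trees -/

namespace DTree

variable {T : Type}

/-- The nonterminal `A` is the label of a node. -/
def Occurs (A : List Bool) : DTree T → Prop
  | .unit C _ => A = C
  | .node C l r => A = C ∨ l.Occurs A ∨ r.Occurs A

/-- The largest number of edges on a path from the root to a node labelled with a nonterminal. -/
def height : DTree T → ℕ
  | .unit _ _ => 0
  | .node _ l r => max l.height r.height + 1

/-- The number of nodes that are labelled with nonterminals. -/
def size : DTree T → ℕ
  | .unit _ _ => 1
  | .node _ l r => l.size + r.size + 1

variable {t l r : DTree T} {A : List Bool} {X : CNFGrammar T}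

theorem occurs_of_mem {w : List (List Bool)} (hw : w ∈ t.paths) (hA : A ∈ w) : t.Occurs A := by
  induction t generalizing w with
  | unit C a => simpa [paths, Occurs] using (List.mem_singleton.1 hw ▸ hA : A ∈ [C])
  | node C l r ihl ihr =>
    simp only [paths, List.mem_map, List.mem_append] at hw
    obtain ⟨w, hw, rfl⟩ := hw
    rcases List.mem_cons.1 hA with rfl | hA
    · exact .inl rfl
    · exact .inr (hw.imp (ihl · hA) (ihr · hA))

theorem acyclic_unit (A : List Bool) (a : T) : (DTree.unit A a).Acyclic := by
  simp [Acyclic, paths]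

theorem Acyclic.node (hl : l.Acyclic) (hr : r.Acyclic) (hl' : ¬ l.Occurs A)
    (hr' : ¬ r.Occurs A) : (DTree.node A l r).Acyclic := by
  intro w hw
  simp only [paths, List.mem_map, List.mem_append] at hw
  obtain ⟨w, hw, rfl⟩ := hw
  rw [List.nodup_cons]
  rcases hw with hw | hw
  · exact ⟨fun h => hl' (occurs_of_mem hw h), hl w hw⟩
  · exact ⟨fun h => hr' (occurs_of_mem hw h), hr w hw⟩

theorem Acyclic.left (h : (DTree.node A l r).Acyclic) : l.Acyclic := fun w hw =>
  (List.nodup_cons.1 (h (A :: w) (by simp [paths, hw]))).2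

theorem Acyclic.right (h : (DTree.node A l r).Acyclic) : r.Acyclic := fun w hw =>
  (List.nodup_cons.1 (h (A :: w) (by simp [paths, hw]))).2

theorem Respects.root_mem (h : t.Respects X) : t.root ∈ X.nonterminals := by
  cases t with
  | unit => exact CNFGrammar.mem_nonterminals h (by simp [Production.nonterminals, root])
  | node => exact CNFGrammar.mem_nonterminals h.1 (by simp [Production.nonterminals, root])

theorem Respects.exists_path (h : t.Respects X) :
    ∃ w ∈ t.paths, w.length = t.height + 1 ∧ ∀ A ∈ w, A ∈ X.nonterminals := by
  induction t with
  | unit C a => exact ⟨[C], by simp [paths], by simp [height], by simpa [root] using h.root_mem⟩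
  | node C l r ihl ihr =>
    have hC := h.root_mem
    rcases le_total l.height r.height with hlr | hlr
    · obtain ⟨w, hw, hl, hX⟩ := ihr h.2.2
      refine ⟨C :: w, by simp [paths, hw], by simp [height, hl, hlr], ?_⟩
      simp only [List.forall_mem_cons]
      exact ⟨hC, hX⟩
    · obtain ⟨w, hw, hl, hX⟩ := ihl h.2.1
      refine ⟨C :: w, by simp [paths, hw], by simp [height, hl, hlr], ?_⟩
      simp only [List.forall_mem_cons]
      exact ⟨hC, hX⟩

theorem Respects.height_lt (h : t.Respects X) (ha : t.Acyclic) :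
    t.height + 1 ≤ X.nonterminals.card := by
  obtain ⟨w, hw, hl, hX⟩ := h.exists_path
  rw [← hl, ← List.toFinset_card_of_nodup (ha w hw)]
  exact Finset.card_le_card fun A hA => hX A (List.mem_toFinset.1 hA)

theorem pow_add_pow_le {d m n : ℕ} (hd : 1 ≤ d) (h : m < n) : d ^ m + d ^ n ≤ (d + 1) ^ n := by
  obtain ⟨n, rfl⟩ := Nat.exists_eq_add_of_lt (Nat.zero_lt_of_lt h)
  rw [Nat.zero_add] at *
  calc d ^ m + d ^ (n + 1) ≤ d ^ n + d ^ n * d := by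
        rw [pow_succ]
        exact Nat.add_le_add_right (Nat.pow_le_pow_right hd (by omega)) _
    _ = d ^ n * (d + 1) := by ring
    _ ≤ (d + 1) ^ n * (d + 1) := Nat.mul_le_mul_right _ (Nat.pow_le_pow_left (by omega) _)

/-- Trees with small Horton-Strahler number are small. -/
theorem size_le (t : DTree T) : t.size + 1 ≤ 2 * (t.height + 1) ^ t.hs := by
  induction t with
  | unit => simp [size, hs]
  | node C l r ihl ihr =>
    simp only [size, hs, height]
    have hL : ∀ n, (l.height + 1) ^ n ≤ (max l.height r.height + 1) ^ n := fun n =>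
      Nat.pow_le_pow_left (by omega) n
    have hR : ∀ n, (r.height + 1) ^ n ≤ (max l.height r.height + 1) ^ n := fun n =>
      Nat.pow_le_pow_left (by omega) n
    replace ihl := ihl.trans (Nat.mul_le_mul_left 2 (hL _))
    replace ihr := ihr.trans (Nat.mul_le_mul_left 2 (hR _))
    have hd : 1 ≤ max l.height r.height + 1 := Nat.le_add_left _ _
    generalize max l.height r.height + 1 = d at *
    split_ifs with h
    · rw [← h] at ihr
      have h1 : d ^ l.hs * 2 ≤ (d + 1) ^ l.hs * (d + 1) :=
        Nat.mul_le_mul (Nat.pow_le_pow_left (by omega) _) (by omega)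
      rw [add_comm 1, pow_succ]
      omega
    · rcases lt_or_gt_of_ne h with h | h
      · rw [max_eq_right h.le]
        have := pow_add_pow_le hd h
        omega
      · rw [max_eq_left h.le]
        have := pow_add_pow_le hd h
        omega

end DTree

section

variable {G : Type} [Group G] {X : CNFGrammar G} {A C : List Bool} {u v : G} {p q : G × Gᵐᵒᵖ}

/-- The product of a word that is obtained from a word with product `v` by adding the terminals of
a context. -/
def wrap (p : G × Gᵐᵒᵖ) (v : G) : G := p.1 * v * p.2.unop

theorem wrap_mul (p q : G × Gᵐᵒᵖ) (v : G) : wrap (p * q) v = wrap p (wrap q v) := by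
  simp [wrap, mul_assoc]

theorem wrap_one (v : G) : wrap 1 v = v := by
  simp [wrap]

/-- `Dec X t v` says that `v` is the product of a word that is derived by the tree `t` when a
context from its label to itself is inserted at every node. -/
inductive Dec (X : CNFGrammar G) : DTree G → G → Prop
  | unit {A : List Bool} {v : G} {p : G × Gᵐᵒᵖ} (h : Con X A A p) : Dec X (.unit A v) (wrap p v)
  | node {A : List Bool} {l r : DTree G} {u v : G} {p : G × Gᵐᵒᵖ} (hl : Dec X l u)
      (hr : Dec X r v) (h : Con X A A p) : Dec X (.node A l r) (wrap p (u * v))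

variable {t : DTree G}

theorem Dec.val (h : Dec X t v) (ht : t.Respects X) : Val X t.root v := by
  induction h with
  | unit h => exact h.val (.term ht)
  | node _ _ h ihl ihr => exact h.val (.bin ht.1 (ihl ht.2.1) (ihr ht.2.2))

theorem Dec.wrap (h : Dec X t v) (hp : Con X t.root t.root p) : Dec X t (wrap p v) := by
  cases h with
  | unit h =>
    rw [← wrap_mul]
    exact .unit (hp.trans h)
  | node hl hr h =>
    rw [← wrap_mul]
    exact .node hl hr (hp.trans h)

/-- A nonterminal that occurs in a tree is the label of the root of a subtree. -/
theorem Dec.exists_subtree (h : Dec X t v) (ht : t.Respects X) (ha : t.Acyclic)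
    (hA : t.Occurs A) : ∃ t' v' p, t'.root = A ∧ t'.Respects X ∧ t'.Acyclic ∧ Dec X t' v' ∧
      Con X t.root A p ∧ v = BlackBoxGroups.wrap p v' := by
  induction h with
  | @unit C v p h =>
    obtain rfl : A = C := hA
    exact ⟨_, _, 1, rfl, ht, ha, .unit h, .refl, (wrap_one _).symm⟩
  | @node C l r u v p hl hr h ihl ihr =>
    rcases hA with rfl | hA | hA
    · exact ⟨_, _, 1, rfl, ht, ha, .node hl hr h, .refl, (wrap_one _).symm⟩
    · obtain ⟨t', v', q, h1, h2, h3, h4, h5, rfl⟩ := ihl ht.2.1 ha.left hA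
      have h6 := (h.right ht.1 (hr.val ht.2.2)).trans h5
      refine ⟨t', v', _, h1, h2, h3, h4, h6, ?_⟩
      simp [BlackBoxGroups.wrap, mul_assoc]
    · obtain ⟨t', v', q, h1, h2, h3, h4, h5, rfl⟩ := ihr ht.2.2 ha.right hA
      have h6 := (h.left ht.1 (hl.val ht.2.1)).trans h5
      refine ⟨t', v', _, h1, h2, h3, h4, h6, ?_⟩
      simp [BlackBoxGroups.wrap, mul_assoc]

/-- Every value of a nonterminal is produced by an acyclic tree with inserted contexts: if a label
is repeated on a path, then the part in between becomes a context. -/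
theorem Val.exists_dec (h : Val X A v) :
    ∃ t : DTree G, t.root = A ∧ t.Respects X ∧ t.Acyclic ∧ Dec X t v := by
  induction h with
  | @term A v h =>
    refine ⟨.unit A v, rfl, h, DTree.acyclic_unit A v, ?_⟩
    simpa [wrap_one] using Dec.unit (v := v) (Con.refl (X := X) (A := A))
  | @bin A C D u v hP hC hD ihC ihD =>
    obtain ⟨l, rfl, hl, hla, hld⟩ := ihC
    obtain ⟨r, rfl, hr, hra, hrd⟩ := ihD
    by_cases hAl : l.Occurs A
    · obtain ⟨t, w, p, rfl, h2, h3, h4, h5, rfl⟩ := hld.exists_subtree hl hla hAl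
      refine ⟨t, rfl, h2, h3, ?_⟩
      simpa [wrap_mul, BlackBoxGroups.wrap, mul_assoc] using
        h4.wrap ((Con.refl.right hP hD).trans h5)
    by_cases hAr : r.Occurs A
    · obtain ⟨t, w, p, rfl, h2, h3, h4, h5, rfl⟩ := hrd.exists_subtree hr hra hAr
      refine ⟨t, rfl, h2, h3, ?_⟩
      simpa [wrap_mul, BlackBoxGroups.wrap, mul_assoc] using
        h4.wrap ((Con.refl.left hP hC).trans h5)
    · refine ⟨.node A l r, rfl, ⟨hP, hl, hr⟩, hla.node hra hAl hAr, ?_⟩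
      simpa [wrap_one] using Dec.node hld hrd (Con.refl (X := X) (A := A))

variable {b c : ℕ} {B : BlackBox G b c} {db : List (Fact b)} [Finite (G × Gᵐᵒᵖ)]

/-- The value of a tree with inserted contexts can be computed by evaluating the tree. -/
theorem Dec.can_hasVal {m : ℕ} (hm : Nat.card (G × Gᵐᵒᵖ) ≤ 2 ^ m) (hk : Knows B X db)
    (hp : ∀ A ∈ X.nonterminals, Pumpable B X m db A) (h : Dec X t v) (ht : t.Respects X) :
    Can B db (t.size * (8 * m + 7)) (HasVal B · t.root v) := by
  have key : ∀ {A p db' v}, db ⊆ db' → A ∈ X.nonterminals → Con X A A p → HasVal B db' A v →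
      Can B db' (8 * m + 5) (HasVal B · A (BlackBoxGroups.wrap p v)) := by
    intro A p db' v hs hA h hv
    obtain ⟨zs, hl, hz, hz'⟩ := (hp A hA).mono hs
    obtain ⟨x, hx, y, hy, rfl⟩ := hz' p h
    exact (can_inv_mul hm hl hz hx hy).bind (n' := 3) fun _ hs' h' => h'.val (hv.mono hs')
  induction h generalizing db with
  | unit h =>
    exact (key (List.Subset.refl _) ht.root_mem h (hk.term ht)).mono (by simp [DTree.size])
  | @node A l r u v p hl hr h ihl ihr =>
    refine Can.mono (n := l.size * (8 * m + 7) + (r.size * (8 * m + 7) + (2 + (8 * m + 5))))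
      ((ihl hk hp ht.2.1 key).bind fun db₁ hs₁ h₁ => (ihr (hk.mono hs₁)
        (fun A hA => (hp A hA).mono hs₁) ht.2.2 fun hs => key (List.Subset.trans hs₁ hs)).bind
        fun db₂ hs₂ h₂ => (HasVal.bin (hs₂ (hs₁ (hk.bin ht.1))) (h₁.mono hs₂) h₂).bind
          fun db₃ hs₃ h₃ => key (List.Subset.trans (List.Subset.trans hs₁ hs₂) hs₃) ht.root_mem h
            h₃) ?_
    simp only [DTree.size, Nat.add_mul, one_mul]
    omega

end

/-! ### Polynomially many passes suffice -/

section

variable {G : Type} [Group G] {b c : ℕ} {B : BlackBox G b c} {X : CNFGrammar G}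
variable {Y : CNFGrammar (Fin b → Bool)} {db : List (Fact b)}

theorem card_le_of_blackBox (B : BlackBox G b c) : Nat.card G ≤ 2 ^ b := by
  choose x hx using B.f_surj
  have hinj : Function.Injective x := fun g h hgh => by
    have := hx g
    rw [hgh, hx h] at this
    exact (Option.some_inj.1 this).symm
  simpa using Nat.card_le_card_of_injective x hinj

theorem card_contexts_le (B : BlackBox G b c) : Nat.card (G × Gᵐᵒᵖ) ≤ 2 ^ (2 * b) := by
  have h := card_le_of_blackBox B
  rw [Nat.card_prod, ← Nat.card_congr (MulOpposite.opEquiv (α := G)), two_mul, pow_add]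
  exact Nat.mul_le_mul h h

theorem exists_production {Q : Production G} (hY : Y.map B.f = X.map some)
    (hQ : Q ∈ X.productions) : ∃ P ∈ Y.productions, P.map B.f = Q.map some := by
  have h := List.mem_map_of_mem (f := Production.map some) hQ
  rwa [← productions_eq hY, List.mem_map] at h

theorem knows_initFacts (hY : Y.map B.f = X.map some) : Knows B X (initFacts Y) where
  bin {A C D} h := by
    obtain ⟨P, hP, h⟩ := exists_production hY h
    cases P with
    | bin A' C' D' =>
      simp only [Production.map, Production.bin.injEq] at h
      obtain ⟨rfl, rfl, rfl⟩ := h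
      exact List.mem_cons_of_mem _ (List.mem_map_of_mem (f := factOfProduction) hP)
    | term => simp [Production.map] at h
  term {A v} h := by
    obtain ⟨P, hP, h'⟩ := exists_production hY h
    cases P with
    | bin => simp [Production.map] at h'
    | term A' x =>
      simp only [Production.map, Production.term.injEq] at h'
      obtain ⟨rfl, hx⟩ := h'
      exact ⟨x, hx, List.mem_cons_of_mem _ (List.mem_map_of_mem (f := factOfProduction) hP)⟩
  goal := by
    rw [← start_eq hY]
    exact List.mem_cons_self

variable [Finite G]

/-- A bound for the number of passes that compute a value of the start symbol; `N` is the number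
of nonterminals. -/
def numPasses (k b N : ℕ) : ℕ :=
  2 * N + (2 * (N * b) + (3 * (N * N) + (N * ((8 * (2 * b) + 9) * (2 * b + 1)) +
    (2 * N ^ k * (8 * (2 * b) + 7) + 1))))

/-- If `v` is a value of the start symbol, then a name of `v` can be derived from the goal. It is
here that the bound for the Horton-Strahler number is used: the tree to be evaluated is acyclic, so
it has polynomial size. -/
theorem can_goal {k : ℕ} (hX : X.InCFG k) (hk : Knows B X db) {v : G} (hv : Val X X.start v) :
    Can B db (numPasses k b X.nonterminals.card)
      fun db' => ∃ x, B.f x = some v ∧ (none, [.inr x]) ∈ db' := by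
  have : Finite Gᵐᵒᵖ := Finite.of_equiv G MulOpposite.opEquiv
  have hm := card_contexts_le B
  refine (can_hasVal hk).bind fun db₁ _ ⟨hk₁, hv₁⟩ =>
    (can_covered (card_le_of_blackBox B) hk₁ hv₁).bind fun db₂ _ ⟨hk₂, hc₂⟩ =>
    (can_connected hk₂ hc₂).bind fun db₃ _ ⟨⟨hk₃, hc₃⟩, hn₃⟩ =>
    (Can.forall_finset X.nonterminals (fun A db => Pumpable B X (2 * b) db A) (fun _ _ _ hs h =>
      Pumpable.mono h hs) fun A hA _ hs => can_pumpable hm hk₃ hc₃ hn₃ hA hs).bind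
    fun db₄ hs₄ hp₄ => ?_
  obtain ⟨t, ht, htr, hta, htd⟩ := hv.exists_dec
  have hsize : t.size ≤ 2 * X.nonterminals.card ^ k := by
    have h1 := htr.height_lt hta
    have h2 : (t.height + 1) ^ t.hs ≤ X.nonterminals.card ^ k :=
      (Nat.pow_le_pow_left h1 _).trans
        (Nat.pow_le_pow_right (by omega) (hX t ⟨ht, htr⟩ hta))
    have := t.size_le
    omega
  have hk₄ := hk₃.mono hs₄
  have hc := htd.can_hasVal hm hk₄ hp₄ htr
  rw [ht] at hc
  exact (hc.mono (Nat.mul_le_mul_right _ hsize)).bind fun db₅ hs₅ h₅ => h₅.goal (hs₅ hk₄.goal)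

theorem nonterminals_map {T U : Type} (φ : T → U) (X : CNFGrammar T) :
    (X.map φ).nonterminals = X.nonterminals := by
  rw [CNFGrammar.nonterminals, CNFGrammar.nonterminals, CNFGrammar.map, List.flatMap_map]
  congr 2
  funext P
  cases P <;> rfl

theorem card_nonterminals_le (Y : CNFGrammar (Fin b → Bool)) :
    Y.nonterminals.card ≤ (encProductions Y.productions).length := by
  refine (List.toFinset_card_le _).trans ?_
  rw [encProductions, List.length_flatMap, List.length_flatMap]
  refine List.sum_le_sum fun P _ => ?_
  cases P <;> simp [Production.nonterminals, encProduction, Production.map,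
    Production.encode]
  omega

theorem numPasses_lt {k b N n : ℕ} (hn : 5 ≤ n) (hN : N ≤ n) (hb : b + 2 ≤ n) :
    numPasses k b N + 1 ≤ n ^ (k + 8) := by
  have hn0 : 0 < n := by omega
  have hmono : ∀ {i j}, i ≤ j → n ^ i ≤ n ^ j := fun h => Nat.pow_le_pow_right hn0 h
  have e2 : n ^ 2 = n * n := sq n
  have e3 : n ^ 3 = n ^ 2 * n := pow_succ n 2
  have h25 : 25 ≤ n ^ 2 := by nlinarith
  have h16 : 16 * n ≤ n ^ 3 := by rw [e3]; exact Nat.mul_le_mul_right n (by omega)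
  have h1 : 2 * N ≤ n ^ (k + 6) := le_trans (by nlinarith) (hmono (i := 2) (by omega))
  have h2 : 2 * (N * b) ≤ n ^ (k + 6) := by
    refine le_trans ?_ (hmono (i := 3) (by omega))
    have : N * b ≤ n * n := Nat.mul_le_mul hN (by omega)
    nlinarith
  have h3 : 3 * (N * N) ≤ n ^ (k + 6) := by
    refine le_trans ?_ (hmono (i := 3) (by omega))
    have : N * N ≤ n * n := Nat.mul_le_mul hN hN
    nlinarith
  have h4 : N * ((8 * (2 * b) + 9) * (2 * b + 1)) ≤ n ^ (k + 6) := by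
    refine le_trans ?_ (hmono (i := 6) (by omega))
    calc N * ((8 * (2 * b) + 9) * (2 * b + 1)) ≤ n * (n ^ 3 * n ^ 2) :=
          Nat.mul_le_mul hN (Nat.mul_le_mul (by omega) (by nlinarith))
      _ = n ^ 6 := by ring
  have h5 : 2 * N ^ k * (8 * (2 * b) + 7) ≤ n ^ (k + 6) := by
    refine le_trans ?_ (hmono (i := k + 4) (by omega))
    calc 2 * N ^ k * (8 * (2 * b) + 7) ≤ n * n ^ k * n ^ 3 :=
          Nat.mul_le_mul (Nat.mul_le_mul (by omega) (Nat.pow_le_pow_left hN k)) (by omega)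
      _ = n ^ (k + 4) := by ring
  have h6 : 1 ≤ n ^ (k + 6) := Nat.one_le_pow _ _ hn0
  have h7 : 7 * n ^ (k + 6) ≤ n ^ (k + 8) := by
    rw [show k + 8 = 2 + (k + 6) by omega, pow_add n 2]
    exact Nat.mul_le_mul_right _ (by omega)
  rw [numPasses]
  omega

theorem length_bound {k W r : ℕ} (hW : 3 ≤ W) (hr : r + 1 ≤ (W + 2) ^ (k + 8)) :
    20 * (r + 1) * (W + r * (6 * W + 1) + 1) ^ 2 < (W + 2) ^ (3 * k + 33) := by
  have h25 : 25 ≤ (W + 2) ^ 2 := by nlinarith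
  have h1 : W + r * (6 * W + 1) + 1 ≤ (r + 1) * (W + 2) ^ 3 := by
    have h2 : 6 * W + 1 ≤ (W + 2) ^ 3 := by
      rw [pow_succ]
      nlinarith
    calc W + r * (6 * W + 1) + 1 ≤ (r + 1) * (6 * W + 1) := by
          rw [Nat.add_mul]
          omega
      _ ≤ _ := Nat.mul_le_mul_left _ h2
  calc 20 * (r + 1) * (W + r * (6 * W + 1) + 1) ^ 2
      ≤ (W + 2) ^ 2 * (W + 2) ^ (k + 8) * ((W + 2) ^ (k + 8) * (W + 2) ^ 3) ^ 2 := by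
        refine Nat.mul_le_mul (Nat.mul_le_mul (by omega) hr) (Nat.pow_le_pow_left ?_ 2)
        exact h1.trans (Nat.mul_le_mul_right _ hr)
    _ = (W + 2) ^ (3 * k + 32) := by ring
    _ < (W + 2) ^ (3 * k + 33) := Nat.pow_lt_pow_right (by omega) (by omega)

/-- If `1` is a value of the start symbol, then the program has a short accepting execution. -/
theorem exists_program_run {k : ℕ} (hX : X.InCFG k) (hY : Y.map B.f = X.map some)
    (hv : Val X X.start 1) : ∃ v ∈ program,
      v.length < ((inputWord b c (Y.map List.ofFn).encode).length + 2) ^ (3 * k + 33) ∧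
      ∃ m, Exec B v (.init (inputWord b c (Y.map List.ofFn).encode)) m := by
  obtain ⟨r, hr, db, hg, x, hx, hdb⟩ := can_goal hX (knows_initFacts hY) hv
  obtain ⟨z, hz⟩ := (B.id_spec x 1 hx).1 rfl
  obtain ⟨v, hvp, hvl, hm⟩ := program_complete (c := c) Y hg hdb hz rfl
  refine ⟨v, hvp, hvl.trans_lt (length_bound ?_ ?_), hm⟩
  · rw [length_inputWord]
    omega
  · have hN : X.nonterminals = Y.nonterminals := by
      rw [← nonterminals_map B.f Y, hY, nonterminals_map]
    have hN' := card_nonterminals_le Y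
    rw [← hN] at hN'
    have hlen := length_inputWord (c := c) Y
    exact (Nat.add_le_add_right hr 1).trans
      (numPasses_lt (by omega) (by omega) (by omega))

end

end BlackBoxGroups

theorem theorem4p2 (k : ℕ) (hk : 1 ≤ k) :
    BlackBoxGroups.InNPForBlackBoxGroups (BlackBoxGroups.cfMembership k) := by
  open BlackBoxGroups in
  refine inNP_of_program (cfMembership k) program isRegular_program (3 * k + 33) ?_ ?_
  · intro G _ _ b c B X Y hY _ v hv m hm
    exact val_start_iff.1 (val_of_program hY hv hm)
  · intro G _ _ b c B X Y hY hX h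
    exact exists_program_run hX hY (val_start_iff.2 h)
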